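/- Let $q\in\mathbb C$ with $q\neq 0$ and $|q|\neq 1$, write $q^x=\exp(x\,\mathrm{Log}\,q)$ for real $x$ (principal logarithm), and put $[x]_q=\frac{q^x-q^{-x}}{q-q^{-1}}$ and $\sigma_m^{(g)}=[m+g-\frac12]_q-(-1)^m[g-\frac12]_q$; square roots are principal. Let $\mathfrak{osp}_q(1|2)$ be the unital associative algebra generated by $A_+,A_-,K,K^{-1},P$ with $KA_\pm K^{-1}=q^{\pm1/2}A_\pm$, $A_+A_-+A_-A_+=\frac{K^2-K^{-2}}{q^{1/2}-q^{-1/2}}$, $PA_\pm+A_\pm P=0$, $PK^{\pm1}=K^{\pm1}P$, $KK^{-1}=K^{-1}K=1$, $P^2=1$, with Casimir element $\Gamma^q=\left(-A_+A_-+\frac{q^{-1/2}K^2-q^{1/2}K^{-2}}{q-q^{-1}}\right)P$ and coproduct $\Delta(A_\pm)=A_\pm\otimes KP+K^{-1}\otimes A_\pm$, $\Delta(K^{\pm1})=K^{\pm1}\otimes K^{\pm1}$, $\Delta(P)=P\otimes P$; $\Delta^{(1)}=\mathrm{id}$ and $\Delta^{(m)}$ is the $m$-factor iterated coproduct. For $g>\frac12$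 let $W^{(g)}$ be the complex vector space with basis $|m\rangle_g$, $m\in\mathbb N=\{0,1,2,\dots\}$, and action $A_+|m\rangle_g=\sqrt{\sigma_{m+1}^{(g)}}\,|m+1\rangle_g$, $A_-|m\rangle_g=\sqrt{\sigma_m^{(g)}}\,|m-1\rangle_g$, $K|m\rangle_g=q^{(m+g)/2}|m\rangle_g$, $P|m\rangle_g=(-1)^m|m\rangle_g$ (note $\sigma_0^{(g)}=0$). Let $i,r\ge1$ and $n\ge i+r$ be integers, put $d=n-i-r$, let $\gamma_1,\dots,\gamma_n>\frac12$ be real, and let $\mathcal W=W^{(\gamma_1)}\otimes\cdots\otimes W^{(\gamma_n)}$ (algebraic tensor product), with the Hermitian inner product for which the vectors $|\nu_1\rangle\otimes\cdots\otimes|\nu_n\rangle$ are orthonormal. Write $[a;b]=\{a,\dots,b\}$, $\gamma_{[a;b]}=\gamma_a+\cdots+\gamma_b$, and $|\mathbf j_m|=j_1+\cdots+j_m$ for a finite sequence $\mathbf j=(j_1,j_2,\dots)$ of natural numbers. For $x\in\mathfrak{osp}_q(1|2)$ let $x_{[a;b]}=1^{\otimes(a-1)}\otimes\Delta^{(b-a+1)}(x)\otimes1^{\otimes(n-b)}$;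 $\Gamma^q_{[a;b]}$ denotes $(\Gamma^q)_{[a;b]}$. The same notation is used on shorter products. Vectors. For a finite sequence $\mathbf j$, parameters $\gamma$, $m\ge2$ and $0\le k\le j_{m-1}$ put $$c_k^{(m)}(\mathbf j)=(-1)^{k(j_{m-1}+\frac{k-1}2)}q^{-\frac k2(|\mathbf j_{m-1}|+\gamma_{[1;m]}-1)}\prod_{\ell=0}^{k-1}\frac{\sqrt{\sigma^{(\gamma_m)}_{j_{m-1}-\ell}}}{\sigma_{\ell+1}^{(|\mathbf j_{m-2}|+\gamma_{[1;m-1]})}}.$$ Define $\psi^{(1)}(p)=\prod_{\ell=1}^p\sqrt{\sigma_\ell^{(\gamma_1)}}\,|p\rangle_{\gamma_1}$ and, for $m\ge2$, $\psi^{(m)}(h_1,\dots,h_{m-1},p)=(A_+)_{[1;m]}^p\sum_{k=0}^{h_{m-1}}c^{(m)}_k(\mathbf h)\,\psi^{(m-1)}(h_1,\dots,h_{m-2},k)\otimes|h_{m-1}-k\rangle_{\gamma_m}$. Let $\varphi^{(r)}(k_1,\dots,k_{r-1},p)\in W^{(\gamma_{i+1})}\otimes\cdots\otimes W^{(\gamma_{i+r})}$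 be the vector obtained by the same construction from the parameters $\gamma_{i+1},\dots,\gamma_{i+r}$. For $\mathbf h\in\mathbb N^{i-1}$, $\mathbf k\in\mathbb N^{r-1}$, $s,t\in\mathbb N$ let $$\Psi(\mathbf h,\mathbf k,s,t)=(A_+)_{[1;i+r]}^t\sum_{p=0}^s(-1)^p\frac{\beta_{s-p+1}\cdots\beta_s}{\alpha_1\cdots\alpha_p}\,\psi^{(i)}(\mathbf h,p)\otimes\varphi^{(r)}(\mathbf k,s-p),$$ $$\alpha_p=(-1)^{|\mathbf k|+s-p}q^{\frac12(\gamma_{[i+1;i+r]}+s-p+|\mathbf k|)}\sigma_p^{(|\mathbf h|+\gamma_{[1;i]})},\qquad \beta_p=q^{-\frac12(\gamma_{[1;i]}+s-p+|\mathbf h|)}\sigma_p^{(|\mathbf k|+\gamma_{[i+1;i+r]})}.$$ Set $\Theta(j_1,\dots,j_{i+r-1},N)=\Psi\big((j_1,\dots,j_{i-1}),(j_i,\dots,j_{i+r-2}),j_{i+r-1},N\big)$ on $i+r$ factors and recursively, for $m>i+r$, $$\Theta(j_1,\dots,j_{m-1},N)=(A_+)_{[1;m]}^N\sum_{k=0}^{j_{m-1}}c_k^{(m)}(\mathbf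 j)\,\Theta(j_1,\dots,j_{m-2},k)\otimes|j_{m-1}-k\rangle_{\gamma_m}.$$ For $\mathbf j\in\mathbb N^{n-1}$, $N\in\mathbb N$ let $|\mathbf j;N\rangle=\Theta(\mathbf j,N)/\|\Theta(\mathbf j,N)\|\in\mathcal W$ (this is $|\mathbf j^{(i,r)};N\rangle$). Spaces. For $\mathbf p\in\mathbb N^{d}$, $N\in\mathbb N$ let $V_{N,\mathbf p}$ be the joint eigenspace in $\mathcal W$ of $\Gamma^q_{[1;i+r+m]}$ with eigenvalue $(-1)^{|\mathbf p_{m+1}|}[|\mathbf p_{m+1}|+\gamma_{[1;i+r+m]}-\frac12]_q$ for $0\le m\le d-1$, and of $K_{[1;n]}$ with eigenvalue $q^{\frac12(N+|\mathbf p|+\gamma_{[1;n]})}$. Let $\mathcal B_{\mathbf p,N}$ be the set of all vectors $\Theta(j_1,\dots,j_{i+r-2},p_1-|\mathbf j_{i+r-2}|,p_2,\dots,p_d,\ell,N-\ell)$ with $|\mathbf j_{i+r-2}|\le p_1$, $\ell\le N$ if $d>0$, and the set of all $\Theta(\mathbf j,N-|\mathbf j|)$ with $\mathbf j\in\mathbb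 N^{n-1}$, $|\mathbf j|\le N$ if $d=0$. For $\mathbf j\in\mathbb N^{n-1}$, $N\in\mathbb N$ let $Z_{N,\mathbf j}$ be the joint eigenspace of $\Gamma^q_{[1;m]}$ with eigenvalue $(-1)^{|\mathbf j_{m-1}|}[|\mathbf j_{m-1}|+\gamma_{[1;m]}-\frac12]_q$ for $m\in\{2,\dots,i\}\cup\{i+r,\dots,n\}$, of $\Gamma^q_{[i+1;i+m]}$ with eigenvalue $(-1)^{a_m}[a_m+\gamma_{[i+1;i+m]}-\frac12]_q$, $a_m=|\mathbf j_{i+m-2}|-|\mathbf j_{i-1}|$, for $2\le m\le r$, and of $K_{[1;n]}$ with eigenvalue $q^{\frac12(N+|\mathbf j|+\gamma_{[1;n]})}$. Then: 1. The vectors $|\mathbf j;N\rangle$, $\mathbf j\in\mathbb N^{n-1}$, $N\in\mathbb N$, have norm $1$ and form a (Hamel) basis of $\mathcal W$; if $q$ is a positive real number, this basis is orthonormal. 2. $\mathcal W=\bigoplus_{\mathbf p\in\mathbb N^{d}}\bigoplus_{N\in\mathbb N}V_{N,\mathbf p}$, and for all $\mathbf p,N$ the set $\mathcal B_{\mathbf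 p,N}$ is a basis of $V_{N,\mathbf p}$, which is orthogonal if $q$ is a positive real number. 3. $\mathcal W=\bigoplus_{\mathbf j\in\mathbb N^{n-1}}\bigoplus_{N\in\mathbb N}Z_{N,\mathbf j}$, each $Z_{N,\mathbf j}$ is one-dimensional and spanned by $|\mathbf j;N\rangle$, and hence every $v\in Z_{N,\mathbf j}$ of norm $1$ equals $c\,|\mathbf j;N\rangle$ for some $c\in\mathbb C$ with $|c|=1$. -/

import Mathlib

open scoped TensorProduct

namespace QBI

noncomputable section

/-! ### The deformation parameter and `q`-numbers -/

/-- A deformation parameter: a complex number `q ≠ 0` with `|q| ≠ 1`. -/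
structure QParam where
  val : ℂ
  ne_zero : val ≠ 0
  norm_ne_one : ‖val‖ ≠ 1

/-- `q ^ x` for real `x` (principal branch). -/
def qpow (q : QParam) (x : ℝ) : ℂ := q.val ^ (x : ℂ)

/-- The `q`-number `[x]_q`. -/
def qnum (q : QParam) (x : ℝ) : ℂ := (qpow q x - qpow q (-x)) / (q.val - q.val⁻¹)

/-- The number `σ_m^{(g)} = [m + g - 1/2]_q - (-1)^m [g - 1/2]_q`. -/
def sigma (q : QParam) (m : ℕ) (g : ℝ) : ℂ :=
  qnum q (m + g - 1 / 2) - (-1) ^ m * qnum q (g - 1 / 2)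

/-- The principal square root of `σ_m^{(g)}`. -/
def sqrtSigma (q : QParam) (m : ℕ) (g : ℝ) : ℂ := sigma q m g ^ (1 / 2 : ℂ)

lemma qpow_add (q : QParam) (x y : ℝ) : qpow q (x + y) = qpow q x * qpow q y := by
  unfold qpow
  push_cast
  exact Complex.cpow_add _ _ q.ne_zero

lemma qpow_zero (q : QParam) : qpow q 0 = 1 := by simp [qpow]

lemma qpow_one (q : QParam) : qpow q 1 = q.val := by simp [qpow]

lemma qpow_neg_one (q : QParam) : qpow q (-1) = q.val⁻¹ := by
  unfold qpow
  push_cast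
  rw [Complex.cpow_neg, Complex.cpow_one]

lemma qpow_ne_zero (q : QParam) (x : ℝ) : qpow q x ≠ 0 := by
  unfold qpow
  simp [Complex.cpow_eq_zero_iff, q.ne_zero]

lemma qpow_mul_neg (q : QParam) (x : ℝ) : qpow q x * qpow q (-x) = 1 := by
  rw [← qpow_add, add_neg_cancel, qpow_zero]

lemma qpow_neg_mul (q : QParam) (x : ℝ) : qpow q (-x) * qpow q x = 1 := by
  rw [← qpow_add, neg_add_cancel, qpow_zero]

lemma sub_inv_ne_zero (q : QParam) : q.val - q.val⁻¹ ≠ 0 := by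
  intro h
  have h1 : q.val * q.val = 1 := by
    have h2 : q.val = q.val⁻¹ := sub_eq_zero.mp h
    nth_rewrite 2 [h2]
    exact mul_inv_cancel₀ q.ne_zero
  have h3 : ‖q.val‖ * ‖q.val‖ = 1 := by rw [← norm_mul, h1, norm_one]
  apply q.norm_ne_one
  nlinarith [norm_nonneg q.val]

lemma half_sub_ne_zero (q : QParam) : qpow q (1 / 2) - qpow q (-(1 / 2)) ≠ 0 := by
  intro h
  apply sub_inv_ne_zero q
  have h1 : qpow q (1 / 2) * qpow q (1 / 2) = q.val := by
    rw [← qpow_add, ← qpow_one]; norm_num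
  have h2 : qpow q (-(1 / 2)) * qpow q (-(1 / 2)) = q.val⁻¹ := by
    rw [← qpow_add, ← qpow_neg_one]; norm_num
  rw [← h2, ← h1]
  linear_combination (qpow q (1 / 2) + qpow q (-(1 / 2))) * h

lemma sqrtSigma_mul_self (q : QParam) (m : ℕ) (g : ℝ) :
    sqrtSigma q m g * sqrtSigma q m g = sigma q m g := by
  unfold sqrtSigma
  rw [← pow_two, ← Complex.cpow_nat_mul]
  simp

lemma sigma_zero (q : QParam) (g : ℝ) : sigma q 0 g = 0 := by simp [sigma]

lemma sqrtSigma_zero (q : QParam) (g : ℝ) : sqrtSigma q 0 g = 0 := by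
  simp [sqrtSigma, sigma_zero]

lemma sigma_add_sigma (q : QParam) (m : ℕ) (g : ℝ) :
    sigma q m g + sigma q (m + 1) g =
      (qpow q (1 / 2) - qpow q (-(1 / 2)))⁻¹ * (qpow q (m + g) - qpow q (-(m + g))) := by
  have hd := half_sub_ne_zero q
  have e1 : q.val - q.val⁻¹ = (qpow q (1 / 2) - qpow q (-(1 / 2))) *
      (qpow q (1 / 2) + qpow q (-(1 / 2))) := by
    have h1 : qpow q (1 / 2) * qpow q (1 / 2) = q.val := by
      rw [← qpow_add, ← qpow_one]; norm_num
    have h2 : qpow q (-(1 / 2)) * qpow q (-(1 / 2)) = q.val⁻¹ := by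
      rw [← qpow_add, ← qpow_neg_one]; norm_num
    linear_combination -h1 + h2
  have hs : qpow q (1 / 2) + qpow q (-(1 / 2)) ≠ 0 := by
    intro h
    apply sub_inv_ne_zero q
    rw [e1, h, mul_zero]
  have a1 : qpow q (m + g - 1 / 2) = qpow q (m + g) * qpow q (-(1 / 2)) := by
    rw [← qpow_add]; congr 1
  have a2 : qpow q (-(m + g - 1 / 2)) = qpow q (-(m + g)) * qpow q (1 / 2) := by
    rw [← qpow_add]; congr 1; ring
  have a3 : qpow q (m + 1 + g - 1 / 2) = qpow q (m + g) * qpow q (1 / 2) := by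
    rw [← qpow_add]; congr 1; ring
  have a4 : qpow q (-(m + 1 + g - 1 / 2)) = qpow q (-(m + g)) * qpow q (-(1 / 2)) := by
    rw [← qpow_add]; congr 1; ring
  unfold sigma qnum
  push_cast
  rw [a1, a2, a3, a4, e1]
  field_simp
  ring

/-! ### The quantum superalgebra `osp_q(1|2)` -/

/-- The generators `A₊, A₋, K, K⁻¹, P`. -/
inductive Gen
  | Ap | Am | K | Kinv | P

/-- The defining relations of `osp_q(1|2)`, for five elements of an algebra. -/
structure OspRel (q : QParam) {A : Type*} [Ring A] [Algebra ℂ A] (Ap Am K Kinv P : A) : Prop where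
  K_Ap : K * Ap * Kinv = qpow q (1 / 2) • Ap
  K_Am : K * Am * Kinv = qpow q (-(1 / 2)) • Am
  Ap_Am : Ap * Am + Am * Ap = (qpow q (1 / 2) - qpow q (-(1 / 2)))⁻¹ • (K ^ 2 - Kinv ^ 2)
  P_Ap : P * Ap + Ap * P = 0
  P_Am : P * Am + Am * P = 0
  P_K : P * K = K * P
  P_Kinv : P * Kinv = Kinv * P
  K_Kinv : K * Kinv = 1
  Kinv_K : Kinv * K = 1
  P_P : P ^ 2 = 1

open FreeAlgebra in
/-- The same relations on the free algebra on the generators. -/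
inductive Rel (q : QParam) : FreeAlgebra ℂ Gen → FreeAlgebra ℂ Gen → Prop
  | K_Ap : Rel q (ι ℂ .K * ι ℂ .Ap * ι ℂ .Kinv) (qpow q (1 / 2) • ι ℂ .Ap)
  | K_Am : Rel q (ι ℂ .K * ι ℂ .Am * ι ℂ .Kinv) (qpow q (-(1 / 2)) • ι ℂ .Am)
  | Ap_Am : Rel q (ι ℂ .Ap * ι ℂ .Am + ι ℂ .Am * ι ℂ .Ap)
      ((qpow q (1 / 2) - qpow q (-(1 / 2)))⁻¹ • (ι ℂ .K ^ 2 - ι ℂ .Kinv ^ 2))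
  | P_Ap : Rel q (ι ℂ .P * ι ℂ .Ap + ι ℂ .Ap * ι ℂ .P) 0
  | P_Am : Rel q (ι ℂ .P * ι ℂ .Am + ι ℂ .Am * ι ℂ .P) 0
  | P_K : Rel q (ι ℂ .P * ι ℂ .K) (ι ℂ .K * ι ℂ .P)
  | P_Kinv : Rel q (ι ℂ .P * ι ℂ .Kinv) (ι ℂ .Kinv * ι ℂ .P)
  | K_Kinv : Rel q (ι ℂ .K * ι ℂ .Kinv) 1
  | Kinv_K : Rel q (ι ℂ .Kinv * ι ℂ .K) 1
  | P_P : Rel q (ι ℂ .P ^ 2) 1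

/-- The algebra `osp_q(1|2)`. -/
abbrev Osp (q : QParam) : Type := RingQuot (Rel q)

/-- The generators as elements of `osp_q(1|2)`. -/
def Osp.gen (q : QParam) (x : Gen) : Osp q := RingQuot.mkAlgHom ℂ (Rel q) (FreeAlgebra.ι ℂ x)

lemma Osp.rel (q : QParam) :
    OspRel q (gen q .Ap) (gen q .Am) (gen q .K) (gen q .Kinv) (gen q .P) where
  K_Ap := by simpa [gen] using RingQuot.mkAlgHom_rel ℂ (Rel.K_Ap (q := q))
  K_Am := by simpa [gen] using RingQuot.mkAlgHom_rel ℂ (Rel.K_Am (q := q))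
  Ap_Am := by simpa only [gen, map_mul, map_add, map_smul, map_sub, map_pow] using
    RingQuot.mkAlgHom_rel ℂ (Rel.Ap_Am (q := q))
  P_Ap := by simpa [gen] using RingQuot.mkAlgHom_rel ℂ (Rel.P_Ap (q := q))
  P_Am := by simpa [gen] using RingQuot.mkAlgHom_rel ℂ (Rel.P_Am (q := q))
  P_K := by simpa [gen] using RingQuot.mkAlgHom_rel ℂ (Rel.P_K (q := q))
  P_Kinv := by simpa [gen] using RingQuot.mkAlgHom_rel ℂ (Rel.P_Kinv (q := q))
  K_Kinv := by simpa [gen] using RingQuot.mkAlgHom_rel ℂ (Rel.K_Kinv (q := q))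
  Kinv_K := by simpa [gen] using RingQuot.mkAlgHom_rel ℂ (Rel.Kinv_K (q := q))
  P_P := by simpa [gen] using RingQuot.mkAlgHom_rel ℂ (Rel.P_P (q := q))

/-- Images for the five generators. -/
def genImage {A : Type*} (Ap Am K Kinv P : A) : Gen → A
  | .Ap => Ap
  | .Am => Am
  | .K => K
  | .Kinv => Kinv
  | .P => P

/-- The algebra morphism out of `osp_q(1|2)` determined by the images of the generators. -/
def Osp.lift (q : QParam) {A : Type*} [Ring A] [Algebra ℂ A] {Ap Am K Kinv P : A}
    (h : OspRel q Ap Am K Kinv P) : Osp q →ₐ[ℂ] A :=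
  RingQuot.liftAlgHom ℂ ⟨FreeAlgebra.lift ℂ (genImage Ap Am K Kinv P), by
    intro x y hxy
    cases hxy
    · simpa [genImage] using h.K_Ap
    · simpa [genImage] using h.K_Am
    · simpa only [map_mul, map_add, map_smul, map_sub, map_pow, FreeAlgebra.lift_ι_apply,
        genImage] using h.Ap_Am
    · simpa [genImage] using h.P_Ap
    · simpa [genImage] using h.P_Am
    · simpa [genImage] using h.P_K
    · simpa [genImage] using h.P_Kinv
    · simpa [genImage] using h.K_Kinv
    · simpa [genImage] using h.Kinv_K
    · simpa [genImage] using h.P_P⟩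

lemma Osp.lift_gen (q : QParam) {A : Type*} [Ring A] [Algebra ℂ A] {Ap Am K Kinv P : A}
    (h : OspRel q Ap Am K Kinv P) (x : Gen) :
    Osp.lift q h (Osp.gen q x) = genImage Ap Am K Kinv P x := by
  unfold Osp.lift Osp.gen
  rw [RingQuot.liftAlgHom_mkAlgHom_apply, FreeAlgebra.lift_ι_apply]

/-- The Casimir element `Γ^q`. -/
def casimir (q : QParam) : Osp q :=
  (-(Osp.gen q .Ap * Osp.gen q .Am) +
    (q.val - q.val⁻¹)⁻¹ • (qpow q (-(1 / 2)) • Osp.gen q .K ^ 2 -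
      qpow q (1 / 2) • Osp.gen q .Kinv ^ 2)) * Osp.gen q .P

lemma OspRel.K_Ap' {q : QParam} {A : Type*} [Ring A] [Algebra ℂ A] {Ap Am K Kinv P : A}
    (h : OspRel q Ap Am K Kinv P) : K * Ap = qpow q (1 / 2) • (Ap * K) := by
  have := congrArg (· * K) h.K_Ap
  simpa [mul_assoc, h.Kinv_K] using this

lemma OspRel.K_Am' {q : QParam} {A : Type*} [Ring A] [Algebra ℂ A] {Ap Am K Kinv P : A}
    (h : OspRel q Ap Am K Kinv P) : K * Am = qpow q (-(1 / 2)) • (Am * K) := by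
  have := congrArg (· * K) h.K_Am
  simpa [mul_assoc, h.Kinv_K] using this

lemma OspRel.Kinv_Ap' {q : QParam} {A : Type*} [Ring A] [Algebra ℂ A] {Ap Am K Kinv P : A}
    (h : OspRel q Ap Am K Kinv P) : Kinv * Ap = qpow q (-(1 / 2)) • (Ap * Kinv) := by
  have h1 : Ap * Kinv = qpow q (1 / 2) • (Kinv * Ap) := by
    have := congrArg (Kinv * ·) h.K_Ap
    simpa [← mul_assoc, h.Kinv_K] using this
  rw [h1, smul_smul, qpow_neg_mul, one_smul]

lemma OspRel.Kinv_Am' {q : QParam} {A : Type*} [Ring A] [Algebra ℂ A] {Ap Am K Kinv P : A}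
    (h : OspRel q Ap Am K Kinv P) : Kinv * Am = qpow q (1 / 2) • (Am * Kinv) := by
  have h1 : Am * Kinv = qpow q (-(1 / 2)) • (Kinv * Am) := by
    have := congrArg (Kinv * ·) h.K_Am
    simpa [← mul_assoc, h.Kinv_K] using this
  rw [h1, smul_smul, qpow_mul_neg, one_smul]

/-- The counit: `A± ↦ 0`, `K^{±1} ↦ 1`, `P ↦ 1`. -/
def counit (q : QParam) : Osp q →ₐ[ℂ] ℂ :=
  Osp.lift q (Ap := 0) (Am := 0) (K := 1) (Kinv := 1) (P := 1) (by constructor <;> simp)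

lemma OspRel.comul {q : QParam} {A : Type*} [Ring A] [Algebra ℂ A] {Ap Am K Ki P : A}
    (h : OspRel q Ap Am K Ki P) :
    OspRel q (A := A ⊗[ℂ] A) (Ap ⊗ₜ (K * P) + Ki ⊗ₜ Ap) (Am ⊗ₜ (K * P) + Ki ⊗ₜ Am)
      (K ⊗ₜ K) (Ki ⊗ₜ Ki) (P ⊗ₜ P) := by
  have hPAp : P * Ap = -(Ap * P) := eq_neg_of_add_eq_zero_left h.P_Ap
  have hPAm : P * Am = -(Am * P) := eq_neg_of_add_eq_zero_left h.P_Am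
  have hKP : K * P * Ki = P := by rw [← h.P_K, mul_assoc, h.K_Kinv, mul_one]
  have hPP : P * P = 1 := by rw [← pow_two, h.P_P]
  have hKPKP : K * P * (K * P) = K ^ 2 := by
    rw [mul_assoc, ← mul_assoc P K P, h.P_K, mul_assoc K P P, hPP, mul_one, pow_two]
  have c1 : Ki * Ap = qpow q (-(1 / 2)) • (Ap * Ki) := h.Kinv_Ap'
  have c2 : Ki * Am = qpow q (1 / 2) • (Am * Ki) := h.Kinv_Am'
  have c3 : K * P * Ap = -(qpow q (1 / 2) • (Ap * (K * P))) := by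
    rw [mul_assoc, hPAp, mul_neg, ← mul_assoc, h.K_Ap', smul_mul_assoc, mul_assoc]
  have c4 : K * P * Am = -(qpow q (-(1 / 2)) • (Am * (K * P))) := by
    rw [mul_assoc, hPAm, mul_neg, ← mul_assoc, h.K_Am', smul_mul_assoc, mul_assoc]
  have c5 : P * (K * P) = K := by rw [← mul_assoc, h.P_K, mul_assoc, hPP, mul_one]
  have c6 : K * P * P = K := by rw [mul_assoc, hPP, mul_one]
  refine ⟨?_, ?_, ?_, ?_, ?_, ?_, ?_, ?_, ?_, ?_⟩
  · simp only [mul_add, add_mul, Algebra.TensorProduct.tmul_mul_tmul, h.K_Ap, h.K_Kinv, one_mul,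
      smul_add]
    rw [mul_assoc K (K * P) Ki, hKP, TensorProduct.smul_tmul', TensorProduct.tmul_smul]
  · simp only [mul_add, add_mul, Algebra.TensorProduct.tmul_mul_tmul, h.K_Am, h.K_Kinv, one_mul,
      smul_add]
    rw [mul_assoc K (K * P) Ki, hKP, TensorProduct.smul_tmul', TensorProduct.tmul_smul]
  · have e : (Ap * Am) ⊗ₜ[ℂ] (K ^ 2) + (Am * Ap) ⊗ₜ[ℂ] (K ^ 2) + ((Ki ^ 2) ⊗ₜ[ℂ] (Ap * Am) +
        (Ki ^ 2) ⊗ₜ[ℂ] (Am * Ap)) =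
        (qpow q (1 / 2) - qpow q (-(1 / 2)))⁻¹ • ((K ^ 2) ⊗ₜ[ℂ] (K ^ 2) - (Ki ^ 2) ⊗ₜ[ℂ] (Ki ^ 2)) := by
      rw [← TensorProduct.add_tmul, ← TensorProduct.tmul_add, h.Ap_Am]
      simp only [TensorProduct.smul_tmul', TensorProduct.tmul_smul, TensorProduct.sub_tmul,
        TensorProduct.tmul_sub, smul_sub]
      abel
    simp only [mul_add, add_mul, Algebra.TensorProduct.tmul_mul_tmul,
      Algebra.TensorProduct.tmul_pow, hKPKP, ← pow_two]
    rw [← e, c1, c2, c3, c4]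
    simp only [TensorProduct.tmul_neg, TensorProduct.smul_tmul', TensorProduct.tmul_smul]
    abel
  · simp only [mul_add, add_mul, Algebra.TensorProduct.tmul_mul_tmul, hPAp, c5, c6, h.P_Kinv,
      TensorProduct.neg_tmul, TensorProduct.tmul_neg]
    abel
  · simp only [mul_add, add_mul, Algebra.TensorProduct.tmul_mul_tmul, hPAm, c5, c6, h.P_Kinv,
      TensorProduct.neg_tmul, TensorProduct.tmul_neg]
    abel
  · simp [h.P_K]
  · simp [h.P_Kinv]
  · simp [h.K_Kinv, Algebra.TensorProduct.one_def]
  · simp [h.Kinv_K, Algebra.TensorProduct.one_def]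
  · simp [Algebra.TensorProduct.tmul_pow, h.P_P, Algebra.TensorProduct.one_def]

/-- The coproduct `Δ(A±) = A± ⊗ K P + K⁻¹ ⊗ A±`, `Δ(K^{±1}) = K^{±1} ⊗ K^{±1}`, `Δ(P) = P ⊗ P`. -/
def comul (q : QParam) : Osp q →ₐ[ℂ] Osp q ⊗[ℂ] Osp q := Osp.lift q (Osp.rel q).comul

/-! ### The modules `W^(g)` and their tensor products -/

/-- The underlying space of every `W^(g)`: the span of the vectors `|m⟩`, `m ∈ ℕ`. -/
abbrev W : Type := ℕ →₀ ℂ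

/-- The basis vector `|m⟩`. -/
def basisKet (m : ℕ) : W := Finsupp.single m 1

/-- `A₊|m⟩ = √σ_{m+1} |m+1⟩`. -/
def raising (q : QParam) (g : ℝ) : Module.End ℂ W :=
  Finsupp.linearCombination ℂ fun m => sqrtSigma q (m + 1) g • basisKet (m + 1)

/-- `A₋|m⟩ = √σ_m |m-1⟩`; here `√σ_0 = 0`. -/
def lowering (q : QParam) (g : ℝ) : Module.End ℂ W :=
  Finsupp.linearCombination ℂ fun m => sqrtSigma q m g • basisKet (m - 1)

/-- `K|m⟩ = q^{(m+g)/2} |m⟩`. -/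
def weight (q : QParam) (g : ℝ) : Module.End ℂ W :=
  Finsupp.linearCombination ℂ fun m => qpow q ((m + g) / 2) • basisKet m

/-- `K⁻¹|m⟩ = q^{-(m+g)/2} |m⟩`. -/
def weightInv (q : QParam) (g : ℝ) : Module.End ℂ W :=
  Finsupp.linearCombination ℂ fun m => qpow q (-((m + g) / 2)) • basisKet m

/-- `P|m⟩ = (-1)^m |m⟩`. -/
def parity : Module.End ℂ W :=
  Finsupp.linearCombination ℂ fun m => (-1 : ℂ) ^ m • basisKet m

lemma raising_ket (q : QParam) (g : ℝ) (m : ℕ) :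
    raising q g (basisKet m) = sqrtSigma q (m + 1) g • basisKet (m + 1) := by
  simp [raising, basisKet]

lemma lowering_ket (q : QParam) (g : ℝ) (m : ℕ) :
    lowering q g (basisKet m) = sqrtSigma q m g • basisKet (m - 1) := by
  simp [lowering, basisKet]

lemma weight_ket (q : QParam) (g : ℝ) (m : ℕ) :
    weight q g (basisKet m) = qpow q ((m + g) / 2) • basisKet m := by
  simp [weight, basisKet]

lemma weightInv_ket (q : QParam) (g : ℝ) (m : ℕ) :
    weightInv q g (basisKet m) = qpow q (-((m + g) / 2)) • basisKet m := by
  simp [weightInv, basisKet]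

lemma parity_ket (m : ℕ) : parity (basisKet m) = (-1 : ℂ) ^ m • basisKet m := by
  simp [parity, basisKet]

lemma end_ext {f g : Module.End ℂ W} (h : ∀ m, f (basisKet m) = g (basisKet m)) : f = g :=
  Finsupp.lhom_ext' fun m => LinearMap.ext_ring (h m)

lemma rep_rel (q : QParam) (g : ℝ) :
    OspRel q (raising q g) (lowering q g) (weight q g) (weightInv q g) parity := by
  refine ⟨?_, ?_, ?_, ?_, ?_, ?_, ?_, ?_, ?_, ?_⟩ <;> refine end_ext fun m => ?_
  · simp only [Module.End.mul_apply, weightInv_ket, map_smul, raising_ket, weight_ket,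
      LinearMap.smul_apply, smul_smul]
    congr 1
    have : qpow q ((((m + 1 : ℕ) : ℝ) + g) / 2) = qpow q ((m + g) / 2) * qpow q (1 / 2) := by
      rw [← qpow_add]; congr 1; push_cast; ring
    rw [this]
    linear_combination (sqrtSigma q (m + 1) g * qpow q (1 / 2)) * qpow_neg_mul q ((m + g) / 2)
  · simp only [Module.End.mul_apply, weightInv_ket, map_smul, lowering_ket, weight_ket,
      LinearMap.smul_apply, smul_smul]
    rcases m with _ | m
    · simp [sqrtSigma_zero]
    · congr 1
      have : qpow q (((m + 1 - 1 : ℕ) + g) / 2) =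
          qpow q (((m + 1 : ℕ) + g) / 2) * qpow q (-(1 / 2)) := by
        rw [← qpow_add]; congr 1; push_cast [Nat.add_sub_cancel]; ring
      rw [this]
      linear_combination (sqrtSigma q (m + 1) g * qpow q (-(1 / 2))) *
        qpow_neg_mul q (((m + 1 : ℕ) + g) / 2)
  · have k1 : qpow q ((m + g) / 2) * qpow q ((m + g) / 2) = qpow q (m + g) := by
      rw [← qpow_add]; congr 1; ring
    have k2 : qpow q (-((m + g) / 2)) * qpow q (-((m + g) / 2)) = qpow q (-(m + g)) := by
      rw [← qpow_add]; congr 1; ring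
    have hR : (raising q g * lowering q g) (basisKet m) = sigma q m g • basisKet m := by
      rcases m with _ | m
      · simp [Module.End.mul_apply, lowering_ket, sqrtSigma_zero, sigma_zero]
      · simp only [Module.End.mul_apply, lowering_ket, map_smul, raising_ket, smul_smul,
          Nat.add_sub_cancel, sqrtSigma_mul_self]
    have hL : (lowering q g * raising q g) (basisKet m) = sigma q (m + 1) g • basisKet m := by
      simp only [Module.End.mul_apply, lowering_ket, map_smul, raising_ket, smul_smul,
        Nat.add_sub_cancel, sqrtSigma_mul_self]
    rw [LinearMap.add_apply, hR, hL, ← add_smul, sigma_add_sigma]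
    simp only [LinearMap.smul_apply, LinearMap.sub_apply, pow_two, Module.End.mul_apply,
      weight_ket, weightInv_ket, map_smul, smul_smul, k1, k2, ← sub_smul]
  · simp only [LinearMap.add_apply, Module.End.mul_apply, raising_ket, parity_ket, map_smul,
      smul_smul, ← add_smul, pow_succ, LinearMap.zero_apply]
    simp
    left; ring
  · simp only [LinearMap.add_apply, Module.End.mul_apply, lowering_ket, parity_ket, map_smul,
      smul_smul, ← add_smul, LinearMap.zero_apply]
    rcases m with _ | m
    · simp [sqrtSigma_zero]
    · simp [pow_succ]
      left; ring
  · simp [Module.End.mul_apply, weight_ket, parity_ket, smul_smul, mul_comm]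
  · simp [Module.End.mul_apply, weightInv_ket, parity_ket, smul_smul, mul_comm]
  · simp [Module.End.mul_apply, weightInv_ket, weight_ket, smul_smul, qpow_neg_mul]
  · simp [Module.End.mul_apply, weightInv_ket, weight_ket, smul_smul, qpow_mul_neg]
  · simp [pow_two, Module.End.mul_apply, parity_ket, smul_smul, ← mul_pow]

/-- The action of `osp_q(1|2)` on `W^(g)`. -/
def rep (q : QParam) (g : ℝ) : Osp q →ₐ[ℂ] Module.End ℂ W := Osp.lift q (rep_rel q g)

/-- The space underlying a tensor product of `n` modules `W^(g)`. -/
abbrev H (n : ℕ) : Type := ⨂[ℂ]^n W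

/-- The canonical isomorphism from `(W ⊗ ... ⊗ W) ⊗ W` (`n + 1` factors) to `H (n + 1)`. -/
def snocEquiv (n : ℕ) : H n ⊗[ℂ] W ≃ₗ[ℂ] H (n + 1) :=
  (TensorProduct.congr (LinearEquiv.refl ℂ (H n))
    (PiTensorProduct.subsingletonEquiv (R := ℂ) (s := fun _ : Fin 1 => W) (0 : Fin 1)).symm).trans
    TensorPower.mulEquiv

/-- `u ⊗ w` for `u` in the product of the first `n` factors and `w` in the last factor. -/
def snoc {n : ℕ} (u : H n) (w : W) : H (n + 1) := snocEquiv n (u ⊗ₜ[ℂ] w)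

/-- `u ⊗ v` for `u` in the product of the first `a` and `v` in that of the last `b` factors. -/
def tens {a b : ℕ} (u : H a) (v : H b) : H (a + b) := TensorPower.mulEquiv (u ⊗ₜ[ℂ] v)

/-- The action on `W^(γ 1) ⊗ ... ⊗ W^(γ n)` (the factors are numbered from `1`) of
`1^{⊗(a-1)} ⊗ Δ^{(b-a+1)}(x) ⊗ 1^{⊗(n-b)}`, where `x ∈ osp_q(1|2)` and `1 ≤ a ≤ b ≤ n`.
It is built one factor at a time: a factor in `[a;b]` is added through the coproduct, and on a
factor outside `[a;b]` the element acts by the identity. As long as no factor of `[a;b]` has been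
reached `x` acts through the counit, so that by the counit law the first factor of `[a;b]` simply
carries `x`. -/
def intervalRep (q : QParam) (γ : ℕ → ℝ) (a b : ℕ) : (n : ℕ) → Osp q →ₐ[ℂ] Module.End ℂ (H n)
  | 0 => (Algebra.ofId ℂ (Module.End ℂ (H 0))).comp (counit q)
  | n + 1 =>
    if a ≤ n + 1 ∧ n + 1 ≤ b then
      ((snocEquiv n).conjAlgEquiv ℂ).toAlgHom.comp
        ((Module.endTensorEndAlgHom (R := ℂ) (S := ℂ) (A := ℂ) (M := H n) (N := W)).comp
          ((Algebra.TensorProduct.map (intervalRep q γ a b n) (rep q (γ (n + 1)))).comp (comul q)))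
    else
      ((snocEquiv n).conjAlgEquiv ℂ).toAlgHom.comp
        ((Module.endTensorEndAlgHom (R := ℂ) (S := ℂ) (A := ℂ) (M := H n) (N := W)).comp
          (Algebra.TensorProduct.includeLeft.comp (intervalRep q γ a b n)))

/-- `(A₊)_{[1;n]}` on `W^(γ 1) ⊗ ... ⊗ W^(γ n)`. -/
def raisingOp (q : QParam) (γ : ℕ → ℝ) (n : ℕ) : Module.End ℂ (H n) :=
  intervalRep q γ 1 n n (Osp.gen q .Ap)

/-- `K_{[1;n]}` on `W^(γ 1) ⊗ ... ⊗ W^(γ n)`. -/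
def weightOp (q : QParam) (γ : ℕ → ℝ) (n : ℕ) : Module.End ℂ (H n) :=
  intervalRep q γ 1 n n (Osp.gen q .K)

/-- `Γ^q_{[a;b]}` on `W^(γ 1) ⊗ ... ⊗ W^(γ n)`. -/
def casimirOp (q : QParam) (γ : ℕ → ℝ) (n a b : ℕ) : Module.End ℂ (H n) :=
  intervalRep q γ a b n (casimir q)

/-- The basis `|ν_1⟩ ⊗ ... ⊗ |ν_n⟩` of the tensor product. -/
def tensorBasis (n : ℕ) : Module.Basis (Fin n → ℕ) ℂ (H n) :=
  Basis.piTensorProduct fun _ => Finsupp.basisSingleOne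

/-- The Hermitian inner product (antilinear in the first argument) for which the vectors
`|ν_1⟩ ⊗ ... ⊗ |ν_n⟩` are orthonormal. -/
def braket {n : ℕ} (u v : H n) : ℂ :=
  ((tensorBasis n).repr u).sum fun ν c => starRingEnd ℂ c * (tensorBasis n).repr v ν

/-! ### The vectors

Finite sequences of natural numbers are numbered from `1`; they are handled as functions on `ℕ`
of which only the relevant entries are used. -/

/-- A finite sequence `(j_1, ..., j_m)`, extended by zero. -/
def seq {m : ℕ} (j : Fin m → ℕ) (k : ℕ) : ℕ :=
  if h : 1 ≤ k ∧ k ≤ m then j ⟨k - 1, by omega⟩ else 0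

/-- `|j_m| = j_1 + ... + j_m`. -/
def psum (j : ℕ → ℕ) (m : ℕ) : ℕ := ∑ k ∈ Finset.Icc 1 m, j k

/-- `γ_{[a;b]} = γ_a + ... + γ_b`. -/
def gsum (γ : ℕ → ℝ) (a b : ℕ) : ℝ := ∑ k ∈ Finset.Icc a b, γ k

/-- The coefficient of `k` in the extension from `n - 1` to `n` factors. -/
def coef (q : QParam) (γ : ℕ → ℝ) (j : ℕ → ℕ) (n k : ℕ) : ℂ :=
  (-1) ^ (k * j (n - 1) + k * (k - 1) / 2) *
    qpow q (-((k : ℝ) / 2) * ((psum j (n - 1) : ℝ) + gsum γ 1 n - 1)) *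
    ∏ l ∈ Finset.range k,
      sqrtSigma q (j (n - 1) - l) (γ n) / sigma q (l + 1) ((psum j (n - 2) : ℝ) + gsum γ 1 (n - 1))

/-- The vectors `ψ^{(i)}(h_1, ..., h_{i-1}, p)` for the parameters `γ 1, ..., γ i`. -/
def psi (q : QParam) (γ : ℕ → ℝ) : (i : ℕ) → (ℕ → ℕ) → ℕ → H i
  | 0, _, _ => 0
  | 1, _, p => (∏ l ∈ Finset.Icc 1 p, sqrtSigma q l (γ 1)) •
      PiTensorProduct.tprod ℂ fun _ : Fin 1 => basisKet p
  | i + 2, h, p => (raisingOp q γ (i + 2) ^ p) (∑ k ∈ Finset.range (h (i + 1) + 1),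
      coef q γ h (i + 2) k • snoc (psi q γ (i + 1) h k) (basisKet (h (i + 1) - k)))

/-- The vectors `φ^{(r)}(k_1, ..., k_{r-1}, p)`: the same construction on the factors
`i + 1, ..., i + r`. -/
def phi (q : QParam) (γ : ℕ → ℝ) (i r : ℕ) (k : ℕ → ℕ) (p : ℕ) : H r :=
  psi q (fun l => γ (i + l)) r k p

/-- The numbers `α_p` (for given `h`, `k`, `s`). -/
def alpha (q : QParam) (γ : ℕ → ℝ) (i r : ℕ) (h k : ℕ → ℕ) (s p : ℕ) : ℂ :=
  (-1) ^ (psum k (r - 1) + (s - p)) *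
    qpow q (1 / 2 * (gsum γ (i + 1) (i + r) + ((s : ℝ) - p) + psum k (r - 1))) *
    sigma q p ((psum h (i - 1) : ℝ) + gsum γ 1 i)

/-- The numbers `β_p` (for given `h`, `k`, `s`). -/
def beta (q : QParam) (γ : ℕ → ℝ) (i r : ℕ) (h k : ℕ → ℕ) (s p : ℕ) : ℂ :=
  qpow q (-(1 / 2) * (gsum γ 1 i + ((s : ℝ) - p) + psum h (i - 1))) *
    sigma q p ((psum k (r - 1) : ℝ) + gsum γ (i + 1) (i + r))

/-- The numbers `ε_p = (-1)^p (β_{s-p+1} ... β_s) / (α_1 ... α_p)`. -/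
def epsilon (q : QParam) (γ : ℕ → ℝ) (i r : ℕ) (h k : ℕ → ℕ) (s p : ℕ) : ℂ :=
  (-1) ^ p * (∏ l ∈ Finset.Icc (s - p + 1) s, beta q γ i r h k s l) /
    ∏ l ∈ Finset.Icc 1 p, alpha q γ i r h k s l

/-- The coupled vectors `Ψ^{(i,r)}(h, k, s, t)`. -/
def coupled (q : QParam) (γ : ℕ → ℝ) (i r : ℕ) (h k : ℕ → ℕ) (s t : ℕ) : H (i + r) :=
  (raisingOp q γ (i + r) ^ t) (∑ p ∈ Finset.range (s + 1),
    epsilon q γ i r h k s p • tens (psi q γ i h p) (phi q γ i r k (s - p)))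

/-- The vectors `Θ^{(i,r)}(j_1, ..., j_{n-1}, N)` for `n = i + r + d`. For `d = 0` this is
`Ψ^{(i,r)}` with `h = (j_1, ..., j_{i-1})`, `k = (j_i, ..., j_{i+r-2})` and `s = j_{i+r-1}`. -/
def Theta (q : QParam) (γ : ℕ → ℝ) (i r : ℕ) : (d : ℕ) → (ℕ → ℕ) → ℕ → H (i + r + d)
  | 0, j, N => coupled q γ i r j (fun l => j (i - 1 + l)) (j (i + r - 1)) N
  | d + 1, j, N => (raisingOp q γ (i + r + d + 1) ^ N)
      (∑ k ∈ Finset.range (j (i + r + d) + 1), coef q γ j (i + r + d + 1) k •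
        snoc (Theta q γ i r d j k) (basisKet (j (i + r + d) - k)))

/-- The normalized vectors `|j_{n-1}, ..., j_1; N⟩`, `n = i + r + d`. -/
def ket (q : QParam) (γ : ℕ → ℝ) (i r d : ℕ) (j : ℕ → ℕ) (N : ℕ) : H (i + r + d) :=
  (((Real.sqrt (braket (Theta q γ i r d j N) (Theta q γ i r d j N)).re)⁻¹ : ℝ) : ℂ) •
    Theta q γ i r d j N

/-! ### The joint eigenspaces -/

/-- The eigenvalue `(-1)^a [a + g - 1/2]_q`. -/
def casimirEigenvalue (q : QParam) (a : ℕ) (g : ℝ) : ℂ := (-1) ^ a * qnum q (a + g - 1 / 2)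

/-- The space `V_{N,p}^{(i,r)}`, `p = (p_1, ..., p_d)`, `n = i + r + d`. -/
def V (q : QParam) (γ : ℕ → ℝ) (i r d : ℕ) (p : ℕ → ℕ) (N : ℕ) : Submodule ℂ (H (i + r + d)) :=
  (⨅ m ∈ Finset.range d,
    Module.End.eigenspace (R := ℂ) (M := H (i + r + d)) (casimirOp q γ (i + r + d) 1 (i + r + m))
      (casimirEigenvalue q (psum p (m + 1)) (gsum γ 1 (i + r + m)))) ⊓
  Module.End.eigenspace (R := ℂ) (M := H (i + r + d)) (weightOp q γ (i + r + d))
    (qpow q (1 / 2 * ((N : ℝ) + psum p d + gsum γ 1 (i + r + d))))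

/-- The sequence `(j_1, ..., j_{i+r-2}, p_1 - |j_{i+r-2}|, p_2, ..., p_d, ℓ)`, for `d ≥ 1`. -/
def indexB (i r d : ℕ) (p j : ℕ → ℕ) (l : ℕ) (k : ℕ) : ℕ :=
  if k ≤ i + r - 2 then j k
  else if k = i + r - 1 then p 1 - psum j (i + r - 2)
  else if k ≤ i + r + d - 2 then p (k + 2 - (i + r))
  else l

/-- The set `B_{p,N}^{(i,r)}`, `p = (p_1, ..., p_d)`, `n = i + r + d`. -/
def B (q : QParam) (γ : ℕ → ℝ) (i r d : ℕ) (p : ℕ → ℕ) (N : ℕ) : Set (H (i + r + d)) :=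
  if d = 0 then
    {v | ∃ j : ℕ → ℕ, psum j (i + r + d - 1) ≤ N ∧
      v = Theta q γ i r d j (N - psum j (i + r + d - 1))}
  else
    {v | ∃ (j : ℕ → ℕ) (l : ℕ), psum j (i + r - 2) ≤ p 1 ∧ l ≤ N ∧
      v = Theta q γ i r d (indexB i r d p j l) (N - l)}

/-- The space `Z_{N,j}^{(i,r)}`, `j = (j_1, ..., j_{n-1})`, `n = i + r + d`. -/
def Z (q : QParam) (γ : ℕ → ℝ) (i r d : ℕ) (j : ℕ → ℕ) (N : ℕ) : Submodule ℂ (H (i + r + d)) :=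
  (⨅ m ∈ Finset.Icc 2 i ∪ Finset.Icc (i + r) (i + r + d),
    Module.End.eigenspace (R := ℂ) (M := H (i + r + d)) (casimirOp q γ (i + r + d) 1 m)
      (casimirEigenvalue q (psum j (m - 1)) (gsum γ 1 m))) ⊓
  (⨅ m ∈ Finset.Icc 2 r,
    Module.End.eigenspace (R := ℂ) (M := H (i + r + d)) (casimirOp q γ (i + r + d) (i + 1) (i + m))
      (casimirEigenvalue q (psum j (i + m - 2) - psum j (i - 1)) (gsum γ (i + 1) (i + m)))) ⊓
  Module.End.eigenspace (R := ℂ) (M := H (i + r + d)) (weightOp q γ (i + r + d))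
    (qpow q (1 / 2 * ((N : ℝ) + psum j (i + r + d - 1) + gsum γ 1 (i + r + d))))

end

end QBI

/-!
The vectors `Θ(j, N)` are obtained by repeated Clebsch-Gordan coupling, and the theorem follows from
three facts about them.

*Chains.* Call `u 0, u 1, ...` a chain (`IsChain`) if `u 0` is killed by `A₋`, is an eigenvector of
`K` and `P`, and `u (k + 1) = A₊ (u k)`. The relations of the algebra determine how all generators
act on a chain (`IsChain.weight`, `IsChain.lower`), and `Γ^q` acts on it by the scalar
`(-1)^a [a + g - 1/2]_q` because it is central. Since `|q| ≠ 1`, the moduli of the powers `q^x`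
separate real exponents; hence the numbers `σ_m` with `m ≥ 1` do not vanish, so that chains do not
break off, and different `a` give different Casimir eigenvalues.

*Coupling.* In a product of two chains, the coefficients that define `ψ`, `Ψ` and `Θ` are those for
which the combination of the `u p ⊗ v (s - p)` is killed by `A₋` (`extCoef_isLowestCoeff`,
`epsilon_isLowestCoeff`), so each level `s` starts a new chain (`couple_isChain`). At level `m` of
the product the `m + 1` coupled vectors have different Casimir eigenvalues, so they are independent
and span the same space as the `m + 1` products (`mem_span_couple`). By induction on the number of
factors, the `Θ(j, N)` span the whole tensor product (`span_Theta`).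

*Separation.* The Casimir operators of the subintervals commute with the action of the algebra on
the whole product (`Centralizes`), so their eigenvalues survive all later couplings, and the
`Θ(j, N)` are joint eigenvectors of the operators that define `Z` and `V`. The eigenvalues
recover all partial sums of `j` and then `N`. Joint eigenvectors with distinct systems of
eigenvalues are independent, so the `Θ(j, N)` form a basis (`thetaBasis`), and every joint
eigenspace is spanned by the basis vectors in it (`mem_span_of_joint_eigenvector`), which gives the
decompositions into the `V` and the `Z`.

For positive `q` the numbers `σ_m` are nonnegative, so `A₊` and `A₋` are adjoint while `K` and `P`
are self-adjoint on each `W^(g)`; the coproduct respects this (`intervalRep_adjoint`). The operators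
above are then self-adjoint, and vectors with different eigenvalues are orthogonal.
-/

namespace QBI

noncomputable section

/-! ### Arithmetic of `q`-numbers -/

lemma norm_qpow (q : QParam) (x : ℝ) : ‖qpow q x‖ = ‖q.val‖ ^ x :=
  Complex.norm_cpow_real _ _

lemma eq_of_norm_qpow_eq (q : QParam) {x y : ℝ} (h : ‖qpow q x‖ = ‖qpow q y‖) : x = y := by
  rw [norm_qpow, norm_qpow] at h
  exact (Real.rpow_right_inj (norm_pos_iff.mpr q.ne_zero) q.norm_ne_one).mp h

lemma qpow_injective (q : QParam) : Function.Injective (qpow q) := fun _ _ h =>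
  eq_of_norm_qpow_eq q (congrArg norm h)

/-- Up to sign, `[x]_q` determines `x ≥ 0`: with `X = q^x` and `Y = q^y`, the difference
`(X - X⁻¹) - (Y - Y⁻¹)` factors as `(X - Y)(1 + (XY)⁻¹)`, and the factors can be told from zero
by their moduli. -/
lemma eq_of_qnum_eq (q : QParam) {x y : ℝ} (hx : 0 ≤ x) (hy : 0 ≤ y)
    (h : qnum q x = qnum q y) : x = y := by
  have h1 : qpow q x - qpow q (-x) = qpow q y - qpow q (-y) := by
    simpa only [qnum, div_left_inj' (sub_inv_ne_zero q)] using h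
  have h2 : (qpow q x - qpow q y) * (1 + qpow q (-x) * qpow q (-y)) = 0 := by
    linear_combination h1 + qpow q (-y) * qpow_mul_neg q x - qpow q (-x) * qpow_mul_neg q y
  rcases mul_eq_zero.mp h2 with h3 | h3
  · exact qpow_injective q (sub_eq_zero.mp h3)
  · have h4 : ‖qpow q (-x + -y)‖ = ‖qpow q 0‖ := by
      rw [qpow_add, eq_neg_of_add_eq_zero_right h3, qpow_zero, norm_neg]
    have := eq_of_norm_qpow_eq q h4
    linarith

lemma eq_of_qnum_eq_neg (q : QParam) {x y : ℝ} (hx : 0 ≤ x) (hy : 0 ≤ y)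
    (h : qnum q x = -qnum q y) : x = y := by
  have h1 : qpow q x - qpow q (-x) = -(qpow q y - qpow q (-y)) := by
    simpa only [qnum, ← neg_div, div_left_inj' (sub_inv_ne_zero q)] using h
  have h2 : (qpow q x + qpow q y) * (1 - qpow q (-x) * qpow q (-y)) = 0 := by
    linear_combination h1 - qpow q (-y) * qpow_mul_neg q x - qpow q (-x) * qpow_mul_neg q y
  rcases mul_eq_zero.mp h2 with h3 | h3
  · refine eq_of_norm_qpow_eq q ?_
    rw [eq_neg_of_add_eq_zero_left h3, norm_neg]
  · have h4 : qpow q (-x + -y) = qpow q 0 := by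
      rw [qpow_add, ← sub_eq_zero.mp h3, qpow_zero]
    have := qpow_injective q h4
    linarith

lemma sigma_ne_zero (q : QParam) {m : ℕ} {g : ℝ} (hm : m ≠ 0) (hg : 1 / 2 < g) :
    sigma q m g ≠ 0 := by
  intro h
  have hm' : (0 : ℝ) < m := by positivity
  have hx : 0 ≤ m + g - 1 / 2 := by linarith
  have hy : 0 ≤ g - 1 / 2 := by linarith
  have h' := sub_eq_zero.mp h
  have : m + g - 1 / 2 = g - 1 / 2 := by
    rcases neg_one_pow_eq_or ℂ m with e | e
    · rw [e, one_mul] at h'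
      exact eq_of_qnum_eq q hx hy h'
    · rw [e, neg_one_mul] at h'
      exact eq_of_qnum_eq_neg q hx hy h'
  linarith

lemma sqrtSigma_ne_zero (q : QParam) {m : ℕ} {g : ℝ} (hm : m ≠ 0) (hg : 1 / 2 < g) :
    sqrtSigma q m g ≠ 0 := fun h =>
  sigma_ne_zero q hm hg (by rw [← sqrtSigma_mul_self, h, zero_mul])

lemma casimirEigenvalue_injective (q : QParam) {g : ℝ} (hg : 1 / 2 < g) :
    Function.Injective fun a => casimirEigenvalue q a g := by
  intro a b h
  have hx : 0 ≤ a + g - 1 / 2 := by have : (0 : ℝ) ≤ a := by positivity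
                                    linarith
  have hy : 0 ≤ b + g - 1 / 2 := by have : (0 : ℝ) ≤ b := by positivity
                                    linarith
  have : a + g - 1 / 2 = b + g - 1 / 2 := by
    simp only [casimirEigenvalue] at h
    rcases neg_one_pow_eq_or ℂ a with ea | ea <;> rcases neg_one_pow_eq_or ℂ b with eb | eb <;>
      simp only [ea, eb, one_mul, neg_one_mul] at h
    · exact eq_of_qnum_eq q hx hy h
    · exact eq_of_qnum_eq_neg q hx hy h
    · exact eq_of_qnum_eq_neg q hx hy (by rw [← h, neg_neg])
    · exact eq_of_qnum_eq q hx hy (neg_injective h)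
  have h2 : (a : ℝ) = b := by linarith
  exact_mod_cast h2

/-! ### Families of joint eigenvectors -/

section JointEigenvectors

variable {E ι κ : Type*} [AddCommGroup E] [Module ℂ E]

/-- If the eigenvalues separate the members of the family, then the product of the operators
`T a - Λ a y` over finitely many `y` annihilates these members and no other given one. -/
lemma exists_annihilator {v : ι → E} {T : κ → Module.End ℂ E} {Λ : κ → ι → ℂ}
    (hT : ∀ a x, T a (v x) = Λ a x • v x) (hsep : ∀ x y, (∀ a, Λ a x = Λ a y) → x = y)
    (x : ι) (S : Finset ι) (hx : x ∉ S) :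
    ∃ (Q : Module.End ℂ E) (μ : ι → ℂ), (∀ y, Q (v y) = μ y • v y) ∧ μ x ≠ 0 ∧
      ∀ y ∈ S, μ y = 0 := by
  classical
  induction S using Finset.induction_on with
  | empty => exact ⟨1, fun _ => 1, by simp⟩
  | insert z S hz ih =>
    rw [Finset.mem_insert, not_or] at hx
    obtain ⟨Q, μ, h1, h2, h3⟩ := ih hx.2
    obtain ⟨a, ha⟩ : ∃ a, Λ a x ≠ Λ a z := by
      by_contra! h
      exact hx.1 (hsep x z h)
    refine ⟨(T a - Λ a z • 1) * Q, fun y => (Λ a y - Λ a z) * μ y, fun y => ?_,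
      mul_ne_zero (sub_ne_zero.mpr ha) h2, fun y hy => ?_⟩
    · simp only [Module.End.mul_apply, h1, map_smul, LinearMap.sub_apply, hT,
        LinearMap.smul_apply, Module.End.one_apply, ← sub_smul, smul_smul, mul_comm]
    · rcases Finset.mem_insert.mp hy with rfl | hy
      · simp
      · simp [h3 y hy]

/-- Joint eigenvectors with pairwise distinct systems of eigenvalues are linearly independent; the
operators are not assumed to commute. -/
lemma linearIndependent_of_separated {v : ι → E} (T : κ → Module.End ℂ E) (Λ : κ → ι → ℂ)
    (hT : ∀ a x, T a (v x) = Λ a x • v x) (hsep : ∀ x y, (∀ a, Λ a x = Λ a y) → x = y)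
    (hv : ∀ x, v x ≠ 0) : LinearIndependent ℂ v := by
  classical
  rw [linearIndependent_iff']
  intro S c hc x hx
  obtain ⟨Q, μ, h1, h2, h3⟩ := exists_annihilator hT hsep x (S.erase x) (Finset.notMem_erase x S)
  have h4 := congrArg Q hc
  rw [map_sum, map_zero, Finset.sum_eq_single_of_mem x hx] at h4
  · rw [map_smul, h1, smul_smul] at h4
    have := (smul_eq_zero.mp h4).resolve_right (hv x)
    exact (mul_eq_zero.mp this).resolve_right h2
  · intro y hy hyx
    rw [map_smul, h1, h3 y (Finset.mem_erase.mpr ⟨hyx, hy⟩), zero_smul, smul_zero]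

/-- A joint eigenspace of operators that are diagonal in a basis is spanned by the basis vectors
that it contains. -/
lemma mem_span_of_joint_eigenvector {E ι κ : Type*} [AddCommMonoid E] [Module ℂ E]
    (b : Module.Basis ι ℂ E) (T : κ → Module.End ℂ E) (Λ : κ → ι → ℂ) (hT : ∀ a x, T a (b x) = Λ a x • b x) (μ : κ → ℂ) {w : E}
    (hw : ∀ a, T a w = μ a • w) :
    w ∈ Submodule.span ℂ (b '' {x | ∀ a, Λ a x = μ a}) := by
  rw [Module.Basis.mem_span_image]
  intro x hx a
  have hx' : b.repr w x ≠ 0 := Finsupp.mem_support_iff.mp hx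
  have key : ∀ u, b.repr (T a u) x = Λ a x * b.repr u x := by
    intro u
    have : (Finsupp.lapply x ∘ₗ b.repr.toLinearMap) ∘ₗ T a =
        Λ a x • (Finsupp.lapply x ∘ₗ b.repr.toLinearMap) := by
      classical
      refine b.ext fun y => ?_
      simp only [LinearMap.comp_apply, hT, map_smul, LinearMap.smul_apply]
      by_cases hxy : y = x
      · rw [hxy]
      · simp [hxy]
    exact LinearMap.congr_fun this u
  have h1 := key w
  rw [hw, map_smul, Finsupp.smul_apply, smul_eq_mul] at h1
  exact (mul_right_cancel₀ hx' h1).symm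

/-- Sorting the vectors of a basis by the values of a function decomposes the space into the
direct sum of their spans. -/
lemma isInternal_span_fibers [DecidableEq κ] (b : Module.Basis ι ℂ E) (f : ι → κ)
    (S : κ → Submodule ℂ E) (hS : ∀ k, S k = Submodule.span ℂ (b '' {x | f x = k})) :
    DirectSum.IsInternal S := by
  rw [DirectSum.isInternal_submodule_iff_iSupIndep_and_iSup_eq_top]
  refine ⟨fun k => ?_, ?_⟩
  · have h1 : ⨆ l, ⨆ (_ : l ≠ k), S l ≤ Submodule.span ℂ (b '' {x | f x ≠ k}) := by
      refine iSup₂_le fun l hl => ?_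
      rw [hS]
      refine Submodule.span_mono (Set.image_mono fun x hx => ?_)
      rw [Set.mem_ofPred_eq] at hx ⊢
      rwa [hx]
    rw [hS k]
    refine (b.linearIndependent.disjoint_span_image ?_).mono_right h1
    exact Set.disjoint_left.mpr fun x h h' => h' h
  · rw [eq_top_iff, ← b.span_eq, Submodule.span_le]
    rintro _ ⟨x, rfl⟩
    refine Submodule.mem_iSup_of_mem (f x) ?_
    rw [hS]
    exact Submodule.subset_span ⟨x, rfl, rfl⟩

end JointEigenvectors

/-! ### The Casimir element -/

lemma OspRel.map {q : QParam} {A A' : Type*} [Ring A] [Algebra ℂ A] [Ring A'] [Algebra ℂ A']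
    {Ap Am K Ki P : A} (h : OspRel q Ap Am K Ki P) (f : A →ₐ[ℂ] A') :
    OspRel q (f Ap) (f Am) (f K) (f Ki) (f P) where
  K_Ap := by simpa using congrArg f h.K_Ap
  K_Am := by simpa using congrArg f h.K_Am
  Ap_Am := by simpa only [map_mul, map_add, map_smul, map_sub, map_pow] using congrArg f h.Ap_Am
  P_Ap := by simpa using congrArg f h.P_Ap
  P_Am := by simpa using congrArg f h.P_Am
  P_K := by simpa using congrArg f h.P_K
  P_Kinv := by simpa using congrArg f h.P_Kinv
  K_Kinv := by simpa using congrArg f h.K_Kinv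
  Kinv_K := by simpa using congrArg f h.Kinv_K
  P_P := by simpa using congrArg f h.P_P

/-- The Casimir element with the parity stripped off; it anticommutes with `A₊` and `A₋`. -/
def bareCasimir (q : QParam) {A : Type*} [Ring A] [Algebra ℂ A] (Ap Am K Ki : A) : A :=
  -(Ap * Am) + (q.val - q.val⁻¹)⁻¹ • (qpow q (-(1 / 2)) • K ^ 2 - qpow q (1 / 2) • Ki ^ 2)

section Casimir

variable {q : QParam} {A : Type*} [Ring A] [Algebra ℂ A] {Ap Am K Ki P : A}

lemma qpow_half_mul_self (q : QParam) : qpow q (1 / 2) * qpow q (1 / 2) = q.val := by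
  rw [← qpow_add, ← qpow_one]; norm_num

lemma qpow_neg_half_mul_self (q : QParam) : qpow q (-(1 / 2)) * qpow q (-(1 / 2)) = q.val⁻¹ := by
  rw [← qpow_add, ← qpow_neg_one]; norm_num

lemma qpow_neg_half_mul_val (q : QParam) : qpow q (-(1 / 2)) * q.val = qpow q (1 / 2) := by
  rw [← qpow_one, ← qpow_add]; norm_num

lemma qpow_half_mul_val_inv (q : QParam) :
    qpow q (1 / 2) * q.val⁻¹ = qpow q (-(1 / 2)) := by
  rw [← qpow_neg_one, ← qpow_add]; norm_num

lemma inv_half_sub (q : QParam) : (qpow q (1 / 2) - qpow q (-(1 / 2)))⁻¹ =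
    (q.val - q.val⁻¹)⁻¹ * (qpow q (1 / 2) + qpow q (-(1 / 2))) := by
  have h1 := half_sub_ne_zero q
  have h2 := sub_inv_ne_zero q
  rw [inv_eq_iff_eq_inv, mul_inv, inv_inv, eq_mul_inv_iff_mul_eq₀]
  · linear_combination qpow_half_mul_self q - qpow_neg_half_mul_self q
  · intro h
    apply h2
    linear_combination (qpow q (1 / 2) - qpow q (-(1 / 2))) * h - qpow_half_mul_self q +
      qpow_neg_half_mul_self q

lemma OspRel.bareCasimir_Ap (h : OspRel q Ap Am K Ki P) :
    bareCasimir q Ap Am K Ki * Ap = -(Ap * bareCasimir q Ap Am K Ki) := by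
  have hK : K ^ 2 * Ap = q.val • (Ap * K ^ 2) := by
    rw [pow_two, mul_assoc, h.K_Ap', mul_smul_comm, ← mul_assoc, h.K_Ap', smul_mul_assoc,
      smul_smul, qpow_half_mul_self, mul_assoc]
  have hKi : Ki ^ 2 * Ap = q.val⁻¹ • (Ap * Ki ^ 2) := by
    rw [pow_two, mul_assoc, h.Kinv_Ap', mul_smul_comm, ← mul_assoc, h.Kinv_Ap', smul_mul_assoc,
      smul_smul, qpow_neg_half_mul_self, mul_assoc]
  have hA : Am * Ap = (qpow q (1 / 2) - qpow q (-(1 / 2)))⁻¹ • (K ^ 2 - Ki ^ 2) - Ap * Am :=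
    eq_sub_of_add_eq' h.Ap_Am
  unfold bareCasimir
  rw [add_mul, neg_mul, mul_assoc Ap Am Ap, hA, mul_sub, mul_add, mul_neg, inv_half_sub]
  simp only [smul_mul_assoc, mul_smul_comm, sub_mul, mul_sub, hK, hKi, smul_smul, smul_sub]
  rw [← sub_eq_zero]
  have e1 : (q.val - q.val⁻¹)⁻¹ * (qpow q (-(1 / 2)) * q.val) =
      (q.val - q.val⁻¹)⁻¹ * qpow q (1 / 2) := by
    rw [qpow_neg_half_mul_val]
  have e2 : (q.val - q.val⁻¹)⁻¹ * (qpow q (1 / 2) * q.val⁻¹) =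
      (q.val - q.val⁻¹)⁻¹ * qpow q (-(1 / 2)) := by
    rw [qpow_half_mul_val_inv]
  simp only [mul_assoc] at e1 e2 ⊢
  rw [e1, e2]
  module

lemma OspRel.bareCasimir_Am (h : OspRel q Ap Am K Ki P) :
    bareCasimir q Ap Am K Ki * Am = -(Am * bareCasimir q Ap Am K Ki) := by
  have hK : K ^ 2 * Am = q.val⁻¹ • (Am * K ^ 2) := by
    rw [pow_two, mul_assoc, h.K_Am', mul_smul_comm, ← mul_assoc, h.K_Am', smul_mul_assoc,
      smul_smul, qpow_neg_half_mul_self, mul_assoc]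
  have hKi : Ki ^ 2 * Am = q.val • (Am * Ki ^ 2) := by
    rw [pow_two, mul_assoc, h.Kinv_Am', mul_smul_comm, ← mul_assoc, h.Kinv_Am', smul_mul_assoc,
      smul_smul, qpow_half_mul_self, mul_assoc]
  have hA : Ap * Am = (qpow q (1 / 2) - qpow q (-(1 / 2)))⁻¹ • (K ^ 2 - Ki ^ 2) - Am * Ap :=
    eq_sub_of_add_eq h.Ap_Am
  have e1 : (q.val - q.val⁻¹)⁻¹ * (qpow q (-(1 / 2)) * q.val) =
      (q.val - q.val⁻¹)⁻¹ * qpow q (1 / 2) := by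
    rw [qpow_neg_half_mul_val]
  have e2 : (q.val - q.val⁻¹)⁻¹ * (qpow q (1 / 2) * q.val⁻¹) =
      (q.val - q.val⁻¹)⁻¹ * qpow q (-(1 / 2)) := by
    rw [qpow_half_mul_val_inv]
  have e3 : q.val * ((q.val - q.val⁻¹)⁻¹ * qpow q (-(1 / 2))) =
      (q.val - q.val⁻¹)⁻¹ * qpow q (1 / 2) := by rw [← e1]; ring
  unfold bareCasimir
  rw [add_mul, neg_mul, hA, sub_mul, mul_add, mul_neg, mul_assoc Am Ap Am, hA, inv_half_sub]
  simp only [smul_mul_assoc, mul_smul_comm, sub_mul, mul_sub, hK, hKi, smul_smul, smul_sub,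
    mul_assoc]
  rw [← sub_eq_zero]
  have f1 : (q.val - q.val⁻¹)⁻¹ * ((qpow q (1 / 2) + qpow q (-(1 / 2))) * q.val⁻¹) =
      (q.val - q.val⁻¹)⁻¹ * (qpow q (-(1 / 2)) + qpow q (-(1 / 2)) * q.val⁻¹) := by
    linear_combination e2
  have f2 : (q.val - q.val⁻¹)⁻¹ * ((qpow q (1 / 2) + qpow q (-(1 / 2))) * q.val) =
      (q.val - q.val⁻¹)⁻¹ * (qpow q (1 / 2) + qpow q (1 / 2) * q.val) := by
    linear_combination e1
  rw [f1, f2]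
  module

lemma OspRel.commute_K_Kinv (h : OspRel q Ap Am K Ki P) : Commute K Ki :=
  h.K_Kinv.trans h.Kinv_K.symm

lemma OspRel.bareCasimir_K (h : OspRel q Ap Am K Ki P) :
    Commute (bareCasimir q Ap Am K Ki) K := by
  have h1 : Commute (Ap * Am) K := by
    change Ap * Am * K = K * (Ap * Am)
    rw [← mul_assoc, h.K_Ap', smul_mul_assoc, mul_assoc Ap K Am, h.K_Am', mul_smul_comm, smul_smul,
      qpow_mul_neg, one_smul, mul_assoc]
  exact h1.neg_left.add_left
    ((((Commute.refl K).pow_left 2).smul_left _ |>.sub_left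
      ((h.commute_K_Kinv.symm.pow_left 2).smul_left _)).smul_left _)

lemma OspRel.bareCasimir_P (h : OspRel q Ap Am K Ki P) :
    Commute (bareCasimir q Ap Am K Ki) P := by
  have h1 : Commute (Ap * Am) P := by
    change Ap * Am * P = P * (Ap * Am)
    rw [← mul_assoc, eq_neg_of_add_eq_zero_left h.P_Ap, neg_mul, mul_assoc Ap P Am,
      eq_neg_of_add_eq_zero_left h.P_Am, mul_neg, neg_neg, mul_assoc]
  have h2 : Commute K P := h.P_K.symm
  have h3 : Commute Ki P := h.P_Kinv.symm
  exact h1.neg_left.add_left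
    (((h2.pow_left 2).smul_left _ |>.sub_left ((h3.pow_left 2).smul_left _)).smul_left _)

/-- `Γ^q` is central: stripped of `P` it anticommutes with `A₊` and `A₋`, and so does `P`. -/
lemma OspRel.commute_casimir (h : OspRel q Ap Am K Ki P) (x : Gen) :
    Commute (bareCasimir q Ap Am K Ki * P) (genImage Ap Am K Ki P x) := by
  have hK : Commute (bareCasimir q Ap Am K Ki * P) K := h.bareCasimir_K.mul_left h.P_K
  cases x with
  | Ap =>
    change _ * _ * Ap = Ap * (_ * _)
    rw [mul_assoc, eq_neg_of_add_eq_zero_left h.P_Ap, mul_neg, ← mul_assoc, h.bareCasimir_Ap,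
      neg_mul, neg_neg, mul_assoc]
  | Am =>
    change _ * _ * Am = Am * (_ * _)
    rw [mul_assoc, eq_neg_of_add_eq_zero_left h.P_Am, mul_neg, ← mul_assoc, h.bareCasimir_Am,
      neg_mul, neg_neg, mul_assoc]
  | K => exact hK
  | Kinv =>
    let u : Aˣ := ⟨K, Ki, h.K_Kinv, h.Kinv_K⟩
    exact Commute.units_inv_right (u := u) hK
  | P => exact h.bareCasimir_P.mul_left (Commute.refl _)

lemma commute_casimir_gen (q : QParam) (x : Gen) : Commute (casimir q) (Osp.gen q x) := by
  have h := (Osp.rel q).commute_casimir x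
  cases x <;> exact h

end Casimir

/-! ### Lowest weight chains -/

section Chains

variable {q : QParam} {M N L : Type*} [AddCommGroup M] [Module ℂ M] [AddCommGroup N] [Module ℂ N]
  [AddCommGroup L] [Module ℂ L] {ρ : Osp q →ₐ[ℂ] Module.End ℂ M}
  {ρ' : Osp q →ₐ[ℂ] Module.End ℂ N} {ρ'' : Osp q →ₐ[ℂ] Module.End ℂ L}

/-- The vectors `u 0, u 1, ...` are the successive images under `A₊` of a vector `u 0` that is
killed by `A₋`, has parity `(-1)^a`, and on which `K` is `q^{(a+g)/2}`. Up to normalization they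
then behave like the basis of `W^(a+g)`; `a` is kept apart from `g` since it fixes the parity. -/
structure IsChain (ρ : Osp q →ₐ[ℂ] Module.End ℂ M) (a : ℕ) (g : ℝ) (u : ℕ → M) : Prop where
  raise : ∀ k, ρ (Osp.gen q .Ap) (u k) = u (k + 1)
  lower_zero : ρ (Osp.gen q .Am) (u 0) = 0
  weight_zero : ρ (Osp.gen q .K) (u 0) = qpow q ((a + g) / 2) • u 0
  parity_zero : ρ (Osp.gen q .P) (u 0) = (-1 : ℂ) ^ a • u 0

/-- The relations of the generators, read off on a vector of a representation. -/
lemma rep_K_Ap (ρ : Osp q →ₐ[ℂ] Module.End ℂ M) (v : M) :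
    ρ (Osp.gen q .K) (ρ (Osp.gen q .Ap) v) =
      qpow q (1 / 2) • ρ (Osp.gen q .Ap) (ρ (Osp.gen q .K) v) :=
  LinearMap.congr_fun ((Osp.rel q).map ρ).K_Ap' v

lemma rep_P_Ap (ρ : Osp q →ₐ[ℂ] Module.End ℂ M) (v : M) :
    ρ (Osp.gen q .P) (ρ (Osp.gen q .Ap) v) = -ρ (Osp.gen q .Ap) (ρ (Osp.gen q .P) v) :=
  eq_neg_of_add_eq_zero_left (LinearMap.congr_fun ((Osp.rel q).map ρ).P_Ap v)

lemma rep_Kinv_K (ρ : Osp q →ₐ[ℂ] Module.End ℂ M) (v : M) :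
    ρ (Osp.gen q .Kinv) (ρ (Osp.gen q .K) v) = v :=
  LinearMap.congr_fun ((Osp.rel q).map ρ).Kinv_K v

lemma rep_Am_Ap (ρ : Osp q →ₐ[ℂ] Module.End ℂ M) (v : M) :
    ρ (Osp.gen q .Am) (ρ (Osp.gen q .Ap) v) =
      (qpow q (1 / 2) - qpow q (-(1 / 2)))⁻¹ • (ρ (Osp.gen q .K) (ρ (Osp.gen q .K) v) -
        ρ (Osp.gen q .Kinv) (ρ (Osp.gen q .Kinv) v)) -
      ρ (Osp.gen q .Ap) (ρ (Osp.gen q .Am) v) := by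
  have h := LinearMap.congr_fun ((Osp.rel q).map ρ).Ap_Am v
  simp only [pow_two] at h
  exact eq_sub_of_add_eq' h

lemma rep_casimir (ρ : Osp q →ₐ[ℂ] Module.End ℂ M) (v : M) :
    ρ (casimir q) v = -ρ (Osp.gen q .Ap) (ρ (Osp.gen q .Am) (ρ (Osp.gen q .P) v)) +
      (q.val - q.val⁻¹)⁻¹ •
        (qpow q (-(1 / 2)) • ρ (Osp.gen q .K) (ρ (Osp.gen q .K) (ρ (Osp.gen q .P) v)) -
        qpow q (1 / 2) • ρ (Osp.gen q .Kinv) (ρ (Osp.gen q .Kinv) (ρ (Osp.gen q .P) v))) := by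
  simp only [casimir, map_mul, map_add, map_neg, map_smul, map_sub, pow_two]
  rfl

/-- A form of `rep_casimir` with `P` on the left, to be compared with it under taking adjoints. -/
lemma rep_casimir_parity_left (ρ : Osp q →ₐ[ℂ] Module.End ℂ M) (v : M) :
    ρ (casimir q) v = ρ (Osp.gen q .P)
      ((-1 : ℂ) • ρ (Osp.gen q .Ap) (ρ (Osp.gen q .Am) v) +
      (q.val - q.val⁻¹)⁻¹ • (qpow q (-(1 / 2)) • ρ (Osp.gen q .K) (ρ (Osp.gen q .K) v) +
        (-1 : ℂ) • qpow q (1 / 2) • ρ (Osp.gen q .Kinv) (ρ (Osp.gen q .Kinv) v))) := by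
  have h : casimir q = Osp.gen q .P * bareCasimir q (Osp.gen q .Ap) (Osp.gen q .Am)
    (Osp.gen q .K) (Osp.gen q .Kinv) := (Osp.rel q).bareCasimir_P
  rw [h, map_mul, Module.End.mul_apply]
  congr 1
  simp only [bareCasimir, map_mul, map_add, map_neg, map_smul, map_sub, pow_two, neg_one_smul,
    ← sub_eq_add_neg]
  rfl

lemma rep_casimir_parity_right (ρ : Osp q →ₐ[ℂ] Module.End ℂ M) (v : M) :
    ρ (casimir q) v = (-1 : ℂ) • ρ (Osp.gen q .Ap) (ρ (Osp.gen q .Am) (ρ (Osp.gen q .P) v)) +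
      (q.val - q.val⁻¹)⁻¹ •
        (qpow q (-(1 / 2)) • ρ (Osp.gen q .K) (ρ (Osp.gen q .K) (ρ (Osp.gen q .P) v)) +
        (-1 : ℂ) • qpow q (1 / 2) •
          ρ (Osp.gen q .Kinv) (ρ (Osp.gen q .Kinv) (ρ (Osp.gen q .P) v))) := by
  rw [rep_casimir]
  module

lemma rep_P_K (ρ : Osp q →ₐ[ℂ] Module.End ℂ M) (v : M) :
    ρ (Osp.gen q .P) (ρ (Osp.gen q .K) v) = ρ (Osp.gen q .K) (ρ (Osp.gen q .P) v) :=
  LinearMap.congr_fun ((Osp.rel q).map ρ).P_K v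

namespace IsChain

variable {a : ℕ} {g : ℝ} {u : ℕ → M}

lemma weight (h : IsChain ρ a g u) (k : ℕ) :
    ρ (Osp.gen q .K) (u k) = qpow q ((k + (a + g)) / 2) • u k := by
  induction k with
  | zero => simpa using h.weight_zero
  | succ k ih =>
    rw [← h.raise, rep_K_Ap, ih, map_smul, smul_smul, ← qpow_add]
    congr 2
    push_cast
    ring

lemma weightInv (h : IsChain ρ a g u) (k : ℕ) :
    ρ (Osp.gen q .Kinv) (u k) = qpow q (-((k + (a + g)) / 2)) • u k := by
  have h1 := congrArg (fun x => qpow q (-((k + (a + g)) / 2)) • ρ (Osp.gen q .Kinv) x) (h.weight k)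
  simp only [map_smul, smul_smul, qpow_neg_mul, one_smul, rep_Kinv_K] at h1
  exact h1.symm

lemma parity (h : IsChain ρ a g u) (k : ℕ) :
    ρ (Osp.gen q .P) (u k) = (-1 : ℂ) ^ (a + k) • u k := by
  induction k with
  | zero => simpa using h.parity_zero
  | succ k ih =>
    rw [← h.raise, rep_P_Ap, ih, map_smul, ← neg_smul, ← add_assoc, pow_succ, mul_neg_one]

lemma lower (h : IsChain ρ a g u) (k : ℕ) :
    ρ (Osp.gen q .Am) (u (k + 1)) = sigma q (k + 1) (a + g) • u k := by
  induction k with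
  | zero =>
    have hs := sigma_add_sigma q 0 (a + g)
    rw [sigma_zero, zero_add] at hs
    rw [← h.raise, rep_Am_Ap, h.lower_zero, map_zero, sub_zero, h.weight, map_smul, h.weight,
      h.weightInv, map_smul, h.weightInv, smul_smul, smul_smul, ← qpow_add, ← qpow_add, ← sub_smul,
      smul_smul, ← neg_add, add_halves, hs]
  | succ k ih =>
    rw [← h.raise (k + 1), rep_Am_Ap, ih, map_smul, h.raise, h.weight, map_smul, h.weight,
      h.weightInv, map_smul, h.weightInv, smul_smul, smul_smul, ← qpow_add, ← qpow_add, ← sub_smul,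
      smul_smul, ← sub_smul, ← neg_add, add_halves,
      ← eq_sub_of_add_eq' (sigma_add_sigma q (k + 1) (a + g))]

lemma casimir_zero (h : IsChain ρ a g u) :
    ρ (casimir q) (u 0) = casimirEigenvalue q a g • u 0 := by
  have e1 : qpow q (-(1 / 2)) * (qpow q (((0 : ℕ) + (a + g)) / 2) *
      qpow q (((0 : ℕ) + (a + g)) / 2)) = qpow q (a + g - 1 / 2) := by
    rw [← qpow_add, ← qpow_add]; congr 1; push_cast; ring
  have e2 : qpow q (1 / 2) * (qpow q (-(((0 : ℕ) + (a + g)) / 2)) *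
      qpow q (-(((0 : ℕ) + (a + g)) / 2))) = qpow q (-(a + g - 1 / 2)) := by
    rw [← qpow_add, ← qpow_add]; congr 1; push_cast; ring
  simp only [rep_casimir, h.parity_zero, map_smul, h.lower_zero, smul_zero, map_zero, neg_zero,
    zero_add, h.weight, h.weightInv, smul_smul, ← sub_smul]
  congr 1
  rw [casimirEigenvalue, qnum, ← e1, ← e2]
  ring

lemma casimir (h : IsChain ρ a g u) (k : ℕ) :
    ρ (casimir q) (u k) = casimirEigenvalue q a g • u k := by
  induction k with
  | zero => exact h.casimir_zero
  | succ k ih =>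
    have hc := LinearMap.congr_fun ((commute_casimir_gen q .Ap).map ρ) (u k)
    rw [← h.raise]
    refine hc.trans ?_
    rw [Module.End.mul_apply, ih, map_smul]

lemma ne_zero (h : IsChain ρ a g u) (hg : 1 / 2 < g) (h0 : u 0 ≠ 0) (k : ℕ) : u k ≠ 0 := by
  induction k with
  | zero => exact h0
  | succ k ih =>
    intro hk
    have h1 := h.lower k
    have ha : (0 : ℝ) ≤ a := by positivity
    rw [hk, map_zero, eq_comm, smul_eq_zero] at h1
    exact ih (h1.resolve_left (sigma_ne_zero q k.succ_ne_zero (by linarith)))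

lemma linearIndependent (h : IsChain ρ a g u) (hg : 1 / 2 < g) (h0 : u 0 ≠ 0) :
    LinearIndependent ℂ u :=
  linearIndependent_of_separated (fun _ : Unit => ρ (Osp.gen q .K)) _ (fun _ k => h.weight k)
    (fun x y hxy => by
      have h1 := qpow_injective q (hxy ())
      have h2 : (x : ℝ) = y := by linarith
      exact_mod_cast h2) (h.ne_zero hg h0)

end IsChain

/-! ### Coupling two chains -/

/-- `E` identifies `L` with the tensor product of `M` and `N`, on which the generators act through
the coproduct. -/
structure IsCoupling (ρ : Osp q →ₐ[ℂ] Module.End ℂ M) (ρ' : Osp q →ₐ[ℂ] Module.End ℂ N)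
    (ρ'' : Osp q →ₐ[ℂ] Module.End ℂ L) (E : M ⊗[ℂ] N ≃ₗ[ℂ] L) : Prop where
  Ap : ∀ u v, ρ'' (Osp.gen q .Ap) (E (u ⊗ₜ v)) =
    E (ρ (Osp.gen q .Ap) u ⊗ₜ ρ' (Osp.gen q .K) (ρ' (Osp.gen q .P) v)) +
    E (ρ (Osp.gen q .Kinv) u ⊗ₜ ρ' (Osp.gen q .Ap) v)
  Am : ∀ u v, ρ'' (Osp.gen q .Am) (E (u ⊗ₜ v)) =
    E (ρ (Osp.gen q .Am) u ⊗ₜ ρ' (Osp.gen q .K) (ρ' (Osp.gen q .P) v)) +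
    E (ρ (Osp.gen q .Kinv) u ⊗ₜ ρ' (Osp.gen q .Am) v)
  K : ∀ u v, ρ'' (Osp.gen q .K) (E (u ⊗ₜ v)) = E (ρ (Osp.gen q .K) u ⊗ₜ ρ' (Osp.gen q .K) v)
  Kinv : ∀ u v, ρ'' (Osp.gen q .Kinv) (E (u ⊗ₜ v)) =
    E (ρ (Osp.gen q .Kinv) u ⊗ₜ ρ' (Osp.gen q .Kinv) v)
  P : ∀ u v, ρ'' (Osp.gen q .P) (E (u ⊗ₜ v)) = E (ρ (Osp.gen q .P) u ⊗ₜ ρ' (Osp.gen q .P) v)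

/-- Coassociativity of the coproduct: the product of `M` with `N ⊗ R` is that of `M ⊗ N` with `R`. -/
lemma IsCoupling.assoc {N' R L' : Type*} [AddCommGroup N'] [Module ℂ N'] [AddCommGroup R]
    [Module ℂ R] [AddCommGroup L'] [Module ℂ L'] {τ : Osp q →ₐ[ℂ] Module.End ℂ R}
    {τ' : Osp q →ₐ[ℂ] Module.End ℂ N'} {τ'' : Osp q →ₐ[ℂ] Module.End ℂ L'}
    {E₁ : M ⊗[ℂ] N ≃ₗ[ℂ] L} {E₂ : N ⊗[ℂ] R ≃ₗ[ℂ] N'} {E₃ : L ⊗[ℂ] R ≃ₗ[ℂ] L'}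
    {E : M ⊗[ℂ] N' ≃ₗ[ℂ] L'} (h₁ : IsCoupling ρ ρ' ρ'' E₁) (h₂ : IsCoupling ρ' τ τ' E₂)
    (h₃ : IsCoupling ρ'' τ τ'' E₃)
    (hE : ∀ u v w, E (u ⊗ₜ E₂ (v ⊗ₜ w)) = E₃ (E₁ (u ⊗ₜ v) ⊗ₜ w)) : IsCoupling ρ τ' τ'' E := by
  constructor <;> intro u z <;> obtain ⟨z, rfl⟩ := E₂.surjective z <;>
    induction z using TensorProduct.induction_on with
    | zero => simp
    | tmul v w =>
      simp only [h₂.Ap, h₂.Am, h₂.K, h₂.Kinv, h₂.P, h₃.Ap, h₃.Am, h₃.K, h₃.Kinv, h₃.P, h₁.Ap, h₁.Am,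
        h₁.K, h₁.Kinv, h₁.P, hE, map_add, TensorProduct.tmul_add, TensorProduct.add_tmul, add_assoc]
    | add z z' hz hz' =>
      simp only [map_add, TensorProduct.tmul_add, hz, hz']
      try abel

/-- Two coefficients `e p`, `e (p + 1)` are related so that the contributions of `A₋ ⊗ K P` and
`K⁻¹ ⊗ A₋` to `A₋ (∑ p, e p • u p ⊗ v (s - p))` cancel. -/
def IsLowestCoeff (q : QParam) (a b : ℕ) (g g' : ℝ) (s : ℕ) (e : ℕ → ℂ) : Prop :=
  ∀ p < s, e (p + 1) * (sigma q (p + 1) (a + g) * ((-1 : ℂ) ^ (b + (s - (p + 1))) *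
      qpow q (((s - (p + 1) : ℕ) + (b + g')) / 2))) +
    e p * (qpow q (-((p + (a + g)) / 2)) * sigma q (s - p) (b + g')) = 0

/-- The image under `A₊^t` of the combination with coefficients `e` of the vectors of level `s`
in the product of two chains. -/
def couple (ρ'' : Osp q →ₐ[ℂ] Module.End ℂ L) (E : M ⊗[ℂ] N ≃ₗ[ℂ] L) (u : ℕ → M) (v : ℕ → N)
    (e : ℕ → ℂ) (s t : ℕ) : L :=
  (ρ'' (Osp.gen q .Ap) ^ t) (∑ p ∈ Finset.range (s + 1), e p • E (u p ⊗ₜ v (s - p)))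

variable {E : M ⊗[ℂ] N ≃ₗ[ℂ] L} {a b : ℕ} {g g' : ℝ} {u : ℕ → M} {v : ℕ → N}

lemma couple_isChain (hE : IsCoupling ρ ρ' ρ'' E) (hu : IsChain ρ a g u) (hv : IsChain ρ' b g' v)
    {s : ℕ} {e : ℕ → ℂ} (he : IsLowestCoeff q a b g g' s e) :
    IsChain ρ'' (a + b + s) (g + g') (couple ρ'' E u v e s) where
  raise k := by rw [couple, couple, pow_succ', Module.End.mul_apply]
  lower_zero := by
    rw [couple, pow_zero, Module.End.one_apply, map_sum]
    simp only [map_smul, hE.Am, smul_add, Finset.sum_add_distrib]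
    rw [Finset.sum_range_succ', Finset.sum_range_succ (fun p => e p •
      E (ρ (Osp.gen q .Kinv) (u p) ⊗ₜ ρ' (Osp.gen q .Am) (v (s - p))))]
    simp only [hu.lower_zero, Nat.sub_self, hv.lower_zero, TensorProduct.zero_tmul,
      TensorProduct.tmul_zero, map_zero, smul_zero, add_zero]
    rw [← Finset.sum_add_distrib]
    refine Finset.sum_eq_zero fun p hp => ?_
    rw [Finset.mem_range] at hp
    obtain ⟨m, rfl⟩ := Nat.exists_eq_add_of_lt hp
    have h1 : p + m + 1 - (p + 1) = m := by omega
    have h2 : p + m + 1 - p = m + 1 := by omega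
    have h3 := he p hp
    rw [h1, h2] at h3
    rw [h1, h2, hu.lower, hv.parity, map_smul, hv.weight, hu.weightInv, hv.lower]
    simp only [← TensorProduct.smul_tmul', TensorProduct.tmul_smul, map_smul, smul_smul, ← add_smul]
    rw [← zero_smul ℂ (E (u p ⊗ₜ[ℂ] v m)), ← h3]
    congr 1
    ring
  weight_zero := by
    rw [couple, pow_zero, Module.End.one_apply, map_sum, Finset.smul_sum]
    refine Finset.sum_congr rfl fun p hp => ?_
    have hp' : p ≤ s := Nat.lt_succ_iff.mp (Finset.mem_range.mp hp)
    rw [map_smul, hE.K, hu.weight, hv.weight, TensorProduct.smul_tmul_smul, map_smul, smul_smul,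
      smul_smul, ← qpow_add, mul_comm (e p)]
    congr 3
    push_cast [Nat.cast_sub hp']
    ring
  parity_zero := by
    rw [couple, pow_zero, Module.End.one_apply, map_sum, Finset.smul_sum]
    refine Finset.sum_congr rfl fun p hp => ?_
    have hp' : p ≤ s := Nat.lt_succ_iff.mp (Finset.mem_range.mp hp)
    rw [map_smul, hE.P, hu.parity, hv.parity, TensorProduct.smul_tmul_smul, map_smul, smul_smul,
      smul_smul, ← pow_add, mul_comm (e p)]
    congr 3
    omega

lemma linearIndependent_coupling (E : M ⊗[ℂ] N ≃ₗ[ℂ] L) (hu : LinearIndependent ℂ u)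
    (hv : LinearIndependent ℂ v) :
    LinearIndependent ℂ fun x : ℕ × ℕ => E (u x.1 ⊗ₜ[ℂ] v x.2) :=
  (hu.tmul_of_isDomain hv).map' E.toLinearMap E.ker

/-- A coupled vector does not vanish, since it contains the product `u 0 ⊗ v s`. -/
lemma couple_zero_ne_zero (hu : LinearIndependent ℂ u) (hv : LinearIndependent ℂ v)
    {s : ℕ} {e : ℕ → ℂ} (he : e 0 ≠ 0) : couple ρ'' E u v e s 0 ≠ 0 := by
  intro h
  have h1 : LinearIndependent ℂ fun p : Fin (s + 1) => E (u p ⊗ₜ[ℂ] v (s - p)) :=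
    (linearIndependent_coupling E hu hv).comp (fun p : Fin (s + 1) => ((p : ℕ), s - (p : ℕ)))
      fun x y hxy => Fin.ext (congrArg Prod.fst hxy)
  rw [couple, pow_zero, Module.End.one_apply, Finset.sum_range] at h
  exact he (Fintype.linearIndependent_iff.mp h1 (fun p => e p) h 0)

/-- The level of a vector `u p ⊗ v k` is raised by one by `A₊`. -/
lemma raise_mem_level (hE : IsCoupling ρ ρ' ρ'' E) (hu : IsChain ρ a g u) (hv : IsChain ρ' b g' v)
    (m : ℕ) {x : L} (hx : x ∈ Submodule.span ℂ
      (Set.range fun p : Fin (m + 1) => E (u p ⊗ₜ[ℂ] v (m - p)))) :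
    ρ'' (Osp.gen q .Ap) x ∈ Submodule.span ℂ
      (Set.range fun p : Fin (m + 1 + 1) => E (u p ⊗ₜ[ℂ] v (m + 1 - p))) := by
  induction hx using Submodule.span_induction with
  | mem x hx =>
    obtain ⟨p, rfl⟩ := hx
    simp only
    rw [hE.Ap, hu.raise, hv.parity, map_smul, hv.weight, hu.weightInv, hv.raise]
    simp only [← TensorProduct.smul_tmul', TensorProduct.tmul_smul, map_smul]
    refine add_mem (Submodule.smul_mem _ _ (Submodule.smul_mem _ _ (Submodule.subset_span
      ⟨p.succ, ?_⟩))) (Submodule.smul_mem _ _ (Submodule.subset_span ⟨p.castSucc, ?_⟩))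
    · simp
    · simp only [Fin.val_castSucc]
      congr 3
      omega
  | zero => simp
  | add x y _ _ hx hy => rw [map_add]; exact add_mem hx hy
  | smul c x _ hx => rw [map_smul]; exact Submodule.smul_mem _ _ hx

/-- The Clebsch-Gordan decomposition of a product of two chains: at level `m` there are `m + 1`
products `u p ⊗ v (m - p)`, and the `m + 1` coupled vectors `couple .. s (m - s)` are independent
because their Casimir eigenvalues differ. -/
lemma mem_span_couple (hE : IsCoupling ρ ρ' ρ'' E) (hu : IsChain ρ a g u) (hv : IsChain ρ' b g' v)
    (hg : 1 / 2 < g) (hg' : 1 / 2 < g') (hu0 : u 0 ≠ 0) (hv0 : v 0 ≠ 0) {e : ℕ → ℕ → ℂ}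
    (he : ∀ s, IsLowestCoeff q a b g g' s (e s)) (he0 : ∀ s, e s 0 ≠ 0) (p k : ℕ) :
    E (u p ⊗ₜ v k) ∈
      Submodule.span ℂ (Set.range fun x : ℕ × ℕ => couple ρ'' E u v (e x.1) x.1 x.2) := by
  have hul := hu.linearIndependent hg hu0
  have hvl := hv.linearIndependent hg' hv0
  -- the `t`-th vector of the chain started at level `s` has level `s + t`
  have hmem : ∀ t s, couple ρ'' E u v (e s) s t ∈ Submodule.span ℂ
      (Set.range fun p : Fin (s + t + 1) => E (u p ⊗ₜ[ℂ] v (s + t - p))) := by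
    intro t s
    induction t with
    | zero =>
      rw [couple, pow_zero, Module.End.one_apply, Finset.sum_range]
      exact Submodule.sum_mem _ fun p _ => Submodule.smul_mem _ _ (Submodule.subset_span ⟨p, rfl⟩)
    | succ t ih =>
      rw [← (couple_isChain hE hu hv (he s)).raise]
      exact raise_mem_level hE hu hv _ ih
  have hab : (0 : ℝ) ≤ (a + b : ℕ) := by positivity
  have hind : LinearIndependent ℂ fun s : Fin (p + k + 1) =>
      couple ρ'' E u v (e s) s (p + k - s) := by
    refine linearIndependent_of_separated (fun _ : Unit => ρ'' (casimir q)) _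
      (fun _ s => (couple_isChain hE hu hv (he s)).casimir _) (fun x y hxy => ?_) fun s =>
      (couple_isChain hE hu hv (he s)).ne_zero (by linarith)
        (couple_zero_ne_zero hul hvl (he0 s)) _
    have := casimirEigenvalue_injective q (by linarith : 1 / 2 < g + g') (hxy ())
    exact Fin.ext (by omega)
  have hfin : FiniteDimensional ℂ (Submodule.span ℂ
      (Set.range fun l : Fin (p + k + 1) => E (u l ⊗ₜ[ℂ] v (p + k - l)))) :=
    FiniteDimensional.span_of_finite ℂ (Set.finite_range _)
  -- at level `p + k` there are as many coupled vectors as products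
  have heq := Submodule.eq_of_le_of_finrank_le
    (S₁ := Submodule.span ℂ (Set.range fun s : Fin (p + k + 1) =>
      couple ρ'' E u v (e s) s (p + k - s)))
    (S₂ := Submodule.span ℂ (Set.range fun l : Fin (p + k + 1) => E (u l ⊗ₜ[ℂ] v (p + k - l))))
    (by
      rw [Submodule.span_le]
      rintro _ ⟨s, rfl⟩
      have h1 := hmem (p + k - s) s
      rwa [Nat.add_sub_cancel' (Nat.lt_succ_iff.mp s.2)] at h1)
    (by
      rw [finrank_span_eq_card hind]
      exact finrank_range_le_card _)
  have h1 : E (u p ⊗ₜ[ℂ] v k) ∈ Submodule.span ℂ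
      (Set.range fun l : Fin (p + k + 1) => E (u l ⊗ₜ[ℂ] v (p + k - l))) :=
    Submodule.subset_span ⟨⟨p, by omega⟩, by simp⟩
  rw [← heq] at h1
  refine Submodule.span_mono ?_ h1
  rintro _ ⟨s, rfl⟩
  exact ⟨(s, p + k - s), rfl⟩

/-- `X` commutes with the action of the generators. -/
def Centralizes (X : Module.End ℂ M) (ρ : Osp q →ₐ[ℂ] Module.End ℂ M) : Prop :=
  ∀ (x : Gen) (u : M), X (ρ (Osp.gen q x) u) = ρ (Osp.gen q x) (X u)

lemma coupling_ext (E : M ⊗[ℂ] N ≃ₗ[ℂ] L) {f f' : Module.End ℂ L}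
    (h : ∀ u v, f (E (u ⊗ₜ v)) = f' (E (u ⊗ₜ v))) (x : L) : f x = f' x := by
  have h1 : f ∘ₗ E.toLinearMap = f' ∘ₗ E.toLinearMap := TensorProduct.ext' h
  have := LinearMap.congr_fun h1 (E.symm x)
  simpa using this

lemma Centralizes.coupling_left (hE : IsCoupling ρ ρ' ρ'' E) {X : Module.End ℂ M}
    (hX : Centralizes X ρ) {Y : Module.End ℂ L} (hY : ∀ u v, Y (E (u ⊗ₜ v)) = E (X u ⊗ₜ v)) :
    Centralizes Y ρ'' := by
  intro x
  refine coupling_ext E (f := Y * ρ'' (Osp.gen q x)) (f' := ρ'' (Osp.gen q x) * Y) fun u v => ?_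
  cases x <;>
    simp only [Module.End.mul_apply, hY, hE.Ap, hE.Am, hE.K, hE.Kinv, hE.P, map_add, hX _ _]

lemma Centralizes.coupling_right (hE : IsCoupling ρ ρ' ρ'' E) {X : Module.End ℂ N}
    (hX : Centralizes X ρ') {Y : Module.End ℂ L} (hY : ∀ u v, Y (E (u ⊗ₜ v)) = E (u ⊗ₜ X v)) :
    Centralizes Y ρ'' := by
  intro x
  refine coupling_ext E (f := Y * ρ'' (Osp.gen q x)) (f' := ρ'' (Osp.gen q x) * Y) fun u v => ?_
  cases x <;>
    simp only [Module.End.mul_apply, hY, hE.Ap, hE.Am, hE.K, hE.Kinv, hE.P, map_add, hX _ _]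

lemma centralizes_casimir (ρ : Osp q →ₐ[ℂ] Module.End ℂ M) : Centralizes (ρ (casimir q)) ρ :=
  fun x u => LinearMap.congr_fun ((commute_casimir_gen q x).map ρ) u

lemma Centralizes.apply_raise_pow {X : Module.End ℂ M} (hX : Centralizes X ρ) {μ : ℂ} {w : M}
    (hw : X w = μ • w) (t : ℕ) :
    X ((ρ (Osp.gen q .Ap) ^ t) w) = μ • (ρ (Osp.gen q .Ap) ^ t) w := by
  induction t with
  | zero => exact hw
  | succ t ih => rw [pow_succ', Module.End.mul_apply, hX, ih, map_smul]

end Chains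

/-! ### Tensor products of the modules `W^(g)` -/

section TensorPowers

lemma snoc_eq_tens {n : ℕ} (u : H n) (w : W) :
    snoc u w = tens u (PiTensorProduct.tprod ℂ fun _ : Fin 1 => w) := by
  simp [snoc, snocEquiv, tens]

lemma tens_tprod {a b : ℕ} (x : Fin a → W) (y : Fin b → W) :
    tens (PiTensorProduct.tprod ℂ x) (PiTensorProduct.tprod ℂ y) =
      PiTensorProduct.tprod ℂ (Fin.append x y) :=
  TensorPower.tprod_mul_tprod ℂ x y

lemma snoc_tprod {n : ℕ} (x : Fin n → W) (w : W) :
    snoc (PiTensorProduct.tprod ℂ x) w =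
      PiTensorProduct.tprod ℂ (Fin.snoc x w : Fin (n + 1) → W) := by
  rw [snoc_eq_tens, tens_tprod, Fin.append_right_eq_snoc]

lemma tens_add_left {a b : ℕ} (u u' : H a) (v : H b) : tens (u + u') v = tens u v + tens u' v := by
  rw [tens, TensorProduct.add_tmul, map_add]; rfl

lemma tens_smul_left {a b : ℕ} (c : ℂ) (u : H a) (v : H b) : tens (c • u) v = c • tens u v := by
  rw [tens, ← TensorProduct.smul_tmul', map_smul]; rfl

lemma tens_add_right {a b : ℕ} (u : H a) (v v' : H b) : tens u (v + v') = tens u v + tens u v' := by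
  rw [tens, TensorProduct.tmul_add, map_add]; rfl

lemma tens_smul_right {a b : ℕ} (c : ℂ) (u : H a) (v : H b) : tens u (c • v) = c • tens u v := by
  rw [tens, TensorProduct.tmul_smul, map_smul]; rfl

lemma snoc_add_left {n : ℕ} (u u' : H n) (w : W) : snoc (u + u') w = snoc u w + snoc u' w := by
  rw [snoc_eq_tens, tens_add_left, ← snoc_eq_tens, ← snoc_eq_tens]

lemma snoc_smul_left {n : ℕ} (c : ℂ) (u : H n) (w : W) : snoc (c • u) w = c • snoc u w := by
  rw [snoc_eq_tens, tens_smul_left, ← snoc_eq_tens]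

lemma snoc_add_right {n : ℕ} (u : H n) (w w' : W) : snoc u (w + w') = snoc u w + snoc u w' := by
  rw [snoc, TensorProduct.tmul_add, map_add]; rfl

lemma snoc_smul_right {n : ℕ} (c : ℂ) (u : H n) (w : W) : snoc u (c • w) = c • snoc u w := by
  rw [snoc, TensorProduct.tmul_smul, map_smul]; rfl

lemma tens_snoc {a b : ℕ} (u : H a) (v : H b) (w : W) :
    tens u (snoc v w) = (snoc (tens u v) w : H (a + b + 1)) := by
  induction u using PiTensorProduct.induction_on with
  | smul_tprod c x =>
    induction v using PiTensorProduct.induction_on with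
    | smul_tprod c' y =>
      simp only [tens_smul_left, tens_smul_right, snoc_smul_left, tens_tprod, snoc_tprod]
      congr 3
      have h := Fin.append_assoc x y (fun _ : Fin 1 => w)
      rw [Fin.append_right_eq_snoc, Fin.append_right_eq_snoc] at h
      exact h.symm
    | add v v' hv hv' => rw [snoc_add_left, tens_add_right, tens_add_right, snoc_add_left, hv, hv']
  | add u u' hu hu' => rw [tens_add_left, tens_add_left, snoc_add_left, hu, hu']

/-- The vector `1` of the empty tensor product. -/
def emptyKet : H 0 := PiTensorProduct.tprod ℂ Fin.elim0

lemma exists_smul_emptyKet (v : H 0) : ∃ c : ℂ, v = c • emptyKet := by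
  induction v using PiTensorProduct.induction_on with
  | smul_tprod c x => exact ⟨c, by rw [emptyKet, Subsingleton.elim x Fin.elim0]⟩
  | add v v' hv hv' =>
    obtain ⟨c, rfl⟩ := hv
    obtain ⟨c', rfl⟩ := hv'
    exact ⟨c + c', (add_smul _ _ _).symm⟩

lemma tens_emptyKet {a : ℕ} (u : H a) : tens u emptyKet = u := by
  induction u using PiTensorProduct.induction_on with
  | smul_tprod c x =>
    rw [tens_smul_left, emptyKet, tens_tprod, Fin.append_right_nil _ _ rfl]
    rfl
  | add u u' hu hu' => rw [tens_add_left, hu, hu']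

/-- Every vector of `H (n + 1)` is a sum of vectors `u ⊗ w`. -/
lemma snoc_induction {n : ℕ} {p : H (n + 1) → Prop} (h : ∀ u w, p (snoc u w))
    (hadd : ∀ x y, p x → p y → p (x + y)) (x : H (n + 1)) : p x := by
  obtain ⟨z, rfl⟩ := (snocEquiv n).surjective x
  induction z using TensorProduct.induction_on with
  | zero => simpa [snoc] using h 0 0
  | tmul u w => exact h u w
  | add z z' hz hz' => rw [map_add]; exact hadd _ _ hz hz'

end TensorPowers

/-! ### The action on intervals of factors -/

section Intervals

variable (q : QParam) (γ : ℕ → ℝ)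

/-- An element of `osp_q(1|2) ⊗ osp_q(1|2)` acting on a tensor product of two representations. -/
def tensorRep {q : QParam} {M N : Type*} [AddCommGroup M] [Module ℂ M] [AddCommGroup N] [Module ℂ N]
    (ρ : Osp q →ₐ[ℂ] Module.End ℂ M) (ρ' : Osp q →ₐ[ℂ] Module.End ℂ N) :
    Osp q ⊗[ℂ] Osp q →ₐ[ℂ] Module.End ℂ (M ⊗[ℂ] N) :=
  (Module.endTensorEndAlgHom (R := ℂ) (S := ℂ) (A := ℂ) (M := M) (N := N)).comp
    (Algebra.TensorProduct.map ρ ρ')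

lemma tensorRep_tmul {q : QParam} {M N : Type*} [AddCommGroup M] [Module ℂ M] [AddCommGroup N]
    [Module ℂ N] (ρ : Osp q →ₐ[ℂ] Module.End ℂ M) (ρ' : Osp q →ₐ[ℂ] Module.End ℂ N)
    (x y : Osp q) (u : M) (v : N) : tensorRep ρ ρ' (x ⊗ₜ y) (u ⊗ₜ v) = ρ x u ⊗ₜ ρ' y v := rfl

lemma intervalRep_of_mem {a b n : ℕ} (h : a ≤ n + 1 ∧ n + 1 ≤ b) (x : Osp q) (z : H n ⊗[ℂ] W) :
    intervalRep q γ a b (n + 1) x (snocEquiv n z) =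
      snocEquiv n (tensorRep (M := H n) (N := W) (intervalRep q γ a b n) (rep q (γ (n + 1)))
        (comul q x) z) := by
  rw [intervalRep, if_pos h]
  simp [LinearEquiv.conjAlgEquiv_apply, tensorRep]

lemma intervalRep_of_notMem {a b n : ℕ} (h : ¬(a ≤ n + 1 ∧ n + 1 ≤ b)) (x : Osp q) (u : H n)
    (w : W) : intervalRep q γ a b (n + 1) x (snoc u w) = snoc (intervalRep q γ a b n x u) w := by
  rw [intervalRep, if_neg h, snoc]
  simp [LinearEquiv.conjAlgEquiv_apply, snoc]
  rfl

lemma intervalRep_zero (a b : ℕ) (x : Osp q) (v : H 0) :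
    intervalRep q γ a b 0 x v = counit q x • v := by
  simp [intervalRep, Algebra.ofId_apply, Module.algebraMap_end_apply]

lemma intervalRep_congr {a b b' n : ℕ} (h : n ≤ b) (h' : n ≤ b') :
    intervalRep q γ a b n = intervalRep q γ a b' n := by
  induction n with
  | zero => rfl
  | succ n ih =>
    rw [intervalRep, intervalRep, ih (by omega) (by omega)]
    simp only [h, h', and_true]

/-- As long as no factor of the interval is reached, the action is through the counit. -/
lemma intervalRep_of_lt {a b n : ℕ} (h : n < a) (x : Osp q) (v : H n) :
    intervalRep q γ a b n x v = counit q x • v := by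
  induction n with
  | zero => exact intervalRep_zero q γ a b x v
  | succ n ih =>
    induction v using snoc_induction with
    | h u w => rw [intervalRep_of_notMem q γ (by omega), ih (by omega), snoc_smul_left]
    | hadd y z hy hz => rw [map_add, hy, hz, smul_add]

lemma comul_gen (x : Gen) : comul q (Osp.gen q x) =
    genImage (Osp.gen q .Ap ⊗ₜ[ℂ] (Osp.gen q .K * Osp.gen q .P) + Osp.gen q .Kinv ⊗ₜ Osp.gen q .Ap)
      (Osp.gen q .Am ⊗ₜ (Osp.gen q .K * Osp.gen q .P) + Osp.gen q .Kinv ⊗ₜ Osp.gen q .Am)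
      (Osp.gen q .K ⊗ₜ Osp.gen q .K) (Osp.gen q .Kinv ⊗ₜ Osp.gen q .Kinv)
      (Osp.gen q .P ⊗ₜ Osp.gen q .P) x := Osp.lift_gen q _ x

lemma counit_gen (x : Gen) : counit q (Osp.gen q x) = genImage 0 0 1 1 1 x := Osp.lift_gen q _ x

lemma snoc_isCoupling {a b n : ℕ} (h : a ≤ n + 1 ∧ n + 1 ≤ b) :
    IsCoupling (M := H n) (N := W) (L := H (n + 1)) (intervalRep q γ a b n) (rep q (γ (n + 1)))
      (intervalRep q γ a b (n + 1)) (snocEquiv n) := by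
  constructor <;> intro u v <;> rw [intervalRep_of_mem q γ h, comul_gen] <;>
    simp only [genImage, map_add, LinearMap.add_apply, tensorRep_tmul, map_mul,
      Module.End.mul_apply]

/-- Coassociativity, in the form in which it is needed: on `i + r` factors the generators act
through the coproduct of their actions on the first `i` and on the last `r` factors. -/
lemma tens_isCoupling (i r : ℕ) {b b' : ℕ} (hb : i + r ≤ b) (hb' : r ≤ b') :
    IsCoupling (M := H i) (N := H r) (L := H (i + r)) (intervalRep q γ 1 b i)
      (intervalRep q (fun l => γ (i + l)) 1 b' r) (intervalRep q γ 1 b (i + r))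
      (TensorPower.mulEquiv (R := ℂ) (M := W)) := by
  induction r with
  | zero =>
    have key : ∀ (u : H i) (c : ℂ),
        TensorPower.mulEquiv (R := ℂ) (M := W) (u ⊗ₜ[ℂ] (c • emptyKet)) = (c • u : H (i + 0)) := fun u c => by
      have := tens_smul_right c u emptyKet
      rwa [tens_emptyKet] at this
    constructor <;> intro u v <;> obtain ⟨c, rfl⟩ := exists_smul_emptyKet v <;>
      simp only [intervalRep_zero, counit_gen, genImage, zero_smul, one_smul, smul_zero,
        TensorProduct.tmul_zero, map_zero, add_zero, key, map_smul] <;> rfl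
  | succ r ih =>
    have h := ih (by omega) (by omega)
    have h1 := snoc_isCoupling q γ (a := 1) (b := b) (n := i + r) (by omega)
    have h2 := snoc_isCoupling q (fun l => γ (i + l)) (a := 1) (b := b') (n := r) (by omega)
    have key : ∀ (u : H i) (v : H r) (w : W), TensorPower.mulEquiv (R := ℂ) (M := W)
        (u ⊗ₜ[ℂ] (snocEquiv r (v ⊗ₜ[ℂ] w))) =
        (snocEquiv (i + r) (TensorPower.mulEquiv (R := ℂ) (M := W) (u ⊗ₜ[ℂ] v) ⊗ₜ[ℂ] w) :
          H (i + r + 1)) := tens_snoc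
    exact IsCoupling.assoc (M := H i) (N := H r) (L := H (i + r)) (R := W) (N' := H (r + 1))
      (L' := H (i + r + 1)) h h2 h1 key

/-- An element that acts on an interval within the first `i` factors leaves the others untouched. -/
lemma intervalRep_tens_left {a b i : ℕ} (hb : b ≤ i) (r : ℕ) (x : Osp q) (u : H i) (v : H r) :
    intervalRep q γ a b (i + r) x (tens u v) = tens (intervalRep q γ a b i x u) v := by
  induction r with
  | zero =>
    obtain ⟨c, rfl⟩ := exists_smul_emptyKet v
    rw [tens_smul_right, tens_smul_right, tens_emptyKet, tens_emptyKet]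
    exact map_smul _ c u
  | succ r ih =>
    induction v using snoc_induction with
    | h v w =>
      rw [tens_snoc, tens_snoc, ← ih]
      exact intervalRep_of_notMem q γ (n := i + r) (by omega) x _ w
    | hadd y z hy hz => rw [tens_add_right, tens_add_right, map_add, hy, hz]

/-- The action on an interval within the last `r` factors, by induction on `r`; it starts with no
factor at all, where the element acts through the counit on either side. -/
lemma intervalRep_tens_right {a : ℕ} (b i : ℕ) (ha : 1 ≤ a) (r : ℕ) (x : Osp q) (u : H i)
    (v : H r) : intervalRep q γ (i + a) (i + b) (i + r) x (tens u v) =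
      tens u (intervalRep q (fun l => γ (i + l)) a b r x v) := by
  induction r generalizing x with
  | zero =>
    obtain ⟨c, rfl⟩ := exists_smul_emptyKet v
    rw [intervalRep_zero, tens_smul_right, tens_smul_right, tens_smul_right, tens_emptyKet,
      map_smul, smul_comm (counit q x)]
    congr 1
    exact intervalRep_of_lt q γ (by omega) x u
  | succ r ih =>
    induction v using snoc_induction with
    | h v w =>
      rw [tens_snoc]
      by_cases hr : a ≤ r + 1 ∧ r + 1 ≤ b
      · have h1 := intervalRep_of_mem q γ (a := i + a) (b := i + b) (n := i + r) (by omega) x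
          (tens u v ⊗ₜ[ℂ] w)
        have h2 := intervalRep_of_mem q (fun l => γ (i + l)) hr x (v ⊗ₜ[ℂ] w)
        refine h1.trans ?_
        rw [snoc, h2]
        generalize comul q x = z
        induction z using TensorProduct.induction_on with
        | zero => simp [tens]
        | tmul y y' =>
          rw [tensorRep_tmul, tensorRep_tmul, ih]
          exact (tens_snoc u _ _).symm
        | add z z' hz hz' =>
          simp only [map_add, LinearMap.add_apply, tens_add_right]
          rw [hz, hz']
      · rw [intervalRep_of_notMem q (fun l => γ (i + l)) hr, tens_snoc, ← ih]
        exact intervalRep_of_notMem q γ (n := i + r) (by omega) x _ w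
    | hadd y z hy hz => rw [tens_add_right, map_add, map_add, tens_add_right, hy, hz]

end Intervals

/-! ### The coupled vectors form chains and span -/

section Spanning

variable {q : QParam} {M N L : Type*} [AddCommGroup M] [Module ℂ M] [AddCommGroup N] [Module ℂ N]
  [AddCommGroup L] [Module ℂ L]

lemma eq_top_of_coupling_mem (E : M ⊗[ℂ] N ≃ₗ[ℂ] L) {A : Set M} {B : Set N}
    (hA : Submodule.span ℂ A = ⊤) (hB : Submodule.span ℂ B = ⊤) {S : Submodule ℂ L}
    (h : ∀ u ∈ A, ∀ v ∈ B, E (u ⊗ₜ v) ∈ S) : S = ⊤ := by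
  have h1 : ∀ u ∈ A, ∀ v, E (u ⊗ₜ v) ∈ S := by
    intro u hu v
    have hv : v ∈ Submodule.span ℂ B := hB ▸ Submodule.mem_top
    induction hv using Submodule.span_induction with
    | mem v hv => exact h u hu v hv
    | zero => simp
    | add v v' _ _ hv hv' => rw [TensorProduct.tmul_add, map_add]; exact add_mem hv hv'
    | smul c v _ hv => rw [TensorProduct.tmul_smul, map_smul]; exact S.smul_mem c hv
  have h2 : ∀ u v, E (u ⊗ₜ v) ∈ S := by
    intro u v
    have hu : u ∈ Submodule.span ℂ A := hA ▸ Submodule.mem_top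
    induction hu using Submodule.span_induction with
    | mem u hu => exact h1 u hu v
    | zero => simp
    | add u u' _ _ hu hu' => rw [TensorProduct.add_tmul, map_add]; exact add_mem hu hu'
    | smul c u _ hu => rw [← TensorProduct.smul_tmul', map_smul]; exact S.smul_mem c hu
  rw [eq_top_iff]
  rintro x -
  obtain ⟨z, rfl⟩ := E.surjective x
  induction z using TensorProduct.induction_on with
  | zero => simp
  | tmul u v => exact h2 u v
  | add z z' hz hz' => rw [map_add]; exact add_mem hz hz'

end Spanning

section Factors

variable (q : QParam) (γ : ℕ → ℝ)

lemma snoc_isCoupling_full (n : ℕ) :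
    IsCoupling (M := H n) (N := W) (L := H (n + 1)) (intervalRep q γ 1 n n) (rep q (γ (n + 1)))
      (intervalRep q γ 1 (n + 1) (n + 1)) (snocEquiv n) := by
  rw [intervalRep_congr q γ (b := n) (b' := n + 1) le_rfl (by omega)]
  exact snoc_isCoupling q γ (by omega)

lemma tens_isCoupling_full (i r : ℕ) :
    IsCoupling (M := H i) (N := H r) (L := H (i + r)) (intervalRep q γ 1 i i)
      (intervalRep q (fun l => γ (i + l)) 1 r r) (intervalRep q γ 1 (i + r) (i + r))
      (TensorPower.mulEquiv (R := ℂ) (M := W)) := by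
  rw [intervalRep_congr q γ (b := i) (b' := i + r) le_rfl (by omega)]
  exact tens_isCoupling q γ i r le_rfl le_rfl

/-- The vectors `A₊^k |0⟩` of `W^(g)`. -/
def ketChain (g : ℝ) (k : ℕ) : W := (∏ l ∈ Finset.Icc 1 k, sqrtSigma q l g) • basisKet k

lemma rep_gen (g : ℝ) (x : Gen) : rep q g (Osp.gen q x) =
    genImage (raising q g) (lowering q g) (weight q g) (weightInv q g) parity x :=
  Osp.lift_gen q _ x

lemma ketChain_isChain (g : ℝ) : IsChain (rep q g) 0 g (ketChain q g) where
  raise k := by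
    rw [rep_gen, genImage, ketChain, ketChain, map_smul, raising_ket, smul_smul,
      Finset.prod_Icc_succ_top (by omega)]
  lower_zero := by simp [rep_gen, genImage, ketChain, lowering_ket, sqrtSigma_zero]
  weight_zero := by simp [rep_gen, genImage, ketChain, weight_ket]
  parity_zero := by simp [rep_gen, genImage, ketChain, parity_ket]

variable {q} in
lemma prod_sqrtSigma_ne_zero {g : ℝ} (hg : 1 / 2 < g) (k : ℕ) :
    ∏ l ∈ Finset.Icc 1 k, sqrtSigma q l g ≠ 0 :=
  Finset.prod_ne_zero_iff.mpr fun l hl =>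
    sqrtSigma_ne_zero q (by have := (Finset.mem_Icc.mp hl).1; omega) hg

lemma ketChain_zero_ne_zero (g : ℝ) : ketChain q g 0 ≠ 0 := by
  simp [ketChain, basisKet]

lemma span_ketChain {g : ℝ} (hg : 1 / 2 < g) :
    Submodule.span ℂ (Set.range (ketChain q g)) = ⊤ := by
  rw [eq_top_iff, ← (Finsupp.basisSingleOne (R := ℂ) (ι := ℕ)).span_eq, Submodule.span_le]
  rintro _ ⟨k, rfl⟩
  have h1 : Finsupp.basisSingleOne (R := ℂ) k =
      (∏ l ∈ Finset.Icc 1 k, sqrtSigma q l g)⁻¹ • ketChain q g k := by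
    rw [ketChain, smul_smul, inv_mul_cancel₀ (prod_sqrtSigma_ne_zero hg k), one_smul]
    simp [basisKet]
  rw [h1]
  exact Submodule.smul_mem _ _ (Submodule.subset_span ⟨k, rfl⟩)

/-- The coefficients `c_k`, in terms of the parity exponent `a` and weight `a + G` of the chain that
is extended, the parameter `g` of the new factor, and the level `s`. -/
def extCoef (a : ℕ) (G g : ℝ) (s k : ℕ) : ℂ :=
  (-1) ^ (k * s + k * (k - 1) / 2) * qpow q (-((k : ℝ) / 2) * (((a + s : ℕ) : ℝ) + (G + g) - 1)) *
    ∏ l ∈ Finset.range k, sqrtSigma q (s - l) g / sigma q (l + 1) (a + G)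

lemma psum_succ (j : ℕ → ℕ) (n : ℕ) : psum j (n + 1) = psum j n + j (n + 1) :=
  Finset.sum_Icc_succ_top (by omega) _

lemma gsum_succ (n : ℕ) : gsum γ 1 (n + 1) = gsum γ 1 n + γ (n + 1) :=
  Finset.sum_Icc_succ_top (by omega) _

lemma coef_eq_extCoef (j : ℕ → ℕ) (n k : ℕ) : coef q γ j (n + 2) k =
    extCoef q (psum j n) (gsum γ 1 (n + 1)) (γ (n + 2)) (j (n + 1)) k := by
  have e1 : n + 2 - 1 = n + 1 := rfl
  have e2 : n + 2 - 2 = n := rfl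
  rw [coef, extCoef, e1, e2, psum_succ, gsum_succ]

lemma triangle_succ (k : ℕ) : (k + 1) * (k + 1 - 1) / 2 = k * (k - 1) / 2 + k := by
  rw [← Finset.sum_range_id_mul_two (k + 1), ← Finset.sum_range_id_mul_two k,
    Nat.mul_div_cancel _ two_pos, Nat.mul_div_cancel _ two_pos, Finset.sum_range_succ]

/-- After renormalizing `|s - k⟩` to a member of the chain `A₊^k |0⟩`, the coefficients `c_k` are
those of a lowest weight vector. -/
lemma extCoef_isLowestCoeff {a : ℕ} {G g : ℝ} (hG : 1 / 2 < G) (hg : 1 / 2 < g) (s : ℕ) :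
    IsLowestCoeff q a 0 G g s
      (fun k => extCoef q a G g s k / ∏ l ∈ Finset.Icc 1 (s - k), sqrtSigma q l g) := by
  intro k hk
  obtain ⟨m, rfl⟩ := Nat.exists_eq_add_of_lt hk
  have h1 : k + m + 1 - (k + 1) = m := by omega
  have h2 : k + m + 1 - k = m + 1 := by omega
  have ha : (0 : ℝ) ≤ a := by positivity
  have hs : sigma q (k + 1) (a + G) ≠ 0 := sigma_ne_zero q k.succ_ne_zero (by linarith)
  have hr : sqrtSigma q (m + 1) g ≠ 0 := sqrtSigma_ne_zero q m.succ_ne_zero hg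
  have hp := prod_sqrtSigma_ne_zero (q := q) hg m
  have hsq := sqrtSigma_mul_self q (m + 1) g
  simp only [extCoef, h1, h2, triangle_succ, Finset.prod_range_succ,
    Finset.prod_Icc_succ_top (Nat.le_add_left 1 m), Nat.cast_zero, zero_add]
  have e1 : qpow q (-(((k + 1 : ℕ) : ℝ) / 2) * (((a + (k + m + 1) : ℕ) : ℝ) + (G + g) - 1)) *
      qpow q ((m + g) / 2) =
      qpow q (-((k : ℝ) / 2) * (((a + (k + m + 1) : ℕ) : ℝ) + (G + g) - 1)) *
      qpow q (-((k + (a + G)) / 2)) := by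
    rw [← qpow_add, ← qpow_add]
    congr 1
    push_cast
    ring
  have e2 : (-1 : ℂ) ^ ((k + 1) * (k + m + 1) + (k * (k - 1) / 2 + k)) * (-1) ^ m =
      -(-1) ^ (k * (k + m + 1) + k * (k - 1) / 2) := by
    rw [← pow_add, show (k + 1) * (k + m + 1) + (k * (k - 1) / 2 + k) + m =
      k * (k + m + 1) + k * (k - 1) / 2 + 2 * (k + m) + 1 by ring, pow_succ, pow_add _ _ (2 * _),
      pow_mul]
    simp
  generalize (∏ l ∈ Finset.range k, sqrtSigma q (k + m + 1 - l) g / sigma q (l + 1) (a + G)) = R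
  generalize (-1 : ℂ) ^ ((k + 1) * (k + m + 1) + (k * (k - 1) / 2 + k)) = x₁ at e2 ⊢
  generalize (-1 : ℂ) ^ (k * (k + m + 1) + k * (k - 1) / 2) = x₂ at e2 ⊢
  generalize qpow q (-(((k + 1 : ℕ) : ℝ) / 2) * (((a + (k + m + 1) : ℕ) : ℝ) + (G + g) - 1)) = y₁
    at e1 ⊢
  generalize qpow q (-((k : ℝ) / 2) * (((a + (k + m + 1) : ℕ) : ℝ) + (G + g) - 1)) = y₂ at e1 ⊢
  rw [← hsq]
  field_simp
  linear_combination (R * sqrtSigma q (m + 1) g) *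
    (x₁ * (-1) ^ m * e1 + y₂ * qpow q (-((k + (a + G)) / 2)) * e2)

/-- One more factor is coupled to a chain `Φ` in `H n`. -/
def extend {n : ℕ} (Φ : ℕ → H n) (a : ℕ) (G : ℝ) (s t : ℕ) : H (n + 1) :=
  (raisingOp q γ (n + 1) ^ t) (∑ k ∈ Finset.range (s + 1),
    extCoef q a G (γ (n + 1)) s k • snoc (Φ k) (basisKet (s - k)))

variable {q γ}

section Extend

variable {n : ℕ} {Φ : ℕ → H n} {a : ℕ} {G : ℝ}

lemma extend_eq_couple (hg : 1 / 2 < γ (n + 1)) (s t : ℕ) : extend q γ Φ a G s t =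
    couple (M := H n) (N := W) (L := H (n + 1)) (intervalRep q γ 1 (n + 1) (n + 1)) (snocEquiv n)
      Φ (ketChain q (γ (n + 1))) (fun k => extCoef q a G (γ (n + 1)) s k /
        ∏ l ∈ Finset.Icc 1 (s - k), sqrtSigma q l (γ (n + 1))) s t := by
  rw [extend, couple]
  congr 1
  refine Finset.sum_congr rfl fun k _ => ?_
  have h := snoc_smul_right (∏ l ∈ Finset.Icc 1 (s - k), sqrtSigma q l (γ (n + 1))) (Φ k)
    (basisKet (s - k))
  change _ = _ • snoc (Φ k) (ketChain q (γ (n + 1)) (s - k))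
  rw [ketChain, h, smul_smul, div_mul_cancel₀ _ (prod_sqrtSigma_ne_zero hg _)]

lemma extCoef_zero_ne_zero (hg : 1 / 2 < γ (n + 1)) (s : ℕ) :
    extCoef q a G (γ (n + 1)) s 0 /
      ∏ l ∈ Finset.Icc 1 (s - 0), sqrtSigma q l (γ (n + 1)) ≠ 0 :=
  div_ne_zero (by simp [extCoef, qpow_zero]) (prod_sqrtSigma_ne_zero hg _)

lemma extend_isChain (hG : 1 / 2 < G) (hg : 1 / 2 < γ (n + 1))
    (hΦ : IsChain (M := H n) (intervalRep q γ 1 n n) a G Φ) (s : ℕ) :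
    IsChain (M := H (n + 1)) (intervalRep q γ 1 (n + 1) (n + 1)) (a + s) (G + γ (n + 1))
      (extend q γ Φ a G s) := by
  rw [funext (extend_eq_couple hg s)]
  exact couple_isChain (snoc_isCoupling_full q γ n) hΦ (ketChain_isChain q _)
    (extCoef_isLowestCoeff q hG hg s)

lemma extend_zero_ne_zero (hG : 1 / 2 < G) (hg : 1 / 2 < γ (n + 1))
    (hΦ : IsChain (M := H n) (intervalRep q γ 1 n n) a G Φ) (h0 : Φ 0 ≠ 0) (s : ℕ) :
    extend q γ Φ a G s 0 ≠ 0 := by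
  rw [extend_eq_couple hg]
  exact couple_zero_ne_zero (M := H n) (N := W) (L := H (n + 1)) (hΦ.linearIndependent hG h0)
    ((ketChain_isChain q _).linearIndependent hg (ketChain_zero_ne_zero q _))
    (extCoef_zero_ne_zero hg s)

/-- If chains span `H n`, then their extensions span `H (n + 1)`. -/
lemma eq_top_of_extend_mem {ι : Type*} {F : ι → ℕ → H n} {a : ι → ℕ} (hG : 1 / 2 < G)
    (hg : 1 / 2 < γ (n + 1)) (hF : ∀ x, IsChain (M := H n) (intervalRep q γ 1 n n) (a x) G (F x))
    (h0 : ∀ x, F x 0 ≠ 0)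
    (hspan : Submodule.span ℂ (Set.range fun x : ι × ℕ => F x.1 x.2) = ⊤)
    {S : Submodule ℂ (H (n + 1))} (hS : ∀ x s t, extend q γ (F x) (a x) G s t ∈ S) : S = ⊤ := by
  refine eq_top_of_coupling_mem (M := H n) (N := W) (L := H (n + 1)) (snocEquiv n) hspan
    (span_ketChain q hg) ?_
  rintro _ ⟨⟨x, p⟩, rfl⟩ _ ⟨k, rfl⟩
  have h := mem_span_couple (snoc_isCoupling_full q γ n) (hF x) (ketChain_isChain q _) hG hg (h0 x)
    (ketChain_zero_ne_zero q _) (fun s => extCoef_isLowestCoeff q hG hg s)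
    (fun s => extCoef_zero_ne_zero hg s) p k
  refine Submodule.span_le.mpr ?_ h
  rintro _ ⟨⟨s, t⟩, rfl⟩
  have := hS x s t
  rwa [extend_eq_couple hg] at this

end Extend

/-! ### Intermediate Casimir operators -/

section IntermediateCasimir

lemma centralizes_casimirOp_snoc {n a b : ℕ} (hb : b ≤ n)
    (h : Centralizes (M := H n) (casimirOp q γ n a b) (intervalRep q γ 1 n n)) :
    Centralizes (M := H (n + 1)) (casimirOp q γ (n + 1) a b)
      (intervalRep q γ 1 (n + 1) (n + 1)) :=
  h.coupling_left (snoc_isCoupling_full q γ n) fun u w =>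
    intervalRep_of_notMem q γ (by omega) (casimir q) u w

lemma centralizes_casimirOp_one {n m : ℕ} (hmn : m ≤ n) :
    Centralizes (M := H n) (casimirOp q γ n 1 m) (intervalRep q γ 1 n n) := by
  induction n, hmn using Nat.le_induction with
  | base => exact centralizes_casimir _
  | succ n hmn ih => exact centralizes_casimirOp_snoc hmn ih

/-- The eigenvalues of the Casimir operators of the first factors are inherited on extension. -/
lemma casimirOp_extend {n a b : ℕ} (hb : b ≤ n)
    (h : Centralizes (M := H n) (casimirOp q γ n a b) (intervalRep q γ 1 n n)) {Φ : ℕ → H n}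
    {μ : ℂ} (hΦ : ∀ k, casimirOp q γ n a b (Φ k) = μ • Φ k) (c : ℕ) (G : ℝ) (s t : ℕ) :
    casimirOp q γ (n + 1) a b (extend q γ Φ c G s t) = μ • extend q γ Φ c G s t := by
  refine (centralizes_casimirOp_snoc hb h).apply_raise_pow ?_ t
  rw [map_sum, Finset.smul_sum]
  refine Finset.sum_congr rfl fun k _ => ?_
  have h1 : casimirOp q γ (n + 1) a b (snoc (Φ k) (basisKet (s - k))) =
      snoc (casimirOp q γ n a b (Φ k)) (basisKet (s - k)) :=
    intervalRep_of_notMem q γ (by omega) (casimir q) _ _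
  rw [map_smul, h1, hΦ, snoc_smul_left, smul_comm]

end IntermediateCasimir

/-! ### The vectors `ψ` -/

section Psi

lemma tensorBasis_apply {n : ℕ} (ν : Fin n → ℕ) :
    tensorBasis n ν = PiTensorProduct.tprod ℂ fun k => basisKet (ν k) := by
  simp [tensorBasis, basisKet]

lemma half_lt_gsum {n : ℕ} (hγ : ∀ k ∈ Finset.Icc 1 (n + 1), 1 / 2 < γ k) :
    1 / 2 < gsum γ 1 (n + 1) := by
  have h1 : γ (n + 1) ≤ gsum γ 1 (n + 1) :=
    Finset.single_le_sum (f := γ) (fun k hk => by linarith [hγ k hk])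
      (Finset.mem_Icc.mpr ⟨by omega, le_rfl⟩)
  linarith [hγ (n + 1) (Finset.mem_Icc.mpr ⟨by omega, le_rfl⟩)]

lemma psi_succ (n : ℕ) (h : ℕ → ℕ) (p : ℕ) : psi q γ (n + 2) h p =
    extend q γ (psi q γ (n + 1) h) (psum h n) (gsum γ 1 (n + 1)) (h (n + 1)) p := by
  simp only [psi, extend, coef_eq_extCoef]

lemma psi_one (h : ℕ → ℕ) (p : ℕ) : psi q γ 1 h p = snoc emptyKet (ketChain q (γ 1) p) := by
  rw [ketChain, snoc_smul_right, emptyKet, snoc_tprod, psi]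
  congr 2

lemma psum_congr {h h' : ℕ → ℕ} {n : ℕ} (hh : ∀ k ∈ Finset.Icc 1 n, h k = h' k) :
    psum h n = psum h' n := Finset.sum_congr rfl hh

lemma psi_congr {h h' : ℕ → ℕ} (n : ℕ) (hh : ∀ k ∈ Finset.Icc 1 n, h k = h' k) :
    psi q γ (n + 1) h = psi q γ (n + 1) h' := by
  induction n with
  | zero => rfl
  | succ n ih =>
    have h1 : ∀ k ∈ Finset.Icc 1 n, h k = h' k := fun k hk =>
      hh k (Finset.Icc_subset_Icc_right n.le_succ hk)
    funext p
    rw [psi_succ, psi_succ, ih h1, psum_congr h1,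
      hh (n + 1) (Finset.mem_Icc.mpr ⟨by omega, le_rfl⟩)]

lemma psi_isChain (n : ℕ) (hγ : ∀ k ∈ Finset.Icc 1 (n + 1), 1 / 2 < γ k) (h : ℕ → ℕ) :
    IsChain (M := H (n + 1)) (intervalRep q γ 1 (n + 1) (n + 1)) (psum h n) (gsum γ 1 (n + 1))
      (psi q γ (n + 1) h) ∧ psi q γ (n + 1) h 0 ≠ 0 := by
  induction n with
  | zero =>
    have hc := snoc_isCoupling_full q γ 0
    have hk := ketChain_isChain q (γ 1)
    have hs : ∀ (c : ℂ) (w : W), snocEquiv 0 (emptyKet ⊗ₜ[ℂ] (c • w)) = c • snoc emptyKet w :=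
      fun c w => snoc_smul_right c emptyKet w
    have e1 : psum h 0 = 0 := rfl
    have e2 : gsum γ 1 (0 + 1) = γ 1 := by simp [gsum]
    have h0 : psi q γ 1 h 0 ≠ 0 := by
      rw [psi]
      simpa [tensorBasis_apply] using (tensorBasis 1).ne_zero fun _ => 0
    refine ⟨?_, h0⟩
    rw [funext (psi_one (q := q) (γ := γ) h), e1, e2]
    refine ⟨fun k => (hc.Ap _ _).trans ?_, (hc.Am _ _).trans ?_, (hc.K _ _).trans ?_,
      (hc.P _ _).trans ?_⟩
    · simp only [intervalRep_zero, counit_gen, genImage, zero_smul, one_smul, zero_add]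
      rw [hk.raise]
      rfl
    · simp only [intervalRep_zero, counit_gen, genImage, zero_smul, one_smul, zero_add]
      rw [hk.lower_zero]
      simp
    · simp only [intervalRep_zero, counit_gen, genImage, one_smul]
      rw [hk.weight_zero, hs]
    · simp only [intervalRep_zero, counit_gen, genImage, one_smul]
      rw [hk.parity_zero, hs]
  | succ n ih =>
    obtain ⟨h1, h2⟩ := ih fun k hk => hγ k (Finset.Icc_subset_Icc_right (Nat.le_succ _) hk)
    have hG := half_lt_gsum (γ := γ) (n := n) fun k hk =>
      hγ k (Finset.Icc_subset_Icc_right (Nat.le_succ _) hk)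
    have hg := hγ (n + 2) (Finset.mem_Icc.mpr ⟨by omega, le_rfl⟩)
    rw [funext (psi_succ n h), psum_succ, gsum_succ]
    exact ⟨extend_isChain hG hg h1 _, extend_zero_ne_zero hG hg h1 h2 _⟩

lemma span_psi (n : ℕ) (hγ : ∀ k ∈ Finset.Icc 1 (n + 1), 1 / 2 < γ k) :
    Submodule.span ℂ (Set.range fun x : (ℕ → ℕ) × ℕ => psi q γ (n + 1) x.1 x.2) = ⊤ := by
  induction n with
  | zero =>
    have he : Submodule.span ℂ {emptyKet} = ⊤ := by
      rw [eq_top_iff]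
      rintro v -
      obtain ⟨c, rfl⟩ := exists_smul_emptyKet v
      exact Submodule.smul_mem _ _ (Submodule.subset_span rfl)
    refine eq_top_of_coupling_mem (M := H 0) (N := W) (L := H 1) (snocEquiv 0) he
      (span_ketChain q (hγ 1 (by simp))) ?_
    rintro _ rfl _ ⟨k, rfl⟩
    exact Submodule.subset_span ⟨(0, k), psi_one 0 k⟩
  | succ n ih =>
    have hγ' : ∀ k ∈ Finset.Icc 1 (n + 1), 1 / 2 < γ k := fun k hk =>
      hγ k (Finset.Icc_subset_Icc_right (Nat.le_succ _) hk)
    refine eq_top_of_extend_mem (half_lt_gsum hγ')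
      (hγ (n + 2) (Finset.mem_Icc.mpr ⟨by omega, le_rfl⟩)) (fun h => (psi_isChain n hγ' h).1)
      (fun h => (psi_isChain n hγ' h).2) (ih hγ') fun h s t => ?_
    -- `ψ` for the entries `h` does not involve the entry that belongs to the new factor
    have h1 : ∀ k ∈ Finset.Icc 1 n, h k = Function.update h (n + 1) s k := fun k hk => by
      rw [Function.update_of_ne]
      have := (Finset.mem_Icc.mp hk).2
      omega
    refine Submodule.subset_span ⟨(Function.update h (n + 1) s, t), ?_⟩
    simp only
    rw [psi_succ, psi_congr n h1, psum_congr h1, Function.update_self]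

lemma casimirOp_psi {m : ℕ} (n : ℕ) (hm : m ≤ n)
    (hγ : ∀ k ∈ Finset.Icc 1 (n + 1), 1 / 2 < γ k) (h : ℕ → ℕ) (p : ℕ) :
    casimirOp q γ (n + 1) 1 (m + 1) (psi q γ (n + 1) h p) =
      casimirEigenvalue q (psum h m) (gsum γ 1 (m + 1)) • psi q γ (n + 1) h p := by
  induction n, hm using Nat.le_induction generalizing p with
  | base => exact (psi_isChain m hγ h).1.casimir p
  | succ n hmn ih =>
    rw [psi_succ]
    exact casimirOp_extend (by omega) (centralizes_casimirOp_one (by omega))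
      (ih fun k hk => hγ k (Finset.Icc_subset_Icc_right (Nat.le_succ _) hk)) _ _ _ _

end Psi

end Factors

/-! ### The vectors `Ψ` and `Θ` -/

section Coupled

variable {q : QParam} {γ : ℕ → ℝ}

lemma gsum_shift (i r : ℕ) : gsum (fun l => γ (i + l)) 1 r = gsum γ (i + 1) (i + r) := by
  induction r with
  | zero => simp [gsum]
  | succ r ih =>
    rw [gsum_succ, ih]
    exact (Finset.sum_Icc_succ_top (by omega) _).symm

lemma gsum_add (i r : ℕ) : gsum γ 1 i + gsum (fun l => γ (i + l)) 1 r = gsum γ 1 (i + r) := by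
  induction r with
  | zero => simp [gsum]
  | succ r ih => rw [gsum_succ, ← add_assoc, ih, ← add_assoc i r 1, gsum_succ]

lemma psum_add (j : ℕ → ℕ) (a b : ℕ) :
    psum j a + psum (fun l => j (a + l)) b = psum j (a + b) := by
  induction b with
  | zero => simp [psum]
  | succ b ih => rw [psum_succ, ← add_assoc, ih, ← add_assoc a b 1, psum_succ]

lemma half_lt_gsum_of_pos {n : ℕ} (hn : 1 ≤ n) (hγ : ∀ k ∈ Finset.Icc 1 n, 1 / 2 < γ k) :
    1 / 2 < gsum γ 1 n := by
  obtain ⟨n, rfl⟩ := Nat.exists_eq_add_of_le' hn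
  exact half_lt_gsum hγ

/-- The ratio of successive coefficients of `Ψ` is the one that makes `Ψ(h, k, s, 0)` a lowest
weight vector. -/
lemma epsilon_isLowestCoeff {i r : ℕ} (h k : ℕ → ℕ) (hG : 1 / 2 < gsum γ 1 i) (s : ℕ) :
    IsLowestCoeff q (psum h (i - 1)) (psum k (r - 1)) (gsum γ 1 i)
      (gsum (fun l => γ (i + l)) 1 r) s (epsilon q γ i r h k s) := by
  intro p hp
  obtain ⟨m, rfl⟩ := Nat.exists_eq_add_of_lt hp
  have h1 : p + m + 1 - (p + 1) = m := by omega
  have h2 : p + m + 1 - p = m + 1 := by omega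
  rw [h1, h2, gsum_shift]
  have hα : ∀ l ∈ Finset.Icc 1 (p + 1), alpha q γ i r h k (p + m + 1) l ≠ 0 := by
    intro l hl
    have hl' := (Finset.mem_Icc.mp hl).1
    have h0 : (0 : ℝ) ≤ psum h (i - 1) := by positivity
    exact mul_ne_zero (mul_ne_zero (pow_ne_zero _ (by norm_num)) (qpow_ne_zero q _))
      (sigma_ne_zero q (by omega) (by linarith))
  have hα1 := hα (p + 1) (by simp)
  have hα2 : ∏ l ∈ Finset.Icc 1 p, alpha q γ i r h k (p + m + 1) l ≠ 0 :=
    Finset.prod_ne_zero_iff.mpr fun l hl => hα l (Finset.Icc_subset_Icc_right p.le_succ hl)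
  have hβ : ∏ l ∈ Finset.Icc (m + 1) (p + m + 1), beta q γ i r h k (p + m + 1) l =
      beta q γ i r h k (p + m + 1) (m + 1) *
        ∏ l ∈ Finset.Icc (m + 2) (p + m + 1), beta q γ i r h k (p + m + 1) l := by
    rw [← Finset.insert_Icc_succ_left_eq_Icc (by omega), Finset.prod_insert (by simp)]
    rfl
  have ea : sigma q (p + 1) (psum h (i - 1) + gsum γ 1 i) * ((-1) ^ (psum k (r - 1) + m) *
      qpow q ((m + (psum k (r - 1) + gsum γ (i + 1) (i + r))) / 2)) =
      alpha q γ i r h k (p + m + 1) (p + 1) := by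
    rw [alpha, h1, show 1 / 2 * (gsum γ (i + 1) (i + r) + (((p + m + 1 : ℕ) : ℝ) - (p + 1 : ℕ)) +
      psum k (r - 1)) = (m + (psum k (r - 1) + gsum γ (i + 1) (i + r))) / 2 by push_cast; ring]
    ring
  have eb : qpow q (-((p + (psum h (i - 1) + gsum γ 1 i)) / 2)) *
      sigma q (m + 1) (psum k (r - 1) + gsum γ (i + 1) (i + r)) =
      beta q γ i r h k (p + m + 1) (m + 1) := by
    rw [beta, show -(1 / 2) * (gsum γ 1 i + (((p + m + 1 : ℕ) : ℝ) - (m + 1 : ℕ)) +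
      psum h (i - 1)) = -((p + (psum h (i - 1) + gsum γ 1 i)) / 2) by push_cast; ring]
  rw [ea, eb, epsilon, epsilon, h1, h2, hβ, Finset.prod_Icc_succ_top (Nat.le_add_left 1 p),
    pow_succ]
  field_simp
  ring

lemma epsilon_zero (i r : ℕ) (h k : ℕ → ℕ) (s : ℕ) : epsilon q γ i r h k s 0 = 1 := by
  simp [epsilon]

lemma epsilon_congr {i r : ℕ} {h h' k k' : ℕ → ℕ} (hh : psum h (i - 1) = psum h' (i - 1))
    (hk : psum k (r - 1) = psum k' (r - 1)) (s p : ℕ) :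
    epsilon q γ i r h k s p = epsilon q γ i r h' k' s p := by
  simp only [epsilon, alpha, beta, hh, hk]

lemma coupled_eq_couple (i r : ℕ) (h k : ℕ → ℕ) (s : ℕ) : coupled q γ i r h k s =
    couple (M := H i) (N := H r) (L := H (i + r)) (intervalRep q γ 1 (i + r) (i + r))
      (TensorPower.mulEquiv (R := ℂ) (M := W)) (psi q γ i h) (phi q γ i r k)
      (epsilon q γ i r h k s) s := rfl

lemma psi_isChain_of_pos {n : ℕ} (hn : 1 ≤ n) (hγ : ∀ k ∈ Finset.Icc 1 n, 1 / 2 < γ k)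
    (h : ℕ → ℕ) : IsChain (M := H n) (intervalRep q γ 1 n n) (psum h (n - 1)) (gsum γ 1 n)
      (psi q γ n h) ∧ psi q γ n h 0 ≠ 0 := by
  obtain ⟨n, rfl⟩ := Nat.exists_eq_add_of_le' hn
  exact psi_isChain n hγ h

lemma casimirOp_psi_of_pos {m n : ℕ} (hm : 1 ≤ m) (hmn : m ≤ n)
    (hγ : ∀ k ∈ Finset.Icc 1 n, 1 / 2 < γ k) (h : ℕ → ℕ) (p : ℕ) :
    casimirOp q γ n 1 m (psi q γ n h p) =
      casimirEigenvalue q (psum h (m - 1)) (gsum γ 1 m) • psi q γ n h p := by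
  obtain ⟨n, rfl⟩ := Nat.exists_eq_add_of_le' (hm.trans hmn)
  obtain ⟨m, rfl⟩ := Nat.exists_eq_add_of_le' hm
  exact casimirOp_psi n (by omega) hγ h p

lemma half_lt_shift {i r : ℕ} (hγ : ∀ k ∈ Finset.Icc 1 (i + r), 1 / 2 < γ k) :
    ∀ k ∈ Finset.Icc 1 r, 1 / 2 < γ (i + k) := fun k hk =>
  hγ _ (by rw [Finset.mem_Icc] at hk ⊢; omega)

lemma half_lt_left {i r : ℕ} (hγ : ∀ k ∈ Finset.Icc 1 (i + r), 1 / 2 < γ k) :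
    ∀ k ∈ Finset.Icc 1 i, 1 / 2 < γ k := fun k hk =>
  hγ _ (by rw [Finset.mem_Icc] at hk ⊢; omega)

section Blocks

variable {i r : ℕ}

lemma coupled_isChain (hi : 1 ≤ i) (hr : 1 ≤ r) 
    (hγ : ∀ k ∈ Finset.Icc 1 (i + r), 1 / 2 < γ k) (h k : ℕ → ℕ) (s : ℕ) :
    IsChain (M := H (i + r)) (intervalRep q γ 1 (i + r) (i + r))
      (psum h (i - 1) + psum k (r - 1) + s) (gsum γ 1 (i + r)) (coupled q γ i r h k s) ∧
    coupled q γ i r h k s 0 ≠ 0 := by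
  obtain ⟨h1, h2⟩ := psi_isChain_of_pos (q := q) hi (half_lt_left hγ) h
  obtain ⟨h3, h4⟩ := psi_isChain_of_pos (q := q) hr (half_lt_shift hγ) k
  have hG := half_lt_gsum_of_pos hi (half_lt_left hγ)
  have hG' := half_lt_gsum_of_pos hr (half_lt_shift hγ)
  rw [coupled_eq_couple, ← gsum_add]
  exact ⟨couple_isChain (tens_isCoupling_full q γ i r) h1 h3 (epsilon_isLowestCoeff h k hG s),
    couple_zero_ne_zero (M := H i) (N := H r) (L := H (i + r)) (h1.linearIndependent hG h2)
      (h3.linearIndependent hG' h4) (by rw [epsilon_zero]; exact one_ne_zero)⟩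

lemma span_psi_of_pos {n : ℕ} {δ : ℕ → ℝ} (hn : 1 ≤ n) (hδ : ∀ k ∈ Finset.Icc 1 n, 1 / 2 < δ k) :
    Submodule.span ℂ (Set.range fun x : (ℕ → ℕ) × ℕ => psi q δ n x.1 x.2) = ⊤ := by
  obtain ⟨n, rfl⟩ := Nat.exists_eq_add_of_le' hn
  exact span_psi n hδ

lemma eq_top_of_coupled_mem (hi : 1 ≤ i) (hr : 1 ≤ r) 
    (hγ : ∀ k ∈ Finset.Icc 1 (i + r), 1 / 2 < γ k) {S : Submodule ℂ (H (i + r))}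
    (hS : ∀ h k s t, coupled q γ i r h k s t ∈ S) : S = ⊤ := by
  refine eq_top_of_coupling_mem (M := H i) (N := H r) (L := H (i + r))
    (TensorPower.mulEquiv (R := ℂ) (M := W)) (span_psi_of_pos (q := q) hi (half_lt_left hγ))
    (span_psi_of_pos (q := q) hr (half_lt_shift hγ)) ?_
  rintro _ ⟨⟨h, p⟩, rfl⟩ _ ⟨⟨k, p'⟩, rfl⟩
  obtain ⟨h1, h2⟩ := psi_isChain_of_pos (q := q) hi (half_lt_left hγ) h
  obtain ⟨h3, h4⟩ := psi_isChain_of_pos (q := q) hr (half_lt_shift hγ) k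
  have hG := half_lt_gsum_of_pos hi (half_lt_left hγ)
  have hG' := half_lt_gsum_of_pos hr (half_lt_shift hγ)
  have hmem := mem_span_couple (tens_isCoupling_full q γ i r) h1 h3 hG hG' h2 h4
    (epsilon_isLowestCoeff h k hG) (fun s => by rw [epsilon_zero]; exact one_ne_zero) p p'
  refine Submodule.span_le.mpr ?_ hmem
  rintro _ ⟨⟨s, t⟩, rfl⟩
  exact hS h k s t

lemma casimirOp_coupled_left (hγ : ∀ k ∈ Finset.Icc 1 (i + r), 1 / 2 < γ k) {m : ℕ}
    (hm : 1 ≤ m) (hmi : m ≤ i) (h k : ℕ → ℕ) (s t : ℕ) :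
    casimirOp q γ (i + r) 1 m (coupled q γ i r h k s t) =
      casimirEigenvalue q (psum h (m - 1)) (gsum γ 1 m) • coupled q γ i r h k s t := by
  refine (centralizes_casimirOp_one (by omega)).apply_raise_pow ?_ t
  rw [map_sum, Finset.smul_sum]
  refine Finset.sum_congr rfl fun p _ => ?_
  have h1 : casimirOp q γ (i + r) 1 m (tens (psi q γ i h p) (phi q γ i r k (s - p))) =
      tens (casimirOp q γ i 1 m (psi q γ i h p)) (phi q γ i r k (s - p)) :=
    intervalRep_tens_left q γ hmi r _ _ _
  rw [map_smul, h1, casimirOp_psi_of_pos hm hmi (half_lt_left hγ), tens_smul_left, smul_comm]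

lemma centralizes_casimirOp_right {m : ℕ} (hmr : m ≤ r) :
    Centralizes (M := H (i + r)) (casimirOp q γ (i + r) (i + 1) (i + m))
      (intervalRep q γ 1 (i + r) (i + r)) :=
  (centralizes_casimirOp_one (γ := fun l => γ (i + l)) hmr).coupling_right
    (tens_isCoupling_full q γ i r) fun u v => intervalRep_tens_right q γ m i le_rfl r _ u v

lemma casimirOp_coupled_right (hγ : ∀ k ∈ Finset.Icc 1 (i + r), 1 / 2 < γ k) {m : ℕ}
    (hm : 1 ≤ m) (hmr : m ≤ r) (h k : ℕ → ℕ) (s t : ℕ) :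
    casimirOp q γ (i + r) (i + 1) (i + m) (coupled q γ i r h k s t) =
      casimirEigenvalue q (psum k (m - 1)) (gsum γ (i + 1) (i + m)) •
        coupled q γ i r h k s t := by
  refine (centralizes_casimirOp_right hmr).apply_raise_pow ?_ t
  rw [map_sum, Finset.smul_sum]
  refine Finset.sum_congr rfl fun p _ => ?_
  have h1 : casimirOp q γ (i + r) (i + 1) (i + m) (tens (psi q γ i h p) (phi q γ i r k (s - p))) =
      tens (psi q γ i h p) (casimirOp q (fun l => γ (i + l)) r 1 m (phi q γ i r k (s - p))) :=
    intervalRep_tens_right q γ m i le_rfl r _ _ _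
  rw [map_smul, h1, phi, casimirOp_psi_of_pos hm hmr (half_lt_shift hγ), tens_smul_right,
    smul_comm, gsum_shift]

end Blocks

section Theta

variable {i r : ℕ}

lemma Theta_succ (hi : 1 ≤ i) (d : ℕ) (j : ℕ → ℕ) (t : ℕ) : Theta q γ i r (d + 1) j t =
    extend q γ (Theta q γ i r d j) (psum j (i + r + d - 1)) (gsum γ 1 (i + r + d))
      (j (i + r + d)) t := by
  obtain ⟨n, hn⟩ : ∃ n, i + r + d = n + 1 := ⟨i + r + d - 1, by omega⟩
  have h : ∀ k, coef q γ j (i + r + d + 1) k = extCoef q (psum j (i + r + d - 1))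
      (gsum γ 1 (i + r + d)) (γ (i + r + d + 1)) (j (i + r + d)) k := fun k => by
    rw [hn]
    exact coef_eq_extCoef q γ j n k
  simp only [Theta, extend, h]

lemma Theta_congr (hi : 1 ≤ i) (hr : 1 ≤ r) {d : ℕ} {j j' : ℕ → ℕ}
    (hj : ∀ k ∈ Finset.Icc 1 (i + r + d - 1), j k = j' k) :
    Theta q γ i r d j = Theta q γ i r d j' := by
  induction d with
  | zero =>
    obtain ⟨i, rfl⟩ := Nat.exists_eq_add_of_le' hi
    obtain ⟨r, rfl⟩ := Nat.exists_eq_add_of_le' hr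
    have h1 : ∀ k ∈ Finset.Icc 1 i, j k = j' k := fun k hk =>
      hj k (by rw [Finset.mem_Icc] at hk ⊢; omega)
    have h2 : ∀ k ∈ Finset.Icc 1 r, j (i + k) = j' (i + k) := fun k hk =>
      hj _ (by rw [Finset.mem_Icc] at hk ⊢; omega)
    have h3 : j (i + 1 + (r + 1) - 1) = j' (i + 1 + (r + 1) - 1) :=
      hj _ (by rw [Finset.mem_Icc]; omega)
    funext N
    simp only [Theta, coupled, phi, Nat.add_sub_cancel, psi_congr i h1, psi_congr r h2, h3]
    simp only [epsilon_congr (q := q) (γ := γ) (i := i + 1) (r := r + 1) (psum_congr h1)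
      (psum_congr h2)]
  | succ d ih =>
    have h1 : ∀ k ∈ Finset.Icc 1 (i + r + d - 1), j k = j' k := fun k hk =>
      hj k (by rw [Finset.mem_Icc] at hk ⊢; omega)
    funext N
    rw [Theta_succ hi, Theta_succ hi, ih h1, psum_congr h1,
      hj (i + r + d) (by rw [Finset.mem_Icc]; omega)]

/-- Splitting the entries of `j` among the two blocks and the coupling between them. -/
lemma psum_blocks (hi : 1 ≤ i) (j : ℕ → ℕ) {m : ℕ} (hm : 1 ≤ m) :
    psum j (i - 1) + psum (fun l => j (i - 1 + l)) (m - 1) = psum j (i + m - 2) := by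
  rw [psum_add]
  congr 1
  omega

lemma psum_pred (j : ℕ → ℕ) {n : ℕ} (hn : 1 ≤ n) : psum j (n - 1) + j n = psum j n := by
  obtain ⟨n, rfl⟩ := Nat.exists_eq_add_of_le' hn
  exact (psum_succ j n).symm

lemma Theta_isChain (hi : 1 ≤ i) (hr : 1 ≤ r) (d : ℕ)
    (hγ : ∀ k ∈ Finset.Icc 1 (i + r + d), 1 / 2 < γ k) (j : ℕ → ℕ) :
    IsChain (M := H (i + r + d)) (intervalRep q γ 1 (i + r + d) (i + r + d))
      (psum j (i + r + d - 1)) (gsum γ 1 (i + r + d)) (Theta q γ i r d j) ∧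
    Theta q γ i r d j 0 ≠ 0 := by
  induction d with
  | zero =>
    have h := coupled_isChain (q := q) hi hr hγ j (fun l => j (i - 1 + l)) (j (i + r - 1))
    have e : psum j (i - 1) + psum (fun l => j (i - 1 + l)) (r - 1) + j (i + r - 1) =
        psum j (i + r - 1) := by
      rw [psum_blocks hi j hr, ← psum_pred j (n := i + r - 1) (by omega)]
      rfl
    rw [e] at h
    exact h
  | succ d ih =>
    have hγ' : ∀ k ∈ Finset.Icc 1 (i + r + d), 1 / 2 < γ k := fun k hk =>
      hγ k (Finset.Icc_subset_Icc_right (Nat.le_succ _) hk)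
    obtain ⟨h1, h2⟩ := ih hγ'
    have hG := half_lt_gsum_of_pos (n := i + r + d) (by omega) hγ'
    have hg := hγ (i + r + d + 1) (Finset.mem_Icc.mpr ⟨by omega, le_rfl⟩)
    rw [funext (Theta_succ hi d j)]
    have h3 := extend_isChain hG hg h1 (j (i + r + d))
    rw [psum_pred j (by omega), ← gsum_succ] at h3
    exact ⟨h3, extend_zero_ne_zero hG hg h1 h2 _⟩

lemma span_Theta (hi : 1 ≤ i) (hr : 1 ≤ r) (d : ℕ)
    (hγ : ∀ k ∈ Finset.Icc 1 (i + r + d), 1 / 2 < γ k) :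
    Submodule.span ℂ (Set.range fun x : (ℕ → ℕ) × ℕ => Theta q γ i r d x.1 x.2) = ⊤ := by
  induction d with
  | zero =>
    refine eq_top_of_coupled_mem (q := q) hi hr hγ fun h k s t => ?_
    let j : ℕ → ℕ := fun l =>
      if l ≤ i - 1 then h l else if l ≤ i + r - 2 then k (l - (i - 1)) else s
    refine Submodule.subset_span ⟨(j, t), ?_⟩
    obtain ⟨i, rfl⟩ := Nat.exists_eq_add_of_le' hi
    obtain ⟨r, rfl⟩ := Nat.exists_eq_add_of_le' hr
    have h1 : ∀ l ∈ Finset.Icc 1 i, j l = h l := fun l hl => if_pos (Finset.mem_Icc.mp hl).2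
    have h2 : ∀ l ∈ Finset.Icc 1 r, j (i + l) = k l := fun l hl => by
      rw [Finset.mem_Icc] at hl
      simp only [j]
      rw [if_neg (by omega), if_pos (by omega)]
      congr 1
      omega
    have h3 : j (i + 1 + (r + 1) - 1) = s := by
      simp only [j]
      rw [if_neg (by omega), if_neg (by omega)]
    simp only [Theta, coupled, phi, Nat.add_sub_cancel, psi_congr i h1, psi_congr r h2, h3]
    simp only [epsilon_congr (q := q) (γ := γ) (i := i + 1) (r := r + 1) (psum_congr h1)
      (psum_congr h2)]
  | succ d ih =>
    have hγ' : ∀ k ∈ Finset.Icc 1 (i + r + d), 1 / 2 < γ k := fun k hk =>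
      hγ k (Finset.Icc_subset_Icc_right (Nat.le_succ _) hk)
    refine eq_top_of_extend_mem (n := i + r + d) (half_lt_gsum_of_pos (by omega) hγ')
      (hγ (i + r + d + 1) (Finset.mem_Icc.mpr ⟨by omega, le_rfl⟩))
      (fun j => (Theta_isChain hi hr d hγ' j).1) (fun j => (Theta_isChain hi hr d hγ' j).2)
      (ih hγ') fun j s t => ?_
    have h1 : ∀ k ∈ Finset.Icc 1 (i + r + d - 1), j k = Function.update j (i + r + d) s k := by
      intro k hk
      rw [Finset.mem_Icc] at hk
      rw [Function.update_of_ne]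
      omega
    refine Submodule.subset_span ⟨(Function.update j (i + r + d) s, t), ?_⟩
    simp only
    rw [Theta_succ hi, Theta_congr hi hr h1, psum_congr h1, Function.update_self]

/-- An eigenvalue equation for a Casimir operator of factors among the first `i + r + d₀` persists
when further factors are coupled. -/
lemma casimirOp_Theta_of_le (hi : 1 ≤ i) {d₀ d a b : ℕ} (hd : d₀ ≤ d) (hb : b ≤ i + r + d₀)
    (hX : Centralizes (M := H (i + r + d₀)) (casimirOp q γ (i + r + d₀) a b)
      (intervalRep q γ 1 (i + r + d₀) (i + r + d₀))) {j : ℕ → ℕ} {μ : ℂ}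
    (hμ : ∀ N, casimirOp q γ (i + r + d₀) a b (Theta q γ i r d₀ j N) = μ • Theta q γ i r d₀ j N)
    (N : ℕ) : casimirOp q γ (i + r + d) a b (Theta q γ i r d j N) = μ • Theta q γ i r d j N := by
  have key : Centralizes (M := H (i + r + d)) (casimirOp q γ (i + r + d) a b)
      (intervalRep q γ 1 (i + r + d) (i + r + d)) ∧
      ∀ N, casimirOp q γ (i + r + d) a b (Theta q γ i r d j N) = μ • Theta q γ i r d j N := by
    induction d, hd using Nat.le_induction with
    | base => exact ⟨hX, hμ⟩
    | succ d hd ih =>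
      refine ⟨centralizes_casimirOp_snoc (n := i + r + d) (by omega) ih.1, fun N => ?_⟩
      rw [Theta_succ hi]
      exact casimirOp_extend (n := i + r + d) (by omega) ih.1 ih.2 _ _ _ _
  exact key.2 N

lemma casimirOp_Theta_left (hi : 1 ≤ i) {d m : ℕ} (hγ : ∀ k ∈ Finset.Icc 1 (i + r + d), 1 / 2 < γ k)
    (hm : 1 ≤ m) (hmi : m ≤ i) (j : ℕ → ℕ) (N : ℕ) :
    casimirOp q γ (i + r + d) 1 m (Theta q γ i r d j N) =
      casimirEigenvalue q (psum j (m - 1)) (gsum γ 1 m) • Theta q γ i r d j N :=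
  casimirOp_Theta_of_le hi d.zero_le (show m ≤ i + r by omega)
    (centralizes_casimirOp_one (by omega))
    (fun N => casimirOp_coupled_left (half_lt_left hγ) hm hmi _ _ _ N) N

lemma casimirOp_Theta_right (hi : 1 ≤ i) {d m : ℕ}
    (hγ : ∀ k ∈ Finset.Icc 1 (i + r + d), 1 / 2 < γ k) (hm : 1 ≤ m) (hmr : m ≤ r) (j : ℕ → ℕ)
    (N : ℕ) : casimirOp q γ (i + r + d) (i + 1) (i + m) (Theta q γ i r d j N) =
      casimirEigenvalue q (psum j (i + m - 2) - psum j (i - 1)) (gsum γ (i + 1) (i + m)) •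
        Theta q γ i r d j N := by
  rw [← psum_blocks hi j hm, Nat.add_sub_cancel_left]
  exact casimirOp_Theta_of_le hi d.zero_le (show i + m ≤ i + r by omega)
    (centralizes_casimirOp_right hmr)
    (fun N => casimirOp_coupled_right (half_lt_left hγ) hm hmr _ _ _ N) N

lemma casimirOp_Theta_full (hi : 1 ≤ i) (hr : 1 ≤ r) {d m : ℕ}
    (hγ : ∀ k ∈ Finset.Icc 1 (i + r + d), 1 / 2 < γ k) (hm : i + r ≤ m) (hmd : m ≤ i + r + d)
    (j : ℕ → ℕ) (N : ℕ) : casimirOp q γ (i + r + d) 1 m (Theta q γ i r d j N) =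
      casimirEigenvalue q (psum j (m - 1)) (gsum γ 1 m) • Theta q γ i r d j N := by
  obtain ⟨d₀, rfl⟩ := Nat.exists_eq_add_of_le hm
  refine casimirOp_Theta_of_le hi (d₀ := d₀) (by omega) le_rfl (centralizes_casimirOp_one le_rfl)
    (fun N => ?_) N
  have hγ' := fun k hk => hγ k (Finset.Icc_subset_Icc_right hmd hk)
  exact (Theta_isChain hi hr d₀ hγ' j).1.casimir N

lemma weightOp_Theta (hi : 1 ≤ i) (hr : 1 ≤ r) {d : ℕ}
    (hγ : ∀ k ∈ Finset.Icc 1 (i + r + d), 1 / 2 < γ k) (j : ℕ → ℕ) (N : ℕ) :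
    weightOp q γ (i + r + d) (Theta q γ i r d j N) =
      qpow q (1 / 2 * ((N : ℝ) + psum j (i + r + d - 1) + gsum γ 1 (i + r + d))) •
        Theta q γ i r d j N := by
  rw [weightOp, (Theta_isChain hi hr d hγ j).1.weight]
  congr 2
  ring

end Theta

end Coupled

/-! ### The inner product -/

section Form

variable {ι : Type*}

/-- The standard Hermitian form on finitely supported functions. -/
def finForm (u v : ι →₀ ℂ) : ℂ := u.sum fun k c => starRingEnd ℂ c * v k

lemma finForm_add_left (u u' v : ι →₀ ℂ) : finForm (u + u') v = finForm u v + finForm u' v :=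
  Finsupp.sum_add_index' (by simp) (by intros; rw [map_add, add_mul])

lemma finForm_smul_left (c : ℂ) (u v : ι →₀ ℂ) :
    finForm (c • u) v = starRingEnd ℂ c * finForm u v := by
  rw [finForm, Finsupp.sum_smul_index (by simp), finForm, Finsupp.mul_sum]
  simp only [map_mul, mul_assoc]

lemma finForm_add_right (u v v' : ι →₀ ℂ) : finForm u (v + v') = finForm u v + finForm u v' := by
  simp only [finForm, Finsupp.add_apply, mul_add, Finsupp.sum_add]

lemma finForm_smul_right (c : ℂ) (u v : ι →₀ ℂ) : finForm u (c • v) = c * finForm u v := by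
  simp only [finForm, Finsupp.smul_apply, smul_eq_mul, Finsupp.mul_sum, mul_left_comm]

lemma finForm_single (k l : ι) [Decidable (k = l)] :
    finForm (Finsupp.single k 1) (Finsupp.single l 1) = if k = l then 1 else 0 := by
  classical
  rw [finForm, Finsupp.sum_single_index (by simp), Finsupp.single_apply]
  simp [eq_comm]

lemma finForm_self (u : ι →₀ ℂ) : finForm u u = ((u.sum fun _ c => ‖c‖ ^ 2 : ℝ) : ℂ) := by
  rw [finForm, Finsupp.sum, Finsupp.sum, Complex.ofReal_sum]
  refine Finset.sum_congr rfl fun k _ => ?_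
  rw [← Complex.normSq_eq_conj_mul_self, Complex.normSq_eq_norm_sq]

variable {n : ℕ}

lemma braket_eq_finForm (u v : H n) :
    braket u v = finForm ((tensorBasis n).repr u) ((tensorBasis n).repr v) := rfl

lemma braket_add_left (u u' v : H n) : braket (u + u') v = braket u v + braket u' v := by
  simp only [braket_eq_finForm, map_add, finForm_add_left]

lemma braket_smul_left (c : ℂ) (u v : H n) : braket (c • u) v = starRingEnd ℂ c * braket u v := by
  simp only [braket_eq_finForm, map_smul, finForm_smul_left]

lemma braket_add_right (u v v' : H n) : braket u (v + v') = braket u v + braket u v' := by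
  simp only [braket_eq_finForm, map_add, finForm_add_right]

lemma braket_smul_right (c : ℂ) (u v : H n) : braket u (c • v) = c * braket u v := by
  simp only [braket_eq_finForm, map_smul, finForm_smul_right]

lemma braket_self_eq_re (v : H n) : braket v v = ((braket v v).re : ℂ) := by
  rw [braket_eq_finForm, finForm_self, Complex.ofReal_re]

lemma braket_self_re_pos {v : H n} (hv : v ≠ 0) : 0 < (braket v v).re := by
  rw [braket_eq_finForm, finForm_self, Complex.ofReal_re]
  have h : (tensorBasis n).repr v ≠ 0 := by simpa using hv
  refine Finset.sum_pos (fun k hk => ?_) (Finsupp.support_nonempty_iff.mpr h)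
  have := norm_pos_iff.mpr (Finsupp.mem_support_iff.mp hk)
  positivity

lemma tensorBasis_induction {p : H n → Prop} (hb : ∀ ν, p (tensorBasis n ν))
    (hadd : ∀ u v, p u → p v → p (u + v)) (hsmul : ∀ (c : ℂ) u, p u → p (c • u)) (u : H n) :
    p u := by
  have hu : u ∈ Submodule.span ℂ (Set.range (tensorBasis n)) :=
    (tensorBasis n).span_eq ▸ Submodule.mem_top
  induction hu using Submodule.span_induction with
  | mem u hu => obtain ⟨ν, rfl⟩ := hu; exact hb ν
  | zero => simpa using hsmul 0 0 (by simpa using hsmul 0 _ (hb fun _ => 0))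
  | add u v _ _ hu hv => exact hadd u v hu hv
  | smul c u _ hu => exact hsmul c u hu

lemma W_induction {p : W → Prop} (hb : ∀ m, p (basisKet m))
    (hadd : ∀ u v, p u → p v → p (u + v)) (hsmul : ∀ (c : ℂ) u, p u → p (c • u)) (w : W) : p w := by
  induction w using Finsupp.induction_linear with
  | zero => simpa using hsmul 0 _ (hb 0)
  | add u v hu hv => exact hadd u v hu hv
  | single m c => simpa [basisKet] using hsmul c _ (hb m)

lemma snoc_tensorBasis (ν : Fin n → ℕ) (m : ℕ) :
    snoc (tensorBasis n ν) (basisKet m) = tensorBasis (n + 1) (Fin.snoc ν m : Fin (n + 1) → ℕ) := by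
  rw [tensorBasis_apply, tensorBasis_apply, snoc_tprod]
  congr 1
  funext k
  refine Fin.lastCases ?_ (fun k => ?_) k <;> simp

lemma braket_tensorBasis (ν μ : Fin n → ℕ) :
    braket (tensorBasis n ν) (tensorBasis n μ) = if ν = μ then 1 else 0 := by
  rw [braket_eq_finForm, Module.Basis.repr_self, Module.Basis.repr_self, finForm_single]

lemma braket_snoc (u u' : H n) (w w' : W) :
    braket (snoc u w) (snoc u' w') = braket u u' * finForm w w' := by
  induction u using tensorBasis_induction with
  | hadd u v hu hv => rw [snoc_add_left, braket_add_left, hu, hv, braket_add_left, add_mul]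
  | hsmul c u hu => rw [snoc_smul_left, braket_smul_left, hu, braket_smul_left, mul_assoc]
  | hb ν =>
  induction u' using tensorBasis_induction with
  | hadd u v hu hv => rw [snoc_add_left, braket_add_right, hu, hv, braket_add_right, add_mul]
  | hsmul c u hu => rw [snoc_smul_left, braket_smul_right, hu, braket_smul_right, mul_assoc]
  | hb μ =>
  induction w using W_induction with
  | hadd u v hu hv => rw [snoc_add_right, braket_add_left, hu, hv, finForm_add_left, mul_add]
  | hsmul c u hu => rw [snoc_smul_right, braket_smul_left, hu, finForm_smul_left, mul_left_comm]
  | hb m =>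
  induction w' using W_induction with
  | hadd u v hu hv => rw [snoc_add_right, braket_add_right, hu, hv, finForm_add_right, mul_add]
  | hsmul c u hu => rw [snoc_smul_right, braket_smul_right, hu, finForm_smul_right, mul_left_comm]
  | hb m' =>
    rw [snoc_tensorBasis, snoc_tensorBasis, braket_tensorBasis, braket_tensorBasis, basisKet,
      basisKet, finForm_single]
    by_cases h : ν = μ <;> by_cases h' : m = m' <;> simp [h, h', Fin.snoc_inj]

end Form

/-! ### Adjoints for positive `q` -/

section Adjoint

variable {q : QParam} {n : ℕ}

/-- `Y` is adjoint to `X` for the inner product. -/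
def IsAdjointOp (X Y : Module.End ℂ (H n)) : Prop := ∀ u v, braket (X u) v = braket u (Y v)

/-- The images of the generators under the involution that exchanges `A₊` and `A₋`. -/
def Gen.star : Gen → Gen
  | .Ap => .Am
  | .Am => .Ap
  | .K => .K
  | .Kinv => .Kinv
  | .P => .P

variable {x : ℝ}

lemma qpow_eq_ofReal (hx : 0 < x) (hq : q.val = x) (y : ℝ) : qpow q y = ((x ^ y : ℝ) : ℂ) := by
  rw [qpow, hq, Complex.ofReal_cpow hx.le]

lemma conj_qpow (hx : 0 < x) (hq : q.val = x) (y : ℝ) : starRingEnd ℂ (qpow q y) = qpow q y := by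
  rw [qpow_eq_ofReal hx hq, Complex.conj_ofReal]

/-- For positive `q` the numbers `σ_m` are nonnegative, since `[y]_q` is odd and increasing in
`y`. -/
lemma sigma_eq_ofReal (hx : 0 < x) (hq : q.val = x) {g : ℝ} (hg : 1 / 2 < g) (m : ℕ) :
    ∃ s : ℝ, 0 ≤ s ∧ sigma q m g = s := by
  have hx1 : x ≠ 1 := by
    rintro rfl
    exact q.norm_ne_one (by rw [hq]; simp)
  let f : ℝ → ℝ := fun y => (x ^ y - x ^ (-y)) / (x - x⁻¹)
  have hf : ∀ y, qnum q y = f y := fun y => by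
    simp only [qnum, f, qpow_eq_ofReal hx hq, hq]
    push_cast
    rfl
  have hmono : Monotone f := by
    intro y z hyz
    rcases lt_or_gt_of_ne hx1 with h | h
    · have hd : x - x⁻¹ < 0 := by
        have := one_lt_inv_iff₀.mpr ⟨hx, h⟩
        linarith
      refine div_le_div_of_nonpos_of_le hd.le (sub_le_sub ?_ ?_)
      · exact Real.rpow_le_rpow_of_exponent_ge hx h.le hyz
      · exact Real.rpow_le_rpow_of_exponent_ge hx h.le (neg_le_neg hyz)
    · have hd : 0 < x - x⁻¹ := by
        have := inv_lt_one_of_one_lt₀ h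
        linarith
      refine div_le_div_of_nonneg_right (sub_le_sub ?_ ?_) hd.le
      · exact Real.rpow_le_rpow_of_exponent_le h.le hyz
      · exact Real.rpow_le_rpow_of_exponent_le h.le (neg_le_neg hyz)
  have h0 : f 0 = 0 := by simp [f]
  have h1 : 0 ≤ f (g - 1 / 2) := by rw [← h0]; exact hmono (by linarith)
  have hm : (0 : ℝ) ≤ m := by positivity
  have h2 : f (g - 1 / 2) ≤ f (m + g - 1 / 2) := hmono (by linarith)
  refine ⟨f (m + g - 1 / 2) - (-1) ^ m * f (g - 1 / 2), ?_, ?_⟩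
  · rcases neg_one_pow_eq_or ℝ m with e | e <;> rw [e] <;> linarith
  · rw [sigma, hf, hf]
    push_cast
    rfl

lemma conj_sqrtSigma (hx : 0 < x) (hq : q.val = x) {g : ℝ} (hg : 1 / 2 < g) (m : ℕ) :
    starRingEnd ℂ (sqrtSigma q m g) = sqrtSigma q m g := by
  obtain ⟨s, hs, h⟩ := sigma_eq_ofReal hx hq hg m
  have : (s : ℂ) ^ (1 / 2 : ℂ) = ((s ^ (1 / 2 : ℝ) : ℝ) : ℂ) := by
    rw [Complex.ofReal_cpow hs]
    push_cast
    rfl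
  rw [sqrtSigma, h, this, Complex.conj_ofReal]

lemma finForm_rep (hx : 0 < x) (hq : q.val = x) {g : ℝ} (hg : 1 / 2 < g) (y : Gen) (w w' : W) :
    finForm (rep q g (Osp.gen q y) w) w' = finForm w (rep q g (Osp.gen q y.star) w') := by
  induction w using W_induction with
  | hadd u v hu hv => rw [map_add, finForm_add_left, hu, hv, finForm_add_left]
  | hsmul c u hu => rw [map_smul, finForm_smul_left, hu, finForm_smul_left]
  | hb m =>
  induction w' using W_induction with
  | hadd u v hu hv => rw [map_add, finForm_add_right, hu, hv, finForm_add_right]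
  | hsmul c u hu => rw [map_smul, finForm_smul_right, hu, finForm_smul_right]
  | hb l =>
    cases y
    · simp only [rep_gen, genImage, Gen.star, raising_ket, lowering_ket, finForm_smul_left,
        finForm_smul_right, conj_sqrtSigma hx hq hg]
      simp only [basisKet, finForm_single]
      rcases l with _ | l
      · simp [sqrtSigma_zero]
      · by_cases h : m = l <;> simp [h]
    · simp only [rep_gen, genImage, Gen.star, raising_ket, lowering_ket, finForm_smul_left,
        finForm_smul_right, conj_sqrtSigma hx hq hg]
      simp only [basisKet, finForm_single]
      rcases m with _ | m
      · simp [sqrtSigma_zero]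
      · by_cases h : m = l <;> simp [h]
    · simp only [rep_gen, genImage, Gen.star, weight_ket, finForm_smul_left,
        finForm_smul_right, conj_qpow hx hq]
      simp only [basisKet, finForm_single]
      by_cases h : m = l <;> simp [h]
    · simp only [rep_gen, genImage, Gen.star, weightInv_ket, finForm_smul_left,
        finForm_smul_right, conj_qpow hx hq]
      simp only [basisKet, finForm_single]
      by_cases h : m = l <;> simp [h]
    · simp only [rep_gen, genImage, Gen.star, parity_ket, finForm_smul_left, finForm_smul_right]
      simp only [basisKet, finForm_single]
      by_cases h : m = l <;> simp [h]

/-- For positive `q` the modules are unitary for the involution that exchanges `A₊` and `A₋`, which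
is compatible with the coproduct. -/
lemma intervalRep_adjoint (hx : 0 < x) (hq : q.val = x) {γ : ℕ → ℝ} (a b n : ℕ)
    (hγ : ∀ k ∈ Finset.Icc 1 n, 1 / 2 < γ k)
    (y : Gen) : IsAdjointOp (intervalRep q γ a b n (Osp.gen q y))
      (intervalRep q γ a b n (Osp.gen q y.star)) := by
  induction n generalizing y with
  | zero =>
    intro u v
    rw [intervalRep_zero, intervalRep_zero, braket_smul_left, braket_smul_right, counit_gen,
      counit_gen]
    cases y <;> simp [genImage, Gen.star]
  | succ n ih =>
    have ih' := ih fun k hk => hγ k (Finset.Icc_subset_Icc_right n.le_succ hk)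
    have hw := finForm_rep hx hq (hγ (n + 1) (Finset.mem_Icc.mpr ⟨by omega, le_rfl⟩))
    intro u v
    induction u using snoc_induction with
    | hadd u u' hu hu' => rw [map_add, braket_add_left, hu, hu', braket_add_left]
    | h u w =>
    induction v using snoc_induction with
    | hadd v v' hv hv' => rw [map_add, braket_add_right, hv, hv', braket_add_right]
    | h v w' =>
    by_cases hab : a ≤ n + 1 ∧ n + 1 ≤ b
    · have hc := snoc_isCoupling q γ hab
      have hs : ∀ (u : H n) (w : W), snocEquiv n (u ⊗ₜ[ℂ] w) = snoc u w := fun _ _ => rfl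
      have e1 := hc.Ap
      have e2 := hc.Am
      have e3 := hc.K
      have e4 := hc.Kinv
      have e5 := hc.P
      simp only [hs] at e1 e2 e3 e4 e5
      have hKP : ∀ w : W, rep q (γ (n + 1)) (Osp.gen q .P) (rep q (γ (n + 1)) (Osp.gen q .K) w) =
          rep q (γ (n + 1)) (Osp.gen q .K) (rep q (γ (n + 1)) (Osp.gen q .P) w) := 
        rep_P_K (M := W) _
      have i1 := ih' .Ap
      have i2 := ih' .Am
      have i3 := ih' .K
      have i4 := ih' .Kinv
      have i5 := ih' .P
      have j1 := hw .Ap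
      have j2 := hw .Am
      have j3 := hw .K
      have j4 := hw .Kinv
      have j5 := hw .P
      simp only [IsAdjointOp, Gen.star] at i1 i2 i3 i4 i5 j1 j2 j3 j4 j5
      cases y <;> simp only [Gen.star, e1, e2, e3, e4, e5, braket_add_left, braket_add_right,
        braket_snoc, i1, i2, i3, i4, i5, j1, j2, j3, j4, j5, hKP]
    · rw [intervalRep_of_notMem q γ hab, intervalRep_of_notMem q γ hab, braket_snoc,
        braket_snoc, ih']

lemma casimirOp_selfAdjoint (hx : 0 < x) (hq : q.val = x) {γ : ℕ → ℝ} (n a b : ℕ)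
    (hγ : ∀ k ∈ Finset.Icc 1 n, 1 / 2 < γ k) :
    IsAdjointOp (casimirOp q γ n a b) (casimirOp q γ n a b) := by
  intro u v
  have h := intervalRep_adjoint hx hq a b n hγ
  have i1 := h .Ap
  have i2 := h .Am
  have i3 := h .K
  have i4 := h .Kinv
  have i5 := h .P
  simp only [IsAdjointOp, Gen.star] at i1 i2 i3 i4 i5
  have hd : starRingEnd ℂ (q.val - q.val⁻¹)⁻¹ = (q.val - q.val⁻¹)⁻¹ := by
    rw [hq]
    simp
  have key : ∀ w, casimirOp q γ n a b w = intervalRep q γ a b n (Osp.gen q .P)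
      ((-1 : ℂ) • intervalRep q γ a b n (Osp.gen q .Ap) (intervalRep q γ a b n (Osp.gen q .Am) w) +
      (q.val - q.val⁻¹)⁻¹ • (qpow q (-(1 / 2)) • intervalRep q γ a b n (Osp.gen q .K)
        (intervalRep q γ a b n (Osp.gen q .K) w) + (-1 : ℂ) • qpow q (1 / 2) •
        intervalRep q γ a b n (Osp.gen q .Kinv) (intervalRep q γ a b n (Osp.gen q .Kinv) w))) := by
    exact rep_casimir_parity_left (M := H n) _
  have key' : ∀ w, casimirOp q γ n a b w =
      (-1 : ℂ) • intervalRep q γ a b n (Osp.gen q .Ap) (intervalRep q γ a b n (Osp.gen q .Am)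
        (intervalRep q γ a b n (Osp.gen q .P) w)) +
      (q.val - q.val⁻¹)⁻¹ • (qpow q (-(1 / 2)) • intervalRep q γ a b n (Osp.gen q .K)
        (intervalRep q γ a b n (Osp.gen q .K) (intervalRep q γ a b n (Osp.gen q .P) w)) +
        (-1 : ℂ) • qpow q (1 / 2) • intervalRep q γ a b n (Osp.gen q .Kinv)
          (intervalRep q γ a b n (Osp.gen q .Kinv) (intervalRep q γ a b n (Osp.gen q .P) w))) := by
    exact rep_casimir_parity_right (M := H n) _
  rw [key, key', i5]
  simp only [braket_add_left, braket_add_right, braket_smul_left, braket_smul_right, map_neg,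
    map_one, conj_qpow hx hq, hd, i1, i2, i3, i4]

lemma weightOp_selfAdjoint (hx : 0 < x) (hq : q.val = x) {γ : ℕ → ℝ} (n : ℕ)
    (hγ : ∀ k ∈ Finset.Icc 1 n, 1 / 2 < γ k) :
    IsAdjointOp (weightOp q γ n) (weightOp q γ n) :=
  intervalRep_adjoint hx hq 1 n n hγ .K

/-- Eigenvectors of a self-adjoint operator for different eigenvalues are orthogonal. -/
lemma braket_eq_zero_of_eigenvalue_ne {X : Module.End ℂ (H n)} (hX : IsAdjointOp X X) {u v : H n}
    {μ μ' : ℂ} (hu : X u = μ • u) (hv : X v = μ' • v) (h : μ ≠ μ') : braket u v = 0 := by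
  by_cases hu0 : u = 0
  · have := braket_smul_left 0 u v
    rwa [zero_smul, map_zero, zero_mul, ← hu0] at this
  · have h1 := hX u u
    have hpos := (braket_self_re_pos hu0).ne'
    have h2 : braket u u ≠ 0 := fun h => hpos (by rw [h, Complex.zero_re])
    rw [hu, braket_smul_left, braket_smul_right, mul_left_inj' h2] at h1
    have h3 := hX u v
    rw [hu, hv, braket_smul_left, braket_smul_right, h1] at h3
    have h4 : (μ - μ') * braket u v = 0 := by rw [sub_mul, h3, sub_self]
    exact (mul_eq_zero.mp h4).resolve_left (sub_ne_zero.mpr h)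

end Adjoint

/-! ### Joint eigenspaces -/

/-- If the eigenvalues of the basis vectors depend only on a label, and distinct labels have distinct
systems of eigenvalues, then the joint eigenspace of a label is spanned by its basis vectors. -/
lemma span_image_eq_of_joint_eigenspace {E ι κ K : Type*} [AddCommMonoid E] [Module ℂ E]
    (b : Module.Basis ι ℂ E) (T : κ → Module.End ℂ E) (f : ι → K) (μ : κ → K → ℂ)
    (hT : ∀ a x, T a (b x) = μ a (f x) • b x) (hsep : ∀ k k', (∀ a, μ a k = μ a k') → k = k')
    {S : Submodule ℂ E} {k : K} (hS : ∀ v, v ∈ S ↔ ∀ a, T a v = μ a k • v) :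
    S = Submodule.span ℂ (b '' {x | f x = k}) := by
  apply le_antisymm
  · intro v hv
    refine Submodule.span_mono (Set.image_mono fun x hx => ?_)
      (mem_span_of_joint_eigenvector b T (fun a x => μ a (f x)) hT _ ((hS v).mp hv))
    exact hsep _ _ hx
  · rw [Submodule.span_le]
    rintro _ ⟨x, rfl, rfl⟩
    exact (hS _).mpr fun a => hT a x

variable {q : QParam} {γ : ℕ → ℝ} {i r d : ℕ}

/-- Labels for the operators whose joint eigenspaces are the spaces `Z`. -/
abbrev ZLabel (i r d : ℕ) : Type :=
  ({m // m ∈ Finset.Icc 2 i ∪ Finset.Icc (i + r) (i + r + d)} ⊕ {m // m ∈ Finset.Icc 2 r}) ⊕ Unit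

/-- The Casimir operators of `[1;m]` and of `[i+1;i+m]`, and `K`, by their labels. -/
def zOp (q : QParam) (γ : ℕ → ℝ) (i r d : ℕ) : ZLabel i r d → Module.End ℂ (H (i + r + d))
  | .inl (.inl m) => casimirOp q γ (i + r + d) 1 m
  | .inl (.inr m) => casimirOp q γ (i + r + d) (i + 1) (i + m)
  | .inr _ => weightOp q γ (i + r + d)

/-- The eigenvalue of `zOp` on `Θ(j, N)`. -/
def zEig (q : QParam) (γ : ℕ → ℝ) (i r d : ℕ) (j : ℕ → ℕ) (N : ℕ) : ZLabel i r d → ℂ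
  | .inl (.inl m) => casimirEigenvalue q (psum j (m - 1)) (gsum γ 1 m)
  | .inl (.inr m) =>
    casimirEigenvalue q (psum j (i + m - 2) - psum j (i - 1)) (gsum γ (i + 1) (i + m))
  | .inr _ => qpow q (1 / 2 * ((N : ℝ) + psum j (i + r + d - 1) + gsum γ 1 (i + r + d)))

lemma mem_Z_iff (j : ℕ → ℕ) (N : ℕ) (v : H (i + r + d)) :
    v ∈ Z q γ i r d j N ↔ ∀ a, zOp q γ i r d a v = zEig q γ i r d j N a • v := by
  simp only [Z, Submodule.mem_inf, Submodule.mem_iInf, Module.End.mem_eigenspace_iff, Sum.forall,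
    Subtype.forall, zOp, zEig, forall_const]

lemma zOp_Theta (hi : 1 ≤ i) (hr : 1 ≤ r) (hγ : ∀ k ∈ Finset.Icc 1 (i + r + d), 1 / 2 < γ k)
    (a : ZLabel i r d) (j : ℕ → ℕ) (N : ℕ) :
    zOp q γ i r d a (Theta q γ i r d j N) = zEig q γ i r d j N a • Theta q γ i r d j N := by
  rcases a with (⟨m, hm⟩ | ⟨m, hm⟩) | _
  · rcases Finset.mem_union.mp hm with h | h <;> rw [Finset.mem_Icc] at h
    · exact casimirOp_Theta_left hi hγ (by omega) h.2 j N
    · exact casimirOp_Theta_full hi hr hγ h.1 h.2 j N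
  · rw [Finset.mem_Icc] at hm
    exact casimirOp_Theta_right hi hγ (by omega) hm.2 j N
  · exact weightOp_Theta hi hr hγ j N

lemma psum_mono (j : ℕ → ℕ) {a b : ℕ} (h : a ≤ b) : psum j a ≤ psum j b :=
  Finset.sum_le_sum_of_subset (Finset.Icc_subset_Icc_right h)

lemma half_lt_gsum_mid (hγ : ∀ k ∈ Finset.Icc 1 (i + r + d), 1 / 2 < γ k) {m : ℕ} (hm : 1 ≤ m)
    (hmr : m ≤ r) : 1 / 2 < gsum γ (i + 1) (i + m) := by
  rw [← gsum_shift]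
  exact half_lt_gsum_of_pos hm fun _ hk =>
    hγ _ (by rw [Finset.mem_Icc] at hk ⊢; omega)

lemma half_lt_gsum_left (hγ : ∀ k ∈ Finset.Icc 1 (i + r + d), 1 / 2 < γ k) {m : ℕ} (hm : 1 ≤ m)
    (hmr : m ≤ i + r + d) : 1 / 2 < gsum γ 1 m :=
  half_lt_gsum_of_pos hm fun _ hk => hγ _ (Finset.Icc_subset_Icc_right hmr hk)

lemma eq_of_qpow_weight_eq {N N' : ℕ} {g : ℝ}
    (h : qpow q (1 / 2 * ((N : ℝ) + g)) = qpow q (1 / 2 * ((N' : ℝ) + g))) : N = N' := by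
  have h1 := qpow_injective q h
  have h2 : (N : ℝ) = N' := by linarith
  exact_mod_cast h2

lemma seq_succ {n : ℕ} (j : Fin n → ℕ) (k : Fin n) : seq j (k + 1) = j k := by
  rw [seq, dif_pos ⟨by omega, by omega⟩]
  rfl

lemma seq_restrict {n : ℕ} (j : ℕ → ℕ) : ∀ k ∈ Finset.Icc 1 n,
    seq (fun l : Fin n => j (l + 1)) k = j k := by
  intro k hk
  rw [Finset.mem_Icc] at hk
  rw [seq, dif_pos hk]
  simp only
  congr 1
  omega

/-- A finite sequence is determined by its partial sums. -/
lemma eq_of_psum_seq_eq {n : ℕ} {j j' : Fin n → ℕ}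
    (h : ∀ m ∈ Finset.Icc 1 n, psum (seq j) m = psum (seq j') m) : j = j' := by
  funext k
  have h1 := h (k + 1) (Finset.mem_Icc.mpr ⟨by omega, by omega⟩)
  have h2 : psum (seq j) k = psum (seq j') k := by
    rcases Nat.eq_zero_or_pos k with h0 | h0
    · rw [h0]
      rfl
    · exact h k (Finset.mem_Icc.mpr ⟨h0, by omega⟩)
  rw [psum_succ, psum_succ, h2, seq_succ, seq_succ] at h1
  exact Nat.add_left_cancel h1

/-- The operators `zOp` recover the partial sums of `j`: those up to `i - 1` and from `i + r - 1` on
from the Casimir operators of `[1;m]`, and those between from the intervals `[i+1;i+m]`, whose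
eigenvalues involve the differences with `|j_{i-1}|`. The weight then gives `N`. -/
lemma zEig_injective (hi : 1 ≤ i) (hr : 1 ≤ r)
    (hγ : ∀ k ∈ Finset.Icc 1 (i + r + d), 1 / 2 < γ k)
    (x y : (Fin (i + r + d - 1) → ℕ) × ℕ)
    (h : ∀ a, zEig q γ i r d (seq x.1) x.2 a = zEig q γ i r d (seq y.1) y.2 a) : x = y := by
  obtain ⟨j, N⟩ := x
  obtain ⟨j', N'⟩ := y
  have h1 : ∀ m ∈ Finset.Icc 2 i ∪ Finset.Icc (i + r) (i + r + d),
      psum (seq j) (m - 1) = psum (seq j') (m - 1) := fun m hm => by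
    have hm' := hm
    rw [Finset.mem_union, Finset.mem_Icc, Finset.mem_Icc] at hm'
    exact casimirEigenvalue_injective q (half_lt_gsum_left hγ (m := m) (by omega) (by omega))
      (h (.inl (.inl ⟨m, hm⟩)))
  have h0 : psum (seq j) (i - 1) = psum (seq j') (i - 1) := by
    rcases Nat.eq_or_lt_of_le hi with rfl | h2
    · rfl
    · exact h1 i (Finset.mem_union_left _ (Finset.mem_Icc.mpr ⟨h2, le_rfl⟩))
  have h2 : ∀ m ∈ Finset.Icc 2 r, psum (seq j) (i + m - 2) = psum (seq j') (i + m - 2) :=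
    fun m hm => by
      have hm' := Finset.mem_Icc.mp hm
      have e := casimirEigenvalue_injective q (half_lt_gsum_mid hγ (by omega) hm'.2)
        (h (.inl (.inr ⟨m, hm⟩)))
      have l1 := psum_mono (seq j) (show i - 1 ≤ i + m - 2 by omega)
      have l2 := psum_mono (seq j') (show i - 1 ≤ i + m - 2 by omega)
      simp only at e
      omega
  have hj : j = j' := by
    refine eq_of_psum_seq_eq fun m hm => ?_
    rw [Finset.mem_Icc] at hm
    by_cases hm1 : m + 1 ≤ i ∨ i + r ≤ m + 1
    · refine h1 (m + 1) ?_
      rw [Finset.mem_union, Finset.mem_Icc, Finset.mem_Icc]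
      omega
    · have := h2 (m + 2 - i) (Finset.mem_Icc.mpr ⟨by omega, by omega⟩)
      rwa [show i + (m + 2 - i) - 2 = m by omega] at this
  subst hj
  have hN := h (.inr ())
  simp only [zEig, add_assoc] at hN
  rw [eq_of_qpow_weight_eq hN]

lemma Theta_ne_zero (hi : 1 ≤ i) (hr : 1 ≤ r)
    (hγ : ∀ k ∈ Finset.Icc 1 (i + r + d), 1 / 2 < γ k) (j : ℕ → ℕ) (N : ℕ) :
    Theta q γ i r d j N ≠ 0 :=
  (Theta_isChain hi hr d hγ j).1.ne_zero (half_lt_gsum_left hγ (by omega) le_rfl)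
    (Theta_isChain hi hr d hγ j).2 N

/-- The vectors `Θ(j, N)` form a basis: they are independent because the eigenvalues of the
operators `zOp` tell them apart, and they span by the repeated Clebsch-Gordan decomposition. -/
def thetaBasis (q : QParam) (hi : 1 ≤ i) (hr : 1 ≤ r)
    (hγ : ∀ k ∈ Finset.Icc 1 (i + r + d), 1 / 2 < γ k) :
    Module.Basis ((Fin (i + r + d - 1) → ℕ) × ℕ) ℂ (H (i + r + d)) :=
  Module.Basis.mk (M := H (i + r + d)) (v := fun x => Theta q γ i r d (seq x.1) x.2)
    (linearIndependent_of_separated (E := H (i + r + d)) (zOp q γ i r d)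
      (fun a x => zEig q γ i r d (seq x.1) x.2 a) (fun a x => zOp_Theta hi hr hγ a _ _)
      (zEig_injective hi hr hγ) fun x => Theta_ne_zero hi hr hγ _ _)
    (by
      rw [← span_Theta (q := q) hi hr d hγ, Submodule.span_le]
      rintro _ ⟨⟨j, N⟩, rfl⟩
      refine Submodule.subset_span ⟨(fun l => j (l + 1), N), ?_⟩
      exact congrFun (Theta_congr hi hr (seq_restrict j)) N)

lemma thetaBasis_apply (hi : 1 ≤ i) (hr : 1 ≤ r)
    (hγ : ∀ k ∈ Finset.Icc 1 (i + r + d), 1 / 2 < γ k) (x : (Fin (i + r + d - 1) → ℕ) × ℕ) :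
    thetaBasis q hi hr hγ x = Theta q γ i r d (seq x.1) x.2 := by
  rw [thetaBasis, Module.Basis.mk_apply]

lemma zOp_selfAdjoint {x : ℝ} (hx : 0 < x) (hq : q.val = x)
    (hγ : ∀ k ∈ Finset.Icc 1 (i + r + d), 1 / 2 < γ k) (a : ZLabel i r d) :
    IsAdjointOp (zOp q γ i r d a) (zOp q γ i r d a) := by
  rcases a with (m | m) | _
  · exact casimirOp_selfAdjoint hx hq _ _ _ hγ
  · exact casimirOp_selfAdjoint hx hq _ _ _ hγ
  · exact weightOp_selfAdjoint hx hq _ hγ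

lemma braket_Theta_eq_zero (hi : 1 ≤ i) (hr : 1 ≤ r) {t : ℝ} (ht : 0 < t) (hq : q.val = t)
    (hγ : ∀ k ∈ Finset.Icc 1 (i + r + d), 1 / 2 < γ k) {x y : (Fin (i + r + d - 1) → ℕ) × ℕ}
    (hxy : x ≠ y) :
    braket (Theta q γ i r d (seq x.1) x.2) (Theta q γ i r d (seq y.1) y.2) = 0 := by
  obtain ⟨a, ha⟩ : ∃ a, zEig q γ i r d (seq x.1) x.2 a ≠ zEig q γ i r d (seq y.1) y.2 a := by
    by_contra! h
    exact hxy (zEig_injective hi hr hγ x y h)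
  exact braket_eq_zero_of_eigenvalue_ne (zOp_selfAdjoint ht hq hγ a) (zOp_Theta hi hr hγ a _ _)
    (zOp_Theta hi hr hγ a _ _) ha

lemma Z_eq_span (hi : 1 ≤ i) (hr : 1 ≤ r) (hγ : ∀ k ∈ Finset.Icc 1 (i + r + d), 1 / 2 < γ k)
    (x : (Fin (i + r + d - 1) → ℕ) × ℕ) : Z q γ i r d (seq x.1) x.2 =
      Submodule.span ℂ (thetaBasis q hi hr hγ '' {y | y = x}) :=
  span_image_eq_of_joint_eigenspace (E := H (i + r + d)) (thetaBasis q hi hr hγ) (zOp q γ i r d) id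
    (fun a (x : (Fin (i + r + d - 1) → ℕ) × ℕ) => zEig q γ i r d (seq x.1) x.2 a)
    (fun a x => by rw [thetaBasis_apply]; exact zOp_Theta hi hr hγ a _ _)
    (zEig_injective hi hr hγ) (mem_Z_iff (seq x.1) x.2)

/-! ### The spaces `V` -/

/-- Labels for the operators whose joint eigenspaces are the spaces `V`. -/
abbrev VLabel (d : ℕ) : Type := {m // m ∈ Finset.range d} ⊕ Unit

/-- The Casimir operators of `[1;i+r+m]` for `m < d`, and `K`, by their labels. -/
def vOp (q : QParam) (γ : ℕ → ℝ) (i r d : ℕ) : VLabel d → Module.End ℂ (H (i + r + d))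
  | .inl m => casimirOp q γ (i + r + d) 1 (i + r + m)
  | .inr _ => weightOp q γ (i + r + d)

/-- The eigenvalue of `vOp` on the space `V` with label `(p, N)`. -/
def vEig (q : QParam) (γ : ℕ → ℝ) (i r d : ℕ) (p : ℕ → ℕ) (N : ℕ) : VLabel d → ℂ
  | .inl m => casimirEigenvalue q (psum p (m + 1)) (gsum γ 1 (i + r + m))
  | .inr _ => qpow q (1 / 2 * ((N : ℝ) + psum p d + gsum γ 1 (i + r + d)))

lemma mem_V_iff (p : ℕ → ℕ) (N : ℕ) (v : H (i + r + d)) :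
    v ∈ V q γ i r d p N ↔ ∀ a, vOp q γ i r d a v = vEig q γ i r d p N a • v := by
  simp only [V, Submodule.mem_inf, Submodule.mem_iInf, Module.End.mem_eigenspace_iff, Sum.forall,
    Subtype.forall, vOp, vEig, forall_const]

/-- The sequence `(|j_{i+r-1}|, j_{i+r}, j_{i+r+1}, ...)`. -/
def contract (i r : ℕ) (j : ℕ → ℕ) (m : ℕ) : ℕ :=
  if m = 1 then psum j (i + r - 1) else j (i + r + m - 2)

lemma psum_contract (j : ℕ → ℕ) (hi : 1 ≤ i) (m : ℕ) :
    psum (contract i r j) (m + 1) = psum j (i + r + m - 1) := by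
  induction m with
  | zero => simp [contract, psum]
  | succ m ih =>
    rw [psum_succ, ih, contract, if_neg (by omega),
      ← psum_pred j (n := i + r + (m + 1) - 1) (by omega)]
    congr 2

/-- The label `(p, N)` of the space `V` that contains `Θ(j, N')`. -/
def vLabel (i r d : ℕ) (x : (Fin (i + r + d - 1) → ℕ) × ℕ) : (Fin d → ℕ) × ℕ :=
  (fun m => contract i r (seq x.1) (m + 1),
    if d = 0 then x.2 + psum (seq x.1) (i + r + d - 1) else x.2 + seq x.1 (i + r + d - 1))

lemma psum_vLabel (hi : 1 ≤ i) (x : (Fin (i + r + d - 1) → ℕ) × ℕ) {m : ℕ} (hm : m < d) :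
    psum (seq (vLabel i r d x).1) (m + 1) = psum (seq x.1) (i + r + m - 1) := by
  rw [← psum_contract (seq x.1) hi m]
  exact psum_congr fun k hk =>
    seq_restrict (contract i r (seq x.1)) k (Finset.Icc_subset_Icc_right hm hk)

lemma vLabel_snd (hi : 1 ≤ i) (x : (Fin (i + r + d - 1) → ℕ) × ℕ) :
    (vLabel i r d x).2 + psum (seq (vLabel i r d x).1) d =
      x.2 + psum (seq x.1) (i + r + d - 1) := by
  rcases d with _ | d
  · rfl
  · rw [psum_vLabel hi x d.lt_succ_self,
      ← psum_pred (seq x.1) (n := i + r + (d + 1) - 1) (by omega)]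
    simp only [vLabel, Nat.succ_ne_zero, if_false]
    rw [show i + r + (d + 1) - 1 - 1 = i + r + d - 1 by omega]
    omega

lemma vOp_Theta (hi : 1 ≤ i) (hr : 1 ≤ r) (hγ : ∀ k ∈ Finset.Icc 1 (i + r + d), 1 / 2 < γ k)
    (a : VLabel d) (x : (Fin (i + r + d - 1) → ℕ) × ℕ) :
    vOp q γ i r d a (Theta q γ i r d (seq x.1) x.2) =
      vEig q γ i r d (seq (vLabel i r d x).1) (vLabel i r d x).2 a •
        Theta q γ i r d (seq x.1) x.2 := by
  rcases a with ⟨m, hm⟩ | _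
  · rw [Finset.mem_range] at hm
    rw [vEig, psum_vLabel hi x hm]
    exact casimirOp_Theta_full hi hr hγ (m := i + r + m) (by omega) (by omega) _ _
  · rw [vEig, ← Nat.cast_add, vLabel_snd hi, Nat.cast_add]
    exact weightOp_Theta hi hr hγ _ _

lemma vEig_injective (hi : 1 ≤ i) (hγ : ∀ k ∈ Finset.Icc 1 (i + r + d), 1 / 2 < γ k)
    (x y : (Fin d → ℕ) × ℕ)
    (h : ∀ a, vEig q γ i r d (seq x.1) x.2 a = vEig q γ i r d (seq y.1) y.2 a) : x = y := by
  obtain ⟨p, N⟩ := x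
  obtain ⟨p', N'⟩ := y
  have hp : p = p' := by
    refine eq_of_psum_seq_eq fun m hm => ?_
    rw [Finset.mem_Icc] at hm
    obtain ⟨m, rfl⟩ := Nat.exists_eq_add_of_le' hm.1
    exact casimirEigenvalue_injective q
      (half_lt_gsum_left hγ (m := i + r + m) (by omega) (by omega)) (h (.inl ⟨m, Finset.mem_range.mpr hm.2⟩))
  subst hp
  have hN := h (.inr ())
  simp only [vEig, add_assoc] at hN
  rw [eq_of_qpow_weight_eq hN]

lemma V_eq_span (hi : 1 ≤ i) (hr : 1 ≤ r) (hγ : ∀ k ∈ Finset.Icc 1 (i + r + d), 1 / 2 < γ k)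
    (k : (Fin d → ℕ) × ℕ) : V q γ i r d (seq k.1) k.2 =
      Submodule.span ℂ (thetaBasis q hi hr hγ '' {x | vLabel i r d x = k}) :=
  span_image_eq_of_joint_eigenspace (E := H (i + r + d)) (thetaBasis q hi hr hγ) (vOp q γ i r d)
    (vLabel i r d) (fun a (k : (Fin d → ℕ) × ℕ) => vEig q γ i r d (seq k.1) k.2 a)
    (fun a x => by rw [thetaBasis_apply]; exact vOp_Theta hi hr hγ a x)
    (vEig_injective hi hγ) (mem_V_iff (seq k.1) k.2)

/-- `B_{p,N}` consists of the basis vectors with label `(p, N)`: the constraint `|j_{i+r-1}| = p_1`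
determines `j_{i+r-1}`, and the remaining freedom is in `j_1, ..., j_{i+r-2}` and in the last entry
`ℓ` of `j` (if `d > 0`). -/
lemma B_eq_image (hi : 1 ≤ i) (hr : 1 ≤ r) (hγ : ∀ k ∈ Finset.Icc 1 (i + r + d), 1 / 2 < γ k)
    (p : Fin d → ℕ) (N : ℕ) : B q γ i r d (seq p) N =
      thetaBasis q hi hr hγ '' {x | vLabel i r d x = (p, N)} := by
  ext v
  simp only [Set.mem_image, thetaBasis_apply]
  rcases Nat.eq_zero_or_pos d with rfl | hd
  · rw [B, if_pos rfl]
    constructor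
    · rintro ⟨j, hj, rfl⟩
      refine ⟨(fun l => j (l + 1), N - psum j (i + r + 0 - 1)), ?_, ?_⟩
      · refine Prod.ext (Subsingleton.elim _ _) ?_
        simp only [vLabel, if_true]
        rw [psum_congr (seq_restrict j)]
        omega
      · exact congrFun (Theta_congr hi hr (seq_restrict j)) _
    · rintro ⟨⟨j, M⟩, hx, rfl⟩
      have hN : M + psum (seq j) (i + r + 0 - 1) = N := congrArg Prod.snd hx
      refine ⟨seq j, by omega, ?_⟩
      congr 1
      omega
  · rw [B, if_neg hd.ne']
    have hn : i + r + d - 1 ∈ Finset.Icc 1 (i + r + d - 1) :=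
      Finset.mem_Icc.mpr ⟨by omega, le_rfl⟩
    constructor
    · rintro ⟨j, l, hj, hl, rfl⟩
      have hlast : indexB i r d (seq p) j l (i + r + d - 1) = l := by
        rw [indexB, if_neg (by omega), if_neg (by omega), if_neg (by omega)]
      refine ⟨(fun k => indexB i r d (seq p) j l (k + 1), N - l), ?_, ?_⟩
      · refine Prod.ext (funext fun m => ?_) ?_
        · have hm := m.2
          simp only [vLabel, contract]
          split_ifs with h0
          · have hm0 : m = ⟨0, hd⟩ := Fin.ext (by simpa using h0)
            have e1 : psum (seq fun k : Fin (i + r + d - 1) => indexB i r d (seq p) j l (k + 1))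
                (i + r - 1) = psum (indexB i r d (seq p) j l) (i + r - 1) :=
              psum_congr fun k hk => seq_restrict _ _ (Finset.Icc_subset_Icc_right (by omega) hk)
            have e2 : psum (indexB i r d (seq p) j l) (i + r - 1 - 1) = psum j (i + r - 2) :=
              psum_congr fun k hk => if_pos (Finset.mem_Icc.mp hk).2
            have e3 : indexB i r d (seq p) j l (i + r - 1) = seq p 1 - psum j (i + r - 2) := by
              rw [indexB, if_neg (by omega), if_pos rfl]
            rw [e1, ← psum_pred _ (by omega), e2, e3, hm0, ← seq_succ p ⟨0, hd⟩]
            simp only [zero_add]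
            omega
          · rw [seq_restrict _ _ (Finset.mem_Icc.mpr ⟨by omega, by omega⟩), indexB,
              if_neg (by omega), if_neg (by omega), if_pos (by omega), ← seq_succ p m]
            congr 1
            omega
        · simp only [vLabel]
          rw [if_neg hd.ne', seq_restrict _ _ hn, hlast]
          omega
      · exact congrFun (Theta_congr hi hr (seq_restrict (indexB i r d (seq p) j l))) _
    · rintro ⟨⟨j, M⟩, hx, rfl⟩
      have hN : (if d = 0 then M + psum (seq j) (i + r + d - 1)
        else M + seq j (i + r + d - 1)) = N := congrArg Prod.snd hx
      rw [if_neg hd.ne'] at hN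
      have hp : ∀ m < d, contract i r (seq j) (m + 1) = seq p (m + 1) := fun m hm =>
        (congrFun (congrArg Prod.fst hx) ⟨m, hm⟩).trans (seq_succ p ⟨m, hm⟩).symm
      have hp1 : psum (seq j) (i + r - 1) = seq p 1 := hp 0 hd
      have hpred := psum_pred (seq j) (n := i + r - 1) (by omega)
      rw [show i + r - 1 - 1 = i + r - 2 by omega, hp1] at hpred
      refine ⟨seq j, seq j (i + r + d - 1), by omega, by omega, ?_⟩
      have hM : M = N - seq j (i + r + d - 1) := by omega
      have hj : ∀ k ∈ Finset.Icc 1 (i + r + d - 1),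
          seq j k = indexB i r d (seq p) (seq j) (seq j (i + r + d - 1)) k := by
        intro k hk
        rw [Finset.mem_Icc] at hk
        rw [indexB]
        split_ifs with h1 h2 h3
        · rfl
        · rw [h2]
          omega
        · have := hp (k + 2 - (i + r) - 1) (by omega)
          rw [contract, if_neg (by omega)] at this
          rw [show k + 2 - (i + r) - 1 + 1 = k + 2 - (i + r) by omega] at this
          rw [← this]
          congr 1
          omega
        · congr 1
          omega
      simp only
      rw [← hM, ← Theta_congr hi hr hj]

/-! ### Normalization -/

/-- The factor that normalizes `Θ(j, N)`. -/
def ketScale (q : QParam) (γ : ℕ → ℝ) (i r d : ℕ) (j : ℕ → ℕ) (N : ℕ) : ℝ :=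
  (Real.sqrt (braket (Theta q γ i r d j N) (Theta q γ i r d j N)).re)⁻¹

lemma ket_eq (j : ℕ → ℕ) (N : ℕ) :
    ket q γ i r d j N = (ketScale q γ i r d j N : ℂ) • Theta q γ i r d j N := rfl

lemma ketScale_ne_zero (hi : 1 ≤ i) (hr : 1 ≤ r)
    (hγ : ∀ k ∈ Finset.Icc 1 (i + r + d), 1 / 2 < γ k) (j : ℕ → ℕ) (N : ℕ) :
    (ketScale q γ i r d j N : ℂ) ≠ 0 := by
  rw [Complex.ofReal_ne_zero]
  exact inv_ne_zero (Real.sqrt_ne_zero'.mpr (braket_self_re_pos (Theta_ne_zero hi hr hγ j N)))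

lemma braket_ket_self (hi : 1 ≤ i) (hr : 1 ≤ r)
    (hγ : ∀ k ∈ Finset.Icc 1 (i + r + d), 1 / 2 < γ k) (j : ℕ → ℕ) (N : ℕ) :
    braket (ket q γ i r d j N) (ket q γ i r d j N) = 1 := by
  have hpos := braket_self_re_pos (Theta_ne_zero (q := q) hi hr hγ j N)
  rw [ket_eq, braket_smul_left, braket_smul_right, Complex.conj_ofReal, braket_self_eq_re,
    ← Complex.ofReal_mul, ← Complex.ofReal_mul, ketScale, ← mul_assoc, ← mul_inv,
    Real.mul_self_sqrt hpos.le, inv_mul_cancel₀ hpos.ne', Complex.ofReal_one]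

lemma braket_ket_eq_zero (hi : 1 ≤ i) (hr : 1 ≤ r) {t : ℝ} (ht : 0 < t) (hq : q.val = t)
    (hγ : ∀ k ∈ Finset.Icc 1 (i + r + d), 1 / 2 < γ k) {x y : (Fin (i + r + d - 1) → ℕ) × ℕ}
    (hxy : x ≠ y) :
    braket (ket q γ i r d (seq x.1) x.2) (ket q γ i r d (seq y.1) y.2) = 0 := by
  rw [ket_eq, ket_eq, braket_smul_left, braket_smul_right, braket_Theta_eq_zero hi hr ht hq hγ hxy,
    mul_zero, mul_zero]

/-- The basis of normalized vectors. -/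
def ketBasis (q : QParam) (hi : 1 ≤ i) (hr : 1 ≤ r)
    (hγ : ∀ k ∈ Finset.Icc 1 (i + r + d), 1 / 2 < γ k) :
    Module.Basis ((Fin (i + r + d - 1) → ℕ) × ℕ) ℂ (H (i + r + d)) :=
  (thetaBasis q hi hr hγ).unitsSMul fun x =>
    Units.mk0 (ketScale q γ i r d (seq x.1) x.2 : ℂ) (ketScale_ne_zero hi hr hγ _ _)

lemma ketBasis_apply (hi : 1 ≤ i) (hr : 1 ≤ r)
    (hγ : ∀ k ∈ Finset.Icc 1 (i + r + d), 1 / 2 < γ k) (x : (Fin (i + r + d - 1) → ℕ) × ℕ) :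
    ketBasis q hi hr hγ x = ket q γ i r d (seq x.1) x.2 := by
  rw [ketBasis, Module.Basis.unitsSMul_apply, thetaBasis_apply, ket_eq]
  rfl

lemma ket_ne_zero (hi : 1 ≤ i) (hr : 1 ≤ r)
    (hγ : ∀ k ∈ Finset.Icc 1 (i + r + d), 1 / 2 < γ k) (j : ℕ → ℕ) (N : ℕ) :
    ket q γ i r d j N ≠ 0 :=
  smul_ne_zero (ketScale_ne_zero hi hr hγ j N) (Theta_ne_zero hi hr hγ j N)

lemma Z_eq_span_ket (hi : 1 ≤ i) (hr : 1 ≤ r) (hγ : ∀ k ∈ Finset.Icc 1 (i + r + d), 1 / 2 < γ k)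
    (x : (Fin (i + r + d - 1) → ℕ) × ℕ) : Z q γ i r d (seq x.1) x.2 =
      Submodule.span ℂ {ket q γ i r d (seq x.1) x.2} := by
  rw [Z_eq_span hi hr hγ, ket_eq,
    Submodule.span_singleton_smul_eq (IsUnit.mk0 _ (ketScale_ne_zero hi hr hγ _ _)),
    Set.ofPred_eq_eq_singleton, Set.image_singleton, thetaBasis_apply]

lemma finrank_Z (hi : 1 ≤ i) (hr : 1 ≤ r) (hγ : ∀ k ∈ Finset.Icc 1 (i + r + d), 1 / 2 < γ k)
    (x : (Fin (i + r + d - 1) → ℕ) × ℕ) :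
    Module.finrank ℂ (Z q γ i r d (seq x.1) x.2) = 1 := by
  rw [Z_eq_span_ket hi hr hγ]
  exact finrank_span_singleton (V := H (i + r + d)) (ket_ne_zero hi hr hγ _ _)

lemma isInternal_V (hi : 1 ≤ i) (hr : 1 ≤ r)
    (hγ : ∀ k ∈ Finset.Icc 1 (i + r + d), 1 / 2 < γ k) :
    DirectSum.IsInternal (fun x : (Fin d → ℕ) × ℕ => V q γ i r d (seq x.1) x.2) :=
  isInternal_span_fibers (E := H (i + r + d)) (thetaBasis q hi hr hγ) (vLabel i r d)
    (fun x : (Fin d → ℕ) × ℕ => V q γ i r d (seq x.1) x.2) (V_eq_span hi hr hγ)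

lemma isInternal_Z (hi : 1 ≤ i) (hr : 1 ≤ r)
    (hγ : ∀ k ∈ Finset.Icc 1 (i + r + d), 1 / 2 < γ k) :
    DirectSum.IsInternal (fun x : (Fin (i + r + d - 1) → ℕ) × ℕ =>
      Z q γ i r d (seq x.1) x.2) :=
  isInternal_span_fibers (E := H (i + r + d)) (thetaBasis q hi hr hγ) id
    (fun x : (Fin (i + r + d - 1) → ℕ) × ℕ => Z q γ i r d (seq x.1) x.2) (Z_eq_span hi hr hγ)

end

end QBI

theorem mainTheorem3 (q : QBI.QParam) (γ : ℕ → ℝ) (i r d : ℕ) (hi : 1 ≤ i) (hr : 1 ≤ r)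
    (hγ : ∀ k ∈ Finset.Icc 1 (i + r + d), 1 / 2 < γ k) :
    -- the vectors `|j; N⟩` form a basis of normalized vectors, orthonormal for real `q > 0`
    (LinearIndependent ℂ (fun x : (Fin (i + r + d - 1) → ℕ) × ℕ =>
        QBI.ket q γ i r d (QBI.seq x.1) x.2) ∧
      Submodule.span ℂ (Set.range (fun x : (Fin (i + r + d - 1) → ℕ) × ℕ =>
        QBI.ket q γ i r d (QBI.seq x.1) x.2)) = ⊤ ∧
      (∀ (j : Fin (i + r + d - 1) → ℕ) (N : ℕ),
        QBI.braket (QBI.ket q γ i r d (QBI.seq j) N) (QBI.ket q γ i r d (QBI.seq j) N) = 1) ∧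
      ((∃ x : ℝ, 0 < x ∧ q.val = x) →
        ∀ (j j' : Fin (i + r + d - 1) → ℕ) (N N' : ℕ), (j, N) ≠ (j', N') →
          QBI.braket (QBI.ket q γ i r d (QBI.seq j) N)
            (QBI.ket q γ i r d (QBI.seq j') N') = 0)) ∧
    -- the module is the direct sum of the spaces `V_{N,p}`
    DirectSum.IsInternal (fun x : (Fin d → ℕ) × ℕ => QBI.V q γ i r d (QBI.seq x.1) x.2) ∧
    -- `B_{p,N}` is a basis of `V_{N,p}`, orthogonal for real `q > 0`
    (∀ (p : Fin d → ℕ) (N : ℕ),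
      LinearIndepOn ℂ id (QBI.B q γ i r d (QBI.seq p) N) ∧
      Submodule.span ℂ (QBI.B q γ i r d (QBI.seq p) N) = QBI.V q γ i r d (QBI.seq p) N ∧
      ((∃ x : ℝ, 0 < x ∧ q.val = x) →
        (QBI.B q γ i r d (QBI.seq p) N).Pairwise fun u v => QBI.braket u v = 0)) ∧
    -- the module is the direct sum of the spaces `Z_{N,j}`
    DirectSum.IsInternal (fun x : (Fin (i + r + d - 1) → ℕ) × ℕ =>
      QBI.Z q γ i r d (QBI.seq x.1) x.2) ∧
    -- `Z_{N,j}` is the line spanned by `|j; N⟩`; so a normalized solution of the eigenvalue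
    -- equations is `|j; N⟩` up to a phase
    (∀ (j : Fin (i + r + d - 1) → ℕ) (N : ℕ),
      Module.finrank ℂ (QBI.Z q γ i r d (QBI.seq j) N) = 1 ∧
      QBI.Z q γ i r d (QBI.seq j) N = Submodule.span ℂ {QBI.ket q γ i r d (QBI.seq j) N} ∧
      ∀ v ∈ QBI.Z q γ i r d (QBI.seq j) N, QBI.braket v v = 1 →
        ∃ c : ℂ, ‖c‖ = 1 ∧ v = c • QBI.ket q γ i r d (QBI.seq j) N) := by
  have hket : (fun x : (Fin (i + r + d - 1) → ℕ) × ℕ => QBI.ket q γ i r d (QBI.seq x.1) x.2) =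
      QBI.ketBasis q hi hr hγ := funext fun x => (QBI.ketBasis_apply hi hr hγ x).symm
  refine ⟨⟨?_, ?_, ?_, ?_⟩, ?_, ?_, ?_, ?_⟩
  · rw [hket]
    exact (QBI.ketBasis q hi hr hγ).linearIndependent
  · rw [hket]
    exact (QBI.ketBasis q hi hr hγ).span_eq
  · exact fun j N => QBI.braket_ket_self hi hr hγ _ N
  · rintro ⟨t, ht, hq⟩ j j' N N' h
    exact QBI.braket_ket_eq_zero hi hr ht hq hγ (x := (j, N)) (y := (j', N')) h
  · exact QBI.isInternal_V hi hr hγ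
  · intro p N
    rw [QBI.V_eq_span hi hr hγ (p, N), QBI.B_eq_image hi hr hγ]
    refine ⟨?_, rfl, ?_⟩
    · exact (QBI.thetaBasis q hi hr hγ).linearIndependent.linearIndepOn_id.mono
        (Set.image_subset_range _ _)
    · rintro ⟨t, ht, hq⟩ _ ⟨x, _, rfl⟩ _ ⟨y, _, rfl⟩ hxy
      rw [QBI.thetaBasis_apply, QBI.thetaBasis_apply]
      exact QBI.braket_Theta_eq_zero hi hr ht hq hγ fun h => hxy (by rw [h])
  · exact QBI.isInternal_Z hi hr hγ
  · intro j N
    have hZ := QBI.Z_eq_span_ket (q := q) hi hr hγ (j, N)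
    have hone := QBI.braket_ket_self (q := q) hi hr hγ (QBI.seq j) N
    refine ⟨?_, hZ, fun v hv hvv => ?_⟩
    · exact QBI.finrank_Z hi hr hγ (j, N)
    · rw [hZ, Submodule.mem_span_singleton] at hv
      obtain ⟨c, rfl⟩ := hv
      refine ⟨c, ?_, rfl⟩
      rw [QBI.braket_smul_left, QBI.braket_smul_right, hone, mul_one,
        ← Complex.normSq_eq_conj_mul_self, Complex.ofReal_eq_one, Complex.normSq_eq_norm_sq] at hvv
      exact (pow_eq_one_iff_of_nonneg (norm_nonneg c) two_ne_zero).mp hvv
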